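/- **Setting.** There are $n$ advertisers and $m$ positions, and at most $K\le m$ ads may be shown. The set $\mathcal X$ of feasible allocations consists of the matrices $x\in\{0,1\}^{n\times m}$ with $\sum_j x_{ij}\le 1$ for all $i$, $\sum_i x_{ij}\le 1$ for all $j$ and $\sum_{i,j}x_{ij}\le K$. Standalone click-through rates $p_{ij}\in(0,1)$ are given; with log-odds $\rho_{ij}=\log\frac{p_{ij}}{1-p_{ij}}$, the click-through rate of advertiser $i$ in the multinomial-logit (MNL) model is $$\pi_i(x)=\frac{\sum_j x_{ij}e^{\rho_{ij}}}{1+\sum_{i',j}x_{i'j}e^{\rho_{i'j}}}.$$ Advertiser $i$ has a private value $v_i\ge0$ per click; the values are independent, $v_i$ having density $f_i$ and distribution function $F_i$ on $[0,\infty)$. A (direct) mechanism maps reports $v\in\mathbb R_+^n$ measurably to a lottery over $\mathcal X$ and to payments $t(v)\in\mathbb R_+^n$; let $y_i(v)$ be the resulting expected click-through rate of $i$. With reports $\hat v$ and true value $w$, advertiser $i$ has utility $u_i(\hat v,w)=w\,y_i(\hat v)-t_i(\hat v)$. The mechanism is IC (respectively $\epsilon$-IC) if $u_i((w,\hat v_{-i}),w)\ge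 u_i(\hat v,w)$ (respectively $\ge u_i(\hat v,w)-\epsilon$) for all $i,\hat v,w$, and IR if always $u_i((w,\hat v_{-i}),w)\ge0$. Its welfare is $\mathbb E_v[\sum_i v_iy_i(v)]$ and its revenue is $\mathbb E_v[\sum_i t_i(v)]$. The virtual value is $\phi_i(v)=v-\frac{1-F_i(v)}{f_i(v)}$ (read as $-\infty$ where $f_i(v)=0$ and $F_i(v)<1$, and as $v$ where $f_i(v)=0$ and $F_i(v)=1$; $0\cdot(-\infty)=0$). Running time is counted in a real-number model of computation (real RAM): a step is an exact arithmetic operation, a comparison, a memory access, an index operation or, in part 2 only, an exact evaluation of some $F_i$ or $f_i$. One program, not depending on the instance, serves all instances: from $n,m,K,p$, the reports (and $\epsilon$ in part 2) it outputs the chosen allocation and all payments. **Theorem (optimal auctions in the MNL model).** 1. There are a program and a polynomial $P$ such that for all $n,m,K,p$ the program computes, in at most $P(n+m)$ steps on every report vector, a mechanism that is IC and IR, whose allocation satisfies $\sum_i v_iy_i(v)=\max_{x\in\mathcal X}\sum_i v_i\pi_i(x)$ for every $v\in\mathbb R_+^n$, and whose welfare is, for every choice of value distributions, at least that of every IC and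 IR mechanism. 2. There are a program with access to the $F_i$ and $f_i$ and a polynomial $P$ such that for all $n,m,K,p$, all value distributions with finite means and non-decreasing virtual values, and all $\epsilon>0$, the program computes, in at most $P\big(n+m+\lceil \max_i v_i/\epsilon\rceil\big)$ steps on every report vector $v$, a mechanism that is $\epsilon$-IC and IR, whose allocation satisfies $\sum_i \phi_i(v_i)y_i(v)=\max_{x\in\mathcal X}\sum_i\phi_i(v_i)\pi_i(x)$ for every $v\in\mathbb R_+^n$, whose payments differ from the Myerson payments $v_iy_i(v)-\int_0^{v_i}y_i(z,v_{-i})\,dz$ by at most $\epsilon$, and whose revenue is at least that of every IC and IR mechanism. -/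

import Mathlib

open MeasureTheory
open scoped NNReal ENNReal

noncomputable section

/-! ## A real-number model of computation

A real RAM with a step count: finite, constant-free programs that are uniform in the size of the
input, with exact arithmetic and comparisons on real numbers, index arithmetic on natural numbers,
indirect addressing, and exact evaluation of the advertisers' distribution functions and densities
as an oracle.  There is no rounding, no conversion from reals to indices, and no multiplication of
indices. -/

namespace RealRAM

/-- The memory: for each array name, an unbounded two-dimensional array of natural numbers
(indices, counters, flags) and one of real numbers. A scalar variable is the cell `(0, 0)`. -/
structure Store where
  nat : ℕ → ℕ → ℕ → ℕ
  real : ℕ → ℕ → ℕ → ℝ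

/-- Access to the value distributions: `cdf i x` and `pdf i x` for advertiser number `i`. -/
structure Oracle where
  cdf : ℕ → ℝ → ℝ
  pdf : ℕ → ℝ → ℝ

/-- The oracle without information, for prior-free computations. -/
def Oracle.none : Oracle where
  cdf := fun _ _ => 0
  pdf := fun _ _ => 0

/-- Index expressions. `get a i j` reads cell `(i, j)` of the natural-number array `a`. -/
inductive NatExpr where
  | const (k : ℕ)
  | get (a : ℕ) (i j : NatExpr)
  | add (e₁ e₂ : NatExpr)
  | sub (e₁ e₂ : NatExpr)

/-- Real expressions. `get a i j` reads cell `(i, j)` of the real array `a`. -/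
inductive RealExpr where
  | const (k : ℕ)
  | get (a : ℕ) (i j : NatExpr)
  | add (e₁ e₂ : RealExpr)
  | sub (e₁ e₂ : RealExpr)
  | mul (e₁ e₂ : RealExpr)
  | div (e₁ e₂ : RealExpr)
  | cdf (i : NatExpr) (x : RealExpr)
  | pdf (i : NatExpr) (x : RealExpr)

/-- Tests. -/
inductive Test where
  | natLe (e₁ e₂ : NatExpr)
  | realLe (e₁ e₂ : RealExpr)
  | not (b : Test)
  | and (b₁ b₂ : Test)

/-- Programs. -/
inductive Prog where
  | skip
  | setNat (a : ℕ) (i j e : NatExpr)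
  | setReal (a : ℕ) (i j : NatExpr) (e : RealExpr)
  | seq (c₁ c₂ : Prog)
  | branch (b : Test) (c₁ c₂ : Prog)
  | loop (b : Test) (c : Prog)

def NatExpr.value (s : Store) : NatExpr → ℕ
  | .const k => k
  | .get a i j => s.nat a (i.value s) (j.value s)
  | .add e₁ e₂ => e₁.value s + e₂.value s
  | .sub e₁ e₂ => e₁.value s - e₂.value s

def RealExpr.value (O : Oracle) (s : Store) : RealExpr → ℝ
  | .const k => (k : ℝ)
  | .get a i j => s.real a (i.value s) (j.value s)
  | .add e₁ e₂ => e₁.value O s + e₂.value O s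
  | .sub e₁ e₂ => e₁.value O s - e₂.value O s
  | .mul e₁ e₂ => e₁.value O s * e₂.value O s
  | .div e₁ e₂ => e₁.value O s / e₂.value O s
  | .cdf i x => O.cdf (i.value s) (x.value O s)
  | .pdf i x => O.pdf (i.value s) (x.value O s)

def Test.Holds (O : Oracle) (s : Store) : Test → Prop
  | .natLe e₁ e₂ => e₁.value s ≤ e₂.value s
  | .realLe e₁ e₂ => e₁.value O s ≤ e₂.value O s
  | .not b => ¬ b.Holds O s
  | .and b₁ b₂ => b₁.Holds O s ∧ b₂.Holds O s

/-- Overwrite one cell of a natural-number array. -/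
def Store.writeNat (s : Store) (a i j k : ℕ) : Store where
  nat := fun a' i' j' => if a' = a ∧ i' = i ∧ j' = j then k else s.nat a' i' j'
  real := s.real

/-- Overwrite one cell of a real array. -/
def Store.writeReal (s : Store) (a i j : ℕ) (x : ℝ) : Store where
  nat := s.nat
  real := fun a' i' j' => if a' = a ∧ i' = i ∧ j' = j then x else s.real a' i' j'

/-- `Exec O c s t s'`: started in `s` with oracle `O`, the program `c` halts in `s'` after exactly
`t` steps. Each assignment and each evaluation of a test is one step; the expressions that occur in
a fixed program have bounded size, so this counts arithmetic operations, comparisons, memory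
accesses and oracle calls up to a constant factor. -/
inductive Exec (O : Oracle) : Prog → Store → ℕ → Store → Prop where
  | skip (s : Store) : Exec O .skip s 1 s
  | setNat (a : ℕ) (i j e : NatExpr) (s : Store) :
      Exec O (.setNat a i j e) s 1 (s.writeNat a (i.value s) (j.value s) (e.value s))
  | setReal (a : ℕ) (i j : NatExpr) (e : RealExpr) (s : Store) :
      Exec O (.setReal a i j e) s 1 (s.writeReal a (i.value s) (j.value s) (e.value O s))
  | seq {c₁ c₂ : Prog} {s s' s'' : Store} {t₁ t₂ : ℕ} (h₁ : Exec O c₁ s t₁ s')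
      (h₂ : Exec O c₂ s' t₂ s'') : Exec O (.seq c₁ c₂) s (t₁ + t₂) s''
  | branch_true {b : Test} {c₁ c₂ : Prog} {s s' : Store} {t : ℕ} (hb : b.Holds O s)
      (h : Exec O c₁ s t s') : Exec O (.branch b c₁ c₂) s (t + 1) s'
  | branch_false {b : Test} {c₁ c₂ : Prog} {s s' : Store} {t : ℕ} (hb : ¬ b.Holds O s)
      (h : Exec O c₂ s t s') : Exec O (.branch b c₁ c₂) s (t + 1) s'
  | loop_true {b : Test} {c : Prog} {s s' s'' : Store} {t₁ t₂ : ℕ} (hb : b.Holds O s)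
      (h₁ : Exec O c s t₁ s') (h₂ : Exec O (.loop b c) s' t₂ s'') :
      Exec O (.loop b c) s (t₁ + t₂ + 1) s''
  | loop_false {b : Test} {c : Prog} {s : Store} (hb : ¬ b.Holds O s) :
      Exec O (.loop b c) s 1 s

end RealRAM

/-! ## Position auctions under the multinomial logit model -/

/-- The public data of a position auction with `n` advertisers and `m` positions: the maximal
number `K` of ads that may be shown and the standalone click-through rates, which lie strictly
between `0` and `1` so that their log-odds are defined. -/
structure PositionAuction (n m : ℕ) where
  K : ℕ
  K_le : K ≤ m
  p : Fin n → Fin m → ℝ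
  p_pos : ∀ i j, 0 < p i j
  p_lt_one : ∀ i j, p i j < 1

namespace PositionAuction

variable {n m : ℕ} (A : PositionAuction n m)

/-- Feasible allocations: 0-1 matrices that assign at most one position to each advertiser and at
most one advertiser to each position, and that fill at most `K` positions. -/
def Allocation : Type :=
  {x : Fin n → Fin m → Fin 2 //
    (∀ i, ∑ j, (x i j : ℕ) ≤ 1) ∧ (∀ j, ∑ i, (x i j : ℕ) ≤ 1) ∧ ∑ i, ∑ j, (x i j : ℕ) ≤ A.K}

instance : Fintype A.Allocation :=
  inferInstanceAs (Fintype {x : Fin n → Fin m → Fin 2 //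
    (∀ i, ∑ j, (x i j : ℕ) ≤ 1) ∧ (∀ j, ∑ i, (x i j : ℕ) ≤ 1) ∧ ∑ i, ∑ j, (x i j : ℕ) ≤ A.K})

/-- The log-odds of showing advertiser `i` in position `j`. -/
def logOdds (i : Fin n) (j : Fin m) : ℝ := Real.log (A.p i j / (1 - A.p i j))

/-- The click-through rate of advertiser `i` in the multinomial logit model. -/
def clickRate (x : A.Allocation) (i : Fin n) : ℝ :=
  (∑ j, (x.1 i j : ℕ) * Real.exp (A.logOdds i j)) /
    (1 + ∑ i', ∑ j, (x.1 i' j : ℕ) * Real.exp (A.logOdds i' j))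

/-- A direct mechanism: to each vector of reported values it assigns a lottery over allocations
and a non-negative expected payment of each advertiser, all measurable in the reports. -/
structure Mechanism where
  prob : (Fin n → ℝ≥0) → A.Allocation → ℝ≥0
  prob_sum : ∀ v, ∑ x, prob v x = 1
  pay : (Fin n → ℝ≥0) → Fin n → ℝ≥0
  measurable_prob : ∀ x, Measurable fun v => prob v x
  measurable_pay : ∀ i, Measurable fun v => pay v i

namespace Mechanism

variable {A} (M : A.Mechanism)

/-- The total click probability of advertiser `i` when the reports are `v`. -/
def clickProb (v : Fin n → ℝ≥0) (i : Fin n) : ℝ := ∑ x, (M.prob v x : ℝ) * A.clickRate x i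

/-- The expected utility of advertiser `i` with true value `w` when the reports are `r`. -/
def utility (i : Fin n) (r : Fin n → ℝ≥0) (w : ℝ≥0) : ℝ := w * M.clickProb r i - M.pay r i

/-- Dominant-strategy incentive compatibility up to an additive loss `ε`. -/
def IsApproxIC (ε : ℝ) : Prop :=
  ∀ (i : Fin n) (r : Fin n → ℝ≥0) (w : ℝ≥0),
    M.utility i r w ≤ M.utility i (Function.update r i w) w + ε

/-- Dominant-strategy incentive compatibility. -/
def IsIC : Prop :=
  ∀ (i : Fin n) (r : Fin n → ℝ≥0) (w : ℝ≥0),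
    M.utility i r w ≤ M.utility i (Function.update r i w) w

/-- Individual rationality. -/
def IsIR : Prop :=
  ∀ (i : Fin n) (r : Fin n → ℝ≥0) (w : ℝ≥0), 0 ≤ M.utility i (Function.update r i w) w

end Mechanism

end PositionAuction

/-- An absolutely continuous distribution on `[0, ∞)`, given by its density. -/
structure ValueDist where
  pdf : ℝ≥0 → ℝ≥0
  measurable_pdf : Measurable pdf
  lintegral_pdf : ∫⁻ x : ℝ in Set.Ici 0, (pdf x.toNNReal : ℝ≥0∞) = 1

namespace ValueDist

variable (D : ValueDist)

/-- The distribution itself, as a measure on `[0, ∞)`. -/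
def law : Measure ℝ≥0 :=
  (Measure.map Real.toNNReal ((volume : Measure ℝ).restrict (Set.Ici 0))).withDensity
    fun v => (D.pdf v : ℝ≥0∞)

/-- The cumulative distribution function. -/
def cdf (v : ℝ≥0) : ℝ≥0∞ := D.law (Set.Iic v)

/-- The virtual value `v - (1 - F v) / f v`. The conventions of `ℝ≥0∞` give it the usual meaning
outside the support: it is `-∞` where `f v = 0` and `F v < 1`, and `v` where `f v = 0` and
`F v = 1`. -/
def virtualValue (v : ℝ≥0) : EReal :=
  ((v : ℝ) : EReal) - (((1 - D.cdf v) / (D.pdf v : ℝ≥0∞) : ℝ≥0∞) : EReal)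

/-- Regularity: virtual values are non-decreasing. -/
def IsRegular : Prop := Monotone D.virtualValue

/-- The expected value is finite. -/
def HasFiniteMean : Prop := ∫⁻ v, (v : ℝ≥0∞) ∂D.law < ∞

end ValueDist

namespace PositionAuction

variable {n m : ℕ} {A : PositionAuction n m}

/-- Expected welfare when the values are drawn independently from `D`. -/
def Mechanism.welfare (M : A.Mechanism) (D : Fin n → ValueDist) : ℝ≥0∞ :=
  ∫⁻ v, ENNReal.ofReal (∑ i, (v i : ℝ) * M.clickProb v i) ∂Measure.pi fun i => (D i).law

/-- Expected revenue when the values are drawn independently from `D`. -/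
def Mechanism.revenue (M : A.Mechanism) (D : Fin n → ValueDist) : ℝ≥0∞ :=
  ∫⁻ v, ∑ i, (M.pay v i : ℝ≥0∞) ∂Measure.pi fun i => (D i).law

/-- Oracle access to the distribution functions and densities of the values. -/
def priorOracle (D : Fin n → ValueDist) : RealRAM.Oracle where
  cdf := fun i x => if h : i < n ∧ 0 ≤ x then ((D ⟨i, h.1⟩).cdf ⟨x, h.2⟩).toReal else 0
  pdf := fun i x => if h : i < n ∧ 0 ≤ x then ((D ⟨i, h.1⟩).pdf ⟨x, h.2⟩ : ℝ) else 0

/-- The initial memory. Natural-number array `0` holds `n`, `m`, `K` in row `0`; real array `0`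
holds the standalone click-through rates, real array `1` the reports (in column `0`), and cell
`(0, 0)` of real array `2` the accuracy parameter. All other cells are zero. -/
def input (A : PositionAuction n m) (v : Fin n → ℝ≥0) (ε : ℝ) : RealRAM.Store where
  nat := fun a i j =>
    if a = 0 ∧ i = 0 ∧ j = 0 then n
    else if a = 0 ∧ i = 0 ∧ j = 1 then m
    else if a = 0 ∧ i = 0 ∧ j = 2 then A.K
    else 0
  real := fun a i j =>
    if a = 0 then (if h : i < n ∧ j < m then A.p ⟨i, h.1⟩ ⟨j, h.2⟩ else 0)
    else if a = 1 ∧ j = 0 then (if h : i < n then (v ⟨i, h⟩ : ℝ) else 0)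
    else if a = 2 ∧ i = 0 ∧ j = 0 then ε
    else 0

/-- On the reports `v`, the program `c` halts after at most `T` steps and outputs the outcome of
`M`: an allocation, which `M` chooses with probability one, in natural-number array `1`, and the
payments in real array `3` (in column `0`). -/
def Mechanism.ComputedBy (M : A.Mechanism) (c : RealRAM.Prog) (O : RealRAM.Oracle) (ε : ℝ)
    (v : Fin n → ℝ≥0) (T : ℕ) : Prop :=
  ∃ (t : ℕ) (s : RealRAM.Store) (x : A.Allocation),
    RealRAM.Exec O c (A.input v ε) t s ∧ t ≤ T ∧ M.prob v x = 1 ∧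
      (∀ (i : Fin n) (j : Fin m), s.nat 1 i j = (x.1 i j : ℕ)) ∧ ∀ i : Fin n, s.real 3 i 0 = (M.pay v i : ℝ)

end PositionAuction

end

/-! # Optimal auctions in the multinomial logit model

Click-through rates enter the model through the odds `a i j = p i j / (1 - p i j)`, so the
weighted welfare of an allocation is a ratio of two linear functions of its 0-1 matrix, the
denominator being `1` plus the total odds of the ads shown.

*Optimization.* The best ratio is found by Newton's method (Dinkelbach's algorithm): for the
current value `R`, solve the assignment problem with edge weights `a i j * (w i - R)`, and replace
`R` by the ratio of its solution. The assignment problem is solved by a primal-dual algorithm that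
keeps the dual variables of all free rows equal; their common value is the dual price of the limit
`K` on the number of ads (`MatchState.final_spec`). The number of Newton steps is bounded by a
polynomial in the number `e` of edges alone, not in the size of the real numbers involved. Each
step divides the product of the parametric optimum and the denominator by at least `4`, and up to
a factor `e + 1` each denominator is one of `e + 1` fixed numbers, so a long run would contain
many solutions with comparable denominators, whose deficits at a common parameter decrease very
fast. These deficits are 0-1 sums of the same `e + 1` reals, and by Siegel's lemma
(`exists_small_int_relation`) `e + 2` such sums satisfy a linear relation with small integer
coefficients, which rules out so fast a decrease (`exists_newton_nonpos`). The result is a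
function `PositionAuction.best` of the weights, so that ties are always broken in the same way,
and no advertiser with a nonpositive weight is ever shown.

*Welfare.* With the reports as weights, the Vickrey-Clarke-Groves payments need the optimal values
for all advertisers and without each single one, hence `n + 1` optimizations (`runs_vcg`).
Optimality of the allocation gives incentive compatibility and individual rationality.

*Revenue.* The weights are the virtual values, replaced by `0` where they are `-∞`. Regularity
makes the click-through rate of an advertiser a monotone function of its report, and the program
subtracts from the value of the clicks a lower Riemann sum of that function with cells of width
`ε`. It misses the integral by at most `ε`, and never exceeds it; hence the auction is incentive
compatible up to `ε`, individually rational, and charges at least the Myerson payments. For the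
comparison of revenues (`Mechanism.revenue_le`) every incentive compatible and individually
rational mechanism satisfies the envelope inequality, and Tonelli's theorem in each coordinate
turns the expected area under the curve of click probabilities into the expectation of the inverse
hazard rate times the click probability. The inequalities are kept additive in `ℝ≥0∞`, where the
infinite inverse hazard rates are harmless; finite means are what allows the final cancellation.

*Programs.* Programs are verified by triples `Runs O c s T Q` for total correctness within `T` steps, with a frame rule saying which arrays a program leaves alone. A mechanism must depend
measurably on the reports; this holds for every program that always halts, as its output is the
limit of the outputs of its truncated evaluations (`MeasurableStore.of_exec`). -/

noncomputable section

namespace RealRAM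

/-! ### Semantics of programs: evaluation, frames, timed total correctness -/

@[simp] theorem Store.writeNat_nat (s : Store) (a i j k a' i' j' : ℕ) :
    (s.writeNat a i j k).nat a' i' j' = if a' = a ∧ i' = i ∧ j' = j then k else s.nat a' i' j' :=
  rfl

@[simp] theorem Store.writeNat_real (s : Store) (a i j k : ℕ) :
    (s.writeNat a i j k).real = s.real := rfl

@[simp] theorem Store.writeReal_nat (s : Store) (a i j : ℕ) (x : ℝ) :
    (s.writeReal a i j x).nat = s.nat := rfl

@[simp] theorem Store.writeReal_real (s : Store) (a i j : ℕ) (x : ℝ) (a' i' j' : ℕ) :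
    (s.writeReal a i j x).real a' i' j' =
      if a' = a ∧ i' = i ∧ j' = j then x else s.real a' i' j' := rfl

attribute [simp] NatExpr.value RealExpr.value Test.Holds

open Classical in
/-- Fuelled evaluation: every loop is unrolled `k` times, with the body idle once the test
fails. A total function, which agrees with `Exec` as soon as `k` is at least the running time. -/
def Prog.eval (O : Oracle) (k : ℕ) : Prog → Store → Store
  | .skip, s => s
  | .setNat a i j e, s => s.writeNat a (i.value s) (j.value s) (e.value s)
  | .setReal a i j e, s => s.writeReal a (i.value s) (j.value s) (e.value O s)
  | .seq c₁ c₂, s => c₂.eval O k (c₁.eval O k s)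
  | .branch b c₁ c₂, s => if b.Holds O s then c₁.eval O k s else c₂.eval O k s
  | .loop b c, s => (fun s => if b.Holds O s then c.eval O k s else s)^[k] s

open Classical in
theorem Exec.eval_eq_aux {O : Oracle} {c : Prog} {s s' : Store} {t : ℕ} (h : Exec O c s t s') :
    ∀ k, t ≤ k → c.eval O k s = s' ∧ ∀ b c₀, c = .loop b c₀ → ∀ l, t ≤ l →
      (fun s => if b.Holds O s then c₀.eval O k s else s)^[l] s = s' := by
  induction h with
  | skip s => intro k hk; simp [Prog.eval]
  | setNat a i j e s => intro k hk; simp [Prog.eval]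
  | setReal a i j e s => intro k hk; simp [Prog.eval]
  | seq h₁ h₂ ih₁ ih₂ =>
    intro k hk
    simp [Prog.eval, (ih₁ k (by omega)).1, (ih₂ k (by omega)).1]
  | branch_true hb h ih =>
    intro k hk
    simp only [Prog.eval, if_pos hb, (ih k (by omega)).1]; simp
  | branch_false hb h ih =>
    intro k hk
    simp only [Prog.eval, if_neg hb, (ih k (by omega)).1]; simp
  | @loop_true b c s s' s'' t₁ t₂ hb h₁ h₂ ih₁ ih₂ =>
    intro k hk
    have key : ∀ l, t₁ + t₂ + 1 ≤ l →
        (fun s => if b.Holds O s then c.eval O k s else s)^[l] s = s'' := by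
      intro l hl
      obtain ⟨l, rfl⟩ : ∃ l', l = l' + 1 := ⟨l - 1, by omega⟩
      rw [Function.iterate_succ_apply, if_pos hb, (ih₁ k (by omega)).1]
      exact (ih₂ k (by omega)).2 b c rfl l (by omega)
    refine ⟨key k hk, ?_⟩
    rintro b' c' ⟨⟩ l hl
    exact key l hl
  | @loop_false b c s hb =>
    intro k hk
    have key : ∀ l, (fun s => if b.Holds O s then c.eval O k s else s)^[l] s = s :=
      fun l => Function.iterate_fixed
        (f := fun s => if b.Holds O s then c.eval O k s else s) (if_neg hb) l
    refine ⟨key k, ?_⟩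
    rintro b' c' ⟨⟩ l -
    exact key l

theorem Exec.eval_eq {O : Oracle} {c : Prog} {s s' : Store} {t : ℕ} (h : Exec O c s t s')
    {k : ℕ} (hk : t ≤ k) : c.eval O k s = s' := (h.eval_eq_aux k hk).1

/-- No loops. -/
def Prog.straight : Prog → Bool
  | .seq c₁ c₂ => c₁.straight && c₂.straight
  | .branch _ c₁ c₂ => c₁.straight && c₂.straight
  | .loop _ _ => false
  | _ => true

/-- A bound on the number of steps of a program without loops. -/
def Prog.cost : Prog → ℕ
  | .seq c₁ c₂ => c₁.cost + c₂.cost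
  | .branch _ c₁ c₂ => c₁.cost + c₂.cost + 1
  | _ => 1

/-- `c.writesNat a`: the program contains an assignment to the natural-number array `a`. -/
def Prog.writesNat (a : ℕ) : Prog → Bool
  | .setNat a' _ _ _ => a' == a
  | .seq c₁ c₂ => c₁.writesNat a || c₂.writesNat a
  | .branch _ c₁ c₂ => c₁.writesNat a || c₂.writesNat a
  | .loop _ c => c.writesNat a
  | _ => false

/-- `c.writesReal a`: the program contains an assignment to the real array `a`. -/
def Prog.writesReal (a : ℕ) : Prog → Bool
  | .setReal a' _ _ _ => a' == a
  | .seq c₁ c₂ => c₁.writesReal a || c₂.writesReal a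
  | .branch _ c₁ c₂ => c₁.writesReal a || c₂.writesReal a
  | .loop _ c => c.writesReal a
  | _ => false

/-- `s'` differs from `s` only in arrays to which `c` contains an assignment. -/
structure Frame (c : Prog) (s s' : Store) : Prop where
  nat : ∀ a, c.writesNat a = false → s'.nat a = s.nat a
  real : ∀ a, c.writesReal a = false → s'.real a = s.real a

theorem Frame.refl (c : Prog) (s : Store) : Frame c s s := ⟨fun _ _ => rfl, fun _ _ => rfl⟩

theorem Frame.trans {c : Prog} {s s' s'' : Store} (h : Frame c s s') (h' : Frame c s' s'') :
    Frame c s s'' :=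
  ⟨fun a ha => (h'.nat a ha).trans (h.nat a ha), fun a ha => (h'.real a ha).trans (h.real a ha)⟩

theorem Frame.mono {c d : Prog} {s s' : Store} (h : Frame c s s')
    (hn : ∀ a, d.writesNat a = false → c.writesNat a = false)
    (hr : ∀ a, d.writesReal a = false → c.writesReal a = false) : Frame d s s' :=
  ⟨fun a ha => h.nat a (hn a ha), fun a ha => h.real a (hr a ha)⟩

theorem Exec.frame {O : Oracle} {c : Prog} {s s' : Store} {t : ℕ} (h : Exec O c s t s') :
    Frame c s s' := by
  induction h with
  | skip s => exact Frame.refl _ _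
  | setNat a i j e s =>
    refine ⟨fun a' ha => ?_, fun _ _ => rfl⟩
    have : a' ≠ a := by rintro rfl; simp [Prog.writesNat] at ha
    funext x y; simp [this]
  | setReal a i j e s =>
    refine ⟨fun _ _ => rfl, fun a' ha => ?_⟩
    have : a' ≠ a := by rintro rfl; simp [Prog.writesReal] at ha
    funext x y; simp [this]
  | seq h₁ h₂ ih₁ ih₂ =>
    refine Frame.trans (ih₁.mono ?_ ?_) (ih₂.mono ?_ ?_) <;> intro a ha <;>
      simp_all [Prog.writesNat, Prog.writesReal]
  | branch_true hb h ih =>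
    refine ih.mono ?_ ?_ <;> intro a ha <;> simp_all [Prog.writesNat, Prog.writesReal]
  | branch_false hb h ih =>
    refine ih.mono ?_ ?_ <;> intro a ha <;> simp_all [Prog.writesNat, Prog.writesReal]
  | loop_true hb h₁ h₂ ih₁ ih₂ => exact Frame.trans (ih₁.mono (fun _ => id) (fun _ => id)) ih₂
  | loop_false hb => exact Frame.refl _ _

/-- Total correctness with a time bound: from `s`, the program halts after at most `T` steps in a
store that satisfies `Q`. -/
def Runs (O : Oracle) (c : Prog) (s : Store) (T : ℕ) (Q : Store → Prop) : Prop :=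
  ∃ t s', Exec O c s t s' ∧ t ≤ T ∧ Q s'

variable {O : Oracle}

theorem Runs.mono {c : Prog} {s : Store} {T T' : ℕ} {Q Q' : Store → Prop}
    (h : Runs O c s T Q) (hT : T ≤ T') (hQ : ∀ s', Frame c s s' → Q s' → Q' s') :
    Runs O c s T' Q' := by
  obtain ⟨t, s', h, ht, hs⟩ := h
  exact ⟨t, s', h, ht.trans hT, hQ s' h.frame hs⟩

theorem Prog.exec_of_straight {c : Prog} (hc : c.straight = true) (s : Store) :
    ∃ t ≤ c.cost, Exec O c s t (c.eval O 0 s) := by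
  induction c generalizing s with
  | skip => exact ⟨1, le_rfl, .skip s⟩
  | setNat a i j e => exact ⟨1, le_rfl, .setNat a i j e s⟩
  | setReal a i j e => exact ⟨1, le_rfl, .setReal a i j e s⟩
  | seq c₁ c₂ ih₁ ih₂ =>
    simp only [Prog.straight, Bool.and_eq_true] at hc
    obtain ⟨t₁, h₁, e₁⟩ := ih₁ hc.1 s
    obtain ⟨t₂, h₂, e₂⟩ := ih₂ hc.2 (c₁.eval O 0 s)
    exact ⟨t₁ + t₂, by simp [Prog.cost]; omega, .seq e₁ e₂⟩
  | branch b c₁ c₂ ih₁ ih₂ =>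
    simp only [Prog.straight, Bool.and_eq_true] at hc
    by_cases hb : b.Holds O s
    · obtain ⟨t₁, h₁, e₁⟩ := ih₁ hc.1 s
      refine ⟨t₁ + 1, by simp [Prog.cost]; omega, ?_⟩
      simp only [Prog.eval, if_pos hb]
      exact .branch_true hb e₁
    · obtain ⟨t₁, h₁, e₁⟩ := ih₂ hc.2 s
      refine ⟨t₁ + 1, by simp [Prog.cost]; omega, ?_⟩
      simp only [Prog.eval, if_neg hb]
      exact .branch_false hb e₁
  | loop b c _ => simp [Prog.straight] at hc

theorem Runs.straight {c : Prog} {s : Store} {T : ℕ} {Q : Store → Prop}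
    (hc : c.straight = true) (hT : c.cost ≤ T) (hQ : Q (c.eval O 0 s)) : Runs O c s T Q := by
  obtain ⟨t, ht, h⟩ := Prog.exec_of_straight (O := O) hc s
  exact ⟨t, _, h, ht.trans hT, hQ⟩

theorem Runs.seq {c₁ c₂ : Prog} {s : Store} {T₁ T₂ : ℕ} {P Q : Store → Prop}
    (h₁ : Runs O c₁ s T₁ P) (h₂ : ∀ s', Frame c₁ s s' → P s' → Runs O c₂ s' T₂ Q) :
    Runs O (.seq c₁ c₂) s (T₁ + T₂) Q := by
  obtain ⟨t, s', h, ht, hs⟩ := h₁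
  obtain ⟨t', s'', h', ht', hs'⟩ := h₂ s' h.frame hs
  exact ⟨t + t', s'', .seq h h', by omega, hs'⟩

theorem Runs.branch {b : Test} {c₁ c₂ : Prog} {s : Store} {T : ℕ} {Q : Store → Prop}
    (h₁ : b.Holds O s → Runs O c₁ s T Q) (h₂ : ¬ b.Holds O s → Runs O c₂ s T Q) :
    Runs O (.branch b c₁ c₂) s (T + 1) Q := by
  by_cases hb : b.Holds O s
  · obtain ⟨t, s', h, ht, hs⟩ := h₁ hb
    exact ⟨t + 1, s', .branch_true hb h, by omega, hs⟩
  · obtain ⟨t, s', h, ht, hs⟩ := h₂ hb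
    exact ⟨t + 1, s', .branch_false hb h, by omega, hs⟩

/-- While loops with an invariant that counts the iterations. -/
theorem Runs.loop {b : Test} {c : Prog} {s : Store} {n T : ℕ} (I : ℕ → Store → Prop)
    (h0 : I 0 s)
    (hs : ∀ k s', Frame (.loop b c) s s' → I k s' → b.Holds O s' →
      k < n ∧ Runs O c s' T (I (k + 1))) :
    Runs O (.loop b c) s (n * (T + 1) + 1)
      (fun s' => ∃ k, I k s' ∧ ¬ b.Holds O s') := by
  suffices H : ∀ d k s', k ≤ n → n - k = d → Frame (.loop b c) s s' → I k s' →
      Runs O (.loop b c) s' (d * (T + 1) + 1) (fun s' => ∃ k, I k s' ∧ ¬ b.Holds O s') by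
    simpa using H n 0 s (Nat.zero_le _) rfl (Frame.refl _ _) h0
  intro d
  induction d with
  | zero =>
    intro k s' hk hd hf hI
    by_cases hb : b.Holds O s'
    · have := (hs k s' hf hI hb).1; omega
    · exact ⟨1, s', .loop_false hb, by omega, k, hI, hb⟩
  | succ d ih =>
    intro k s' hk hd hf hI
    by_cases hb : b.Holds O s'
    · obtain ⟨hkn, t, s₁, h₁, ht, hI₁⟩ := hs k s' hf hI hb
      obtain ⟨t₂, s₂, h₂, ht₂, hQ⟩ := ih (k + 1) s₁ hkn (by omega)
        (hf.trans (h₁.frame.mono (fun _ => id) (fun _ => id))) hI₁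
      refine ⟨t + t₂ + 1, s₂, .loop_true hb h₁ h₂, ?_, hQ⟩
      rw [Nat.succ_mul]; omega
    · exact ⟨1, s', .loop_false hb, by omega, k, hI, hb⟩

/-- `for a := 0 to N - 1 do c`, with the loop variable in cell `(0, 0)` of array `a`. -/
def forLoop (a : ℕ) (N : NatExpr) (c : Prog) : Prog :=
  .seq (.setNat a (.const 0) (.const 0) (.const 0))
    (.loop (.not (.natLe N (.get a (.const 0) (.const 0))))
      (.seq c (.setNat a (.const 0) (.const 0)
        (.add (.get a (.const 0) (.const 0)) (.const 1)))))

theorem Runs.forLoop {a : ℕ} {N : NatExpr} {c : Prog} {s : Store} {n T : ℕ}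
    (I : ℕ → Store → Prop) (hc : c.writesNat a = false)
    (hN : ∀ s', Frame (forLoop a N c) s s' → N.value s' = n)
    (hI : ∀ k s' x, I k s' → I k (s'.writeNat a 0 0 x)) (h0 : I 0 s)
    (hs : ∀ k < n, ∀ s', Frame (RealRAM.forLoop a N c) s s' → s'.nat a 0 0 = k → I k s' →
      Runs O c s' T (I (k + 1))) :
    Runs O (RealRAM.forLoop a N c) s (n * (T + 2) + 2) (I n) := by
  have h1 : Runs O (.setNat a (.const 0) (.const 0) (.const 0)) s 1
      (fun s' => s'.nat a 0 0 = 0 ∧ I 0 s') :=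
    Runs.straight rfl le_rfl ⟨by simp [Prog.eval], by simpa [Prog.eval] using hI _ _ _ h0⟩
  have h2 := Runs.seq (T₂ := n * (T + 1 + 1) + 1) h1
    (c₂ := .loop (.not (.natLe N (.get a (.const 0) (.const 0))))
      (.seq c (.setNat a (.const 0) (.const 0)
        (.add (.get a (.const 0) (.const 0)) (.const 1)))))
    (Q := I n) ?_
  · exact h2.mono (le_of_eq (by ring)) (fun _ _ h => h)
  · intro s₁ hf₁ hs₁
    have hf1 : Frame (RealRAM.forLoop a N c) s s₁ := hf₁.mono
      (fun a' ha' => by simp_all [RealRAM.forLoop, Prog.writesNat])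
      (fun a' ha' => by simp [Prog.writesReal])
    have hcomp : ∀ s', Frame (.loop (.not (.natLe N (.get a (.const 0) (.const 0))))
      (.seq c (.setNat a (.const 0) (.const 0)
        (.add (.get a (.const 0) (.const 0)) (.const 1))))) s₁ s' →
        Frame (RealRAM.forLoop a N c) s s' := fun s' hf => hf1.trans (hf.mono
      (fun a' ha' => by simp_all [RealRAM.forLoop, Prog.writesNat])
      (fun a' ha' => by simp_all [RealRAM.forLoop, Prog.writesReal]))
    have h3 := Runs.loop (O := O) (s := s₁) (n := n) (T := T + 1)
      (b := .not (.natLe N (.get a (.const 0) (.const 0))))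
      (c := .seq c (.setNat a (.const 0) (.const 0)
        (.add (.get a (.const 0) (.const 0)) (.const 1))))
      (fun k s' => k ≤ n ∧ s'.nat a 0 0 = k ∧ I k s') ⟨Nat.zero_le _, hs₁⟩ ?_
    · refine h3.mono le_rfl ?_
      rintro s' hf ⟨k, ⟨hk, hk', hI'⟩, hb⟩
      simp only [Test.Holds, not_not, hN s' (hcomp s' hf), NatExpr.value, hk'] at hb
      have : k = n := by omega
      rwa [this] at hI'
    · rintro k s' hf ⟨hk, hk', hI'⟩ hb
      simp only [Test.Holds, hN s' (hcomp s' hf), NatExpr.value, hk', not_le] at hb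
      refine ⟨hb, ?_⟩
      refine Runs.seq (T₁ := T) (T₂ := 1)
        (hs k hb s' (hcomp s' hf) hk' hI') (fun s₂ hf₂ hI₂ => ?_)
      refine Runs.straight rfl le_rfl ?_
      simp only [Prog.eval, NatExpr.value]
      refine ⟨hb, ?_, hI _ _ _ hI₂⟩
      simp [hf₂.nat a hc, hk']

/-! ### Measurability of program outputs -/

/-- A store that depends on `ω`, all of whose cells are measurable in `ω`. -/
structure MeasurableStore {Ω : Type*} [MeasurableSpace Ω] (f : Ω → Store) : Prop where
  nat : ∀ a i j, Measurable fun ω => (f ω).nat a i j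
  real : ∀ a i j, Measurable fun ω => (f ω).real a i j

/-- Oracles all of whose functions are measurable. -/
structure Oracle.IsMeasurable (O : Oracle) : Prop where
  cdf : ∀ i, Measurable (O.cdf i)
  pdf : ∀ i, Measurable (O.pdf i)

section Measurability

variable {Ω : Type*} [MeasurableSpace Ω] {f : Ω → Store}

theorem measurable_comp_nat {β : Type*} [MeasurableSpace β] {g : ℕ → Ω → β} {k : Ω → ℕ}
    (hg : ∀ i, Measurable (g i)) (hk : Measurable k) : Measurable fun ω => g (k ω) ω :=
  (measurable_from_prod_countable_right (f := fun q : ℕ × Ω => g q.1 q.2) hg).comp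
    (hk.prodMk measurable_id)

theorem measurable_natExpr (hf : MeasurableStore f) (e : NatExpr) :
    Measurable fun ω => e.value (f ω) := by
  induction e with
  | const k => exact measurable_const
  | get a i j hi hj =>
    exact measurable_comp_nat (g := fun k ω => (f ω).nat a k (j.value (f ω)))
      (fun k => measurable_comp_nat (g := fun l ω => (f ω).nat a k l) (hf.nat a k) hj) hi
  | add e₁ e₂ h₁ h₂ => exact h₁.add h₂
  | sub e₁ e₂ h₁ h₂ => exact h₁.sub h₂

theorem measurable_realExpr (hO : O.IsMeasurable) (hf : MeasurableStore f) (e : RealExpr) :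
    Measurable fun ω => e.value O (f ω) := by
  induction e with
  | const k => exact measurable_const
  | get a i j =>
    exact measurable_comp_nat (g := fun k ω => (f ω).real a k (j.value (f ω)))
      (fun k => measurable_comp_nat (g := fun l ω => (f ω).real a k l) (hf.real a k)
        (measurable_natExpr hf j)) (measurable_natExpr hf i)
  | add e₁ e₂ h₁ h₂ => exact h₁.add h₂
  | sub e₁ e₂ h₁ h₂ => exact h₁.sub h₂
  | mul e₁ e₂ h₁ h₂ => exact h₁.mul h₂
  | div e₁ e₂ h₁ h₂ => exact h₁.div h₂
  | cdf i e h =>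
    exact measurable_comp_nat (g := fun k ω => O.cdf k (e.value O (f ω)))
      (fun k => (hO.cdf k).comp h) (measurable_natExpr hf i)
  | pdf i e h =>
    exact measurable_comp_nat (g := fun k ω => O.pdf k (e.value O (f ω)))
      (fun k => (hO.pdf k).comp h) (measurable_natExpr hf i)

theorem measurableSet_test (hO : O.IsMeasurable) (hf : MeasurableStore f) (b : Test) :
    MeasurableSet {ω | b.Holds O (f ω)} := by
  induction b with
  | natLe e₁ e₂ => exact measurableSet_le (measurable_natExpr hf e₁) (measurable_natExpr hf e₂)
  | realLe e₁ e₂ =>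
    exact measurableSet_le (measurable_realExpr hO hf e₁) (measurable_realExpr hO hf e₂)
  | not b h => exact h.compl
  | and b₁ b₂ h₁ h₂ => exact h₁.inter h₂

open Classical in
theorem MeasurableStore.ite {g : Ω → Store} {b : Ω → Prop} (hb : MeasurableSet {ω | b ω})
    (hf : MeasurableStore f) (hg : MeasurableStore g) :
    MeasurableStore fun ω => if b ω then f ω else g ω where
  nat a i j := by
    have : Measurable fun ω => if b ω then (f ω).nat a i j else (g ω).nat a i j :=
      Measurable.ite hb (hf.nat a i j) (hg.nat a i j)
    convert this using 2 with ω
    by_cases h : b ω <;> simp [h]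
  real a i j := by
    have : Measurable fun ω => if b ω then (f ω).real a i j else (g ω).real a i j :=
      Measurable.ite hb (hf.real a i j) (hg.real a i j)
    convert this using 2 with ω
    by_cases h : b ω <;> simp [h]

open Classical in
theorem MeasurableStore.iterate {φ : Store → Store}
    (hφ : ∀ g : Ω → Store, MeasurableStore g → MeasurableStore fun ω => φ (g ω))
    (hf : MeasurableStore f) (l : ℕ) : MeasurableStore fun ω => φ^[l] (f ω) := by
  induction l generalizing f with
  | zero => exact hf
  | succ l ih => exact ih (hφ f hf)

theorem MeasurableStore.eval (hO : O.IsMeasurable) (k : ℕ) (c : Prog)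
    (hf : MeasurableStore f) : MeasurableStore fun ω => c.eval O k (f ω) := by
  classical
  induction c generalizing f with
  | skip => exact hf
  | setNat a i j e =>
    have hi := measurable_natExpr hf i
    have hj := measurable_natExpr hf j
    refine ⟨fun a' i' j' => ?_, hf.real⟩
    simp only [Prog.eval, Store.writeNat_nat]
    exact Measurable.ite ((MeasurableSet.const _).inter
      ((measurableSet_eq_fun measurable_const hi).inter (measurableSet_eq_fun measurable_const hj)))
      (measurable_natExpr hf e) (hf.nat _ _ _)
  | setReal a i j e =>
    have hi := measurable_natExpr hf i
    have hj := measurable_natExpr hf j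
    refine ⟨hf.nat, fun a' i' j' => ?_⟩
    simp only [Prog.eval, Store.writeReal_real]
    exact Measurable.ite ((MeasurableSet.const _).inter
      ((measurableSet_eq_fun measurable_const hi).inter (measurableSet_eq_fun measurable_const hj)))
      (measurable_realExpr hO hf e) (hf.real _ _ _)
  | seq c₁ c₂ ih₁ ih₂ => exact ih₂ (ih₁ hf)
  | branch b c₁ c₂ ih₁ ih₂ =>
    simp only [Prog.eval]
    exact MeasurableStore.ite (measurableSet_test hO hf b) (ih₁ hf) (ih₂ hf)
  | loop b c ih =>
    refine MeasurableStore.iterate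
      (φ := fun s => if b.Holds O s then c.eval O k s else s) (fun g hg => ?_) hf k
    exact MeasurableStore.ite (measurableSet_test hO hg b) (ih hg) hg

/-- The final store of a program that always halts depends measurably on the initial one, since
it is the pointwise (eventually constant) limit of the fuelled evaluations. -/
theorem MeasurableStore.of_exec (hO : O.IsMeasurable) {c : Prog} (hf : MeasurableStore f)
    {g : Ω → Store} (h : ∀ ω, ∃ t, Exec O c (f ω) t (g ω)) : MeasurableStore g := by
  have hev : ∀ ω, ∀ᶠ k in Filter.atTop, c.eval O k (f ω) = g ω := fun ω => by
    obtain ⟨t, ht⟩ := h ω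
    exact (Filter.eventually_ge_atTop t).mono fun k hk => ht.eval_eq hk
  refine ⟨fun a i j => ?_, fun a i j => ?_⟩
  · refine measurable_of_tendsto_metrizable
      (f := fun k ω => (c.eval O k (f ω)).nat a i j)
      (fun k => (hf.eval hO k c).nat a i j) (tendsto_pi_nhds.2 fun ω => ?_)
    exact tendsto_const_nhds.congr' ((hev ω).mono fun k hk => by simp only [hk])
  · refine measurable_of_tendsto_metrizable
      (f := fun k ω => (c.eval O k (f ω)).real a i j)
      (fun k => (hf.eval hO k c).real a i j) (tendsto_pi_nhds.2 fun ω => ?_)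
    exact tendsto_const_nhds.congr' ((hev ω).mono fun k hk => by simp only [hk])

end Measurability

end RealRAM

/-! ### The number of Newton steps for a ratio of 0-1 sums -/

/-- Siegel's lemma for `q + 1` sign vectors of length `q`. -/
theorem exists_small_int_relation {ι : Type*} [Fintype ι] [Nonempty ι] {q : ℕ}
    (hq : Fintype.card ι = q) (A : Fin (q + 1) → ι → ℤ) (hA : ∀ k e, |A k e| ≤ 1) :
    ∃ l : Fin (q + 1) → ℤ, l ≠ 0 ∧ (∀ e, ∑ k, l k * A k e = 0) ∧
      ∀ k, |(l k : ℝ)| ≤ (q + 1 : ℝ) ^ q := by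
  classical
  let := Matrix.seminormedAddCommGroup (m := ι) (n := Fin (q + 1)) (α := ℤ)
  let B : Matrix ι (Fin (q + 1)) ℤ := Matrix.of fun e k => A k e
  have hB : ‖B‖ ≤ 1 := by
    rw [Matrix.norm_le_iff zero_le_one]
    intro e k
    rw [Int.norm_eq_abs]
    exact_mod_cast hA k e
  obtain ⟨l, hl, hl0, hln⟩ := Int.Matrix.exists_ne_zero_int_vec_norm_le B
    (by simp [hq]) Fintype.card_pos
  refine ⟨l, hl, fun e => ?_, fun k => ?_⟩
  · have := congrFun hl0 e
    simpa [Matrix.mulVec, dotProduct, B, mul_comm] using this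
  · have h1 : |(l k : ℝ)| ≤ ‖l‖ := by
      have := norm_le_pi_norm l k
      rwa [Int.norm_eq_abs] at this
    refine h1.trans (hln.trans ?_)
    have : (q : ℝ) / ((q + 1 : ℕ) - q : ℝ) = q := by push_cast; simp
    rw [hq, Fintype.card_fin, max_eq_left hB, this, Real.rpow_natCast]
    push_cast; simp

/-- Goemans' lemma on geometrically decreasing sequences: `q + 1` positive numbers, all of them
signed sub-sums of the same `q` reals, cannot decrease too fast. -/
theorem one_le_of_geometric_subsums {ι : Type*} [Fintype ι] [Nonempty ι] {q : ℕ}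
    (hq : Fintype.card ι = q) (c : ι → ℝ) (A : Fin (q + 1) → ι → ℤ) (hA : ∀ k e, |A k e| ≤ 1)
    {η : ℝ} (hpos : ∀ k, 0 < ∑ e, c e * A k e)
    (hdec : ∀ k k', k < k' → ∑ e, c e * A k' e ≤ η * ∑ e, c e * A k e) :
    1 ≤ (q + 1 : ℝ) ^ (q + 1) * η := by
  classical
  obtain ⟨l, hl, hl0, hlB⟩ := exists_small_int_relation hq A hA
  set Q : Fin (q + 1) → ℝ := fun k => ∑ e, c e * A k e with hQ
  have hrel : ∑ k, (l k : ℝ) * Q k = 0 := by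
    simp only [hQ, Finset.mul_sum]
    rw [Finset.sum_comm]
    refine Finset.sum_eq_zero fun e _ => ?_
    have : ((∑ k, l k * A k e : ℤ) : ℝ) = 0 := by rw [hl0 e]; simp
    push_cast at this
    calc ∑ k, (l k : ℝ) * (c e * A k e) = c e * ∑ k, (l k : ℝ) * A k e := by
          rw [Finset.mul_sum]; exact Finset.sum_congr rfl fun k _ => by ring
      _ = 0 := by rw [this, mul_zero]
  -- the leading term of the relation dominates all later ones
  obtain ⟨k₀, hk₀, hmin⟩ : ∃ k₀, l k₀ ≠ 0 ∧ ∀ k < k₀, l k = 0 := by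
    have hne : (Finset.univ.filter fun k => l k ≠ 0).Nonempty := by
      obtain ⟨k, hk⟩ := Function.ne_iff.1 hl
      exact ⟨k, by simpa using hk⟩
    refine ⟨_, by simpa using Finset.min'_mem _ hne, fun k hk => ?_⟩
    by_contra h
    exact absurd (Finset.min'_le _ k (by simpa using h)) (not_le.2 hk)
  have hη : 0 ≤ η ∨ ∀ k, k ≤ k₀ := by
    by_cases h : ∀ k, k ≤ k₀
    · exact .inr h
    · push Not at h
      obtain ⟨k, hk⟩ := h
      left
      by_contra hneg
      have := hdec k₀ k hk
      have h1 := hpos k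
      have h2 := hpos k₀
      nlinarith
  have hsplit : (l k₀ : ℝ) * Q k₀ = -∑ k ∈ Finset.univ.erase k₀, (l k : ℝ) * Q k := by
    rw [← Finset.add_sum_erase _ _ (Finset.mem_univ k₀)] at hrel
    linarith
  have hone : (1 : ℝ) ≤ |(l k₀ : ℝ)| := by
    have := Int.one_le_abs hk₀
    exact_mod_cast this
  have hQ0 : 0 < Q k₀ := hpos k₀
  rcases hη with hη | hlast
  · have h1 : Q k₀ ≤ ∑ k ∈ Finset.univ.erase k₀, (q + 1 : ℝ) ^ q * (η * Q k₀) := by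
      calc Q k₀ ≤ |(l k₀ : ℝ)| * Q k₀ := le_mul_of_one_le_left hQ0.le hone
        _ = |(l k₀ : ℝ) * Q k₀| := by rw [abs_mul, abs_of_pos hQ0]
        _ = |∑ k ∈ Finset.univ.erase k₀, (l k : ℝ) * Q k| := by rw [hsplit, abs_neg]
        _ ≤ ∑ k ∈ Finset.univ.erase k₀, |(l k : ℝ) * Q k| := Finset.abs_sum_le_sum_abs _ _
        _ ≤ _ := by
          refine Finset.sum_le_sum fun k hk => ?_
          rcases lt_or_gt_of_ne (Finset.ne_of_mem_erase hk) with h | h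
          · rw [hmin k h]; simp; positivity
          · rw [abs_mul, abs_of_pos (hpos k)]
            exact mul_le_mul (hlB k) (hdec _ _ h) (hpos k).le (by positivity)
    rw [Finset.sum_const, Finset.card_erase_of_mem (Finset.mem_univ _), Finset.card_univ,
      Fintype.card_fin, Nat.add_sub_cancel, nsmul_eq_mul] at h1
    have h2 : (q : ℝ) * ((q + 1 : ℝ) ^ q * (η * Q k₀)) ≤
        ((q + 1 : ℝ) ^ (q + 1) * η) * Q k₀ := by
      have : 0 ≤ (q + 1 : ℝ) ^ q * (η * Q k₀) := by positivity
      rw [pow_succ]; nlinarith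
    by_contra hlt
    push Not at hlt
    nlinarith
  · -- nothing follows the leading term, which is then zero
    exfalso
    have : ∑ k ∈ Finset.univ.erase k₀, (l k : ℝ) * Q k = 0 := by
      refine Finset.sum_eq_zero fun k hk => ?_
      rw [hmin k (lt_of_le_of_ne (hlast k) (Finset.ne_of_mem_erase hk))]; simp
    rw [this, neg_zero] at hsplit
    rcases mul_eq_zero.1 hsplit with h | h
    · exact hk₀ (by exact_mod_cast h)
    · exact hQ0.ne' h

/-- The bound on the number of Newton steps for ratios of sums over subsets of a set with `q - 1`
elements. -/
def newtonBound (q : ℕ) : ℕ := q * (q + 3) * (q * (q + 1))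

section Newton

variable {E : Type*} [Fintype E] {a b : E → ℝ} {sel : ℕ → Finset E} {R : ℕ → ℝ}

/-- One Newton step: the value `g` of the parametric problem and the denominator `D` of its
maximizer satisfy `g' / g + D' / D ≤ 1`, whence `D' < D` and `g' D' ≤ g D / 4`. -/
theorem newton_step {N N' D D' r r' g g' : ℝ} (hD : 0 < D) (hD' : 0 < D')
    (hg : g = N - r * D) (hg' : g' = N' - r' * D') (hr : r' = N / D)
    (hopt : N' - r * D' ≤ g) (hpos : 0 < g) (hpos' : 0 < g') :
    D' < D ∧ g' ≤ g ∧ g' * D' ≤ g * D / 4 ∧ r' - r = g / D ∧ r < r' := by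
  have h1 : r' - r = g / D := by rw [hr, hg]; field_simp
  have h1' : (r' - r) * D = g := by rw [h1]; field_simp
  have hlt : 0 < r' - r := by rw [h1]; positivity
  have h2 : g' + (r' - r) * D' ≤ g := by rw [hg']; linarith
  have h3 : D' < D := by
    by_contra h
    push Not at h
    nlinarith
  refine ⟨h3, by nlinarith, ?_, h1, by linarith⟩
  have h4 : g' ≤ (r' - r) * (D - D') := by nlinarith
  have h5 : g' * D' ≤ (r' - r) * (D - D') * D' := mul_le_mul_of_nonneg_right h4 hD'.le
  have h6 : (D - D') * D' ≤ D * D / 4 := by nlinarith [sq_nonneg (D - 2 * D')]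
  calc g' * D' ≤ (r' - r) * ((D - D') * D') := by linarith
    _ ≤ (r' - r) * (D * D / 4) := mul_le_mul_of_nonneg_left h6 hlt.le
    _ = g * D / 4 := by rw [← h1']; ring

/-- Up to a factor of at most `|E| + 1`, a denominator `1 + ∑ a` equals one of the `|E| + 1`
numbers `1` and `a e`. -/
theorem exists_bucket (ha : ∀ e, 0 < a e) (s : Finset E) :
    ∃ k : Option E, k.elim 1 a ≤ 1 + ∑ e ∈ s, a e ∧
      1 + ∑ e ∈ s, a e ≤ (Fintype.card E + 1) * k.elim 1 a := by
  have hcard : (s.card : ℝ) ≤ Fintype.card E := by exact_mod_cast Finset.card_le_univ s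
  have h0 : 0 ≤ ∑ e ∈ s, a e := Finset.sum_nonneg fun e _ => (ha e).le
  by_cases h : ∀ e ∈ s, a e ≤ 1
  · refine ⟨none, by simpa using h0, ?_⟩
    have := Finset.sum_le_sum h
    simp only [Finset.sum_const, nsmul_eq_mul, mul_one] at this
    simp only [Option.elim]
    linarith
  · push Not at h
    obtain ⟨e₁, he₁, h1⟩ := h
    obtain ⟨e, he, hmax⟩ := s.exists_max_image a ⟨e₁, he₁⟩
    refine ⟨some e, ?_, ?_⟩
    · have := Finset.single_le_sum (f := a) (fun e _ => (ha e).le) he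
      simp only [Option.elim]; linarith
    · have h2 := Finset.sum_le_sum hmax
      simp only [Finset.sum_const, nsmul_eq_mul] at h2
      have h3 : (s.card : ℝ) * a e ≤ Fintype.card E * a e :=
        mul_le_mul_of_nonneg_right hcard (ha e).le
      have h4 := hmax e₁ he₁
      simp only [Option.elim]; nlinarith

/-- Newton's method for the maximum of `∑ b / (1 + ∑ a)` over a family of subsets of `E` stops
after polynomially many steps, whatever the real coefficients are. -/
theorem exists_newton_nonpos (ha : ∀ e, 0 < a e)
    (hR : ∀ t, R (t + 1) = (∑ e ∈ sel t, b e) / (1 + ∑ e ∈ sel t, a e))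
    (hopt : ∀ t s, ∑ e ∈ sel s, b e - R t * (1 + ∑ e ∈ sel s, a e) ≤
      ∑ e ∈ sel t, b e - R t * (1 + ∑ e ∈ sel t, a e)) :
    ∃ t ≤ newtonBound (Fintype.card E + 1),
      ∑ e ∈ sel t, b e - R t * (1 + ∑ e ∈ sel t, a e) ≤ 0 := by
  classical
  by_contra hcon
  push Not at hcon
  set q := Fintype.card E + 1 with hq
  set N : ℕ → ℝ := fun t => ∑ e ∈ sel t, b e with hN
  set D : ℕ → ℝ := fun t => 1 + ∑ e ∈ sel t, a e with hD
  set g : ℕ → ℝ := fun t => N t - R t * D t with hg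
  have hD0 : ∀ t, 0 < D t := fun t =>
    add_pos_of_pos_of_nonneg one_pos (Finset.sum_nonneg fun e _ => (ha e).le)
  set L := q * (q + 3) with hL
  set W := newtonBound q with hW
  have hstep : ∀ t, t + 1 ≤ W → D (t + 1) < D t ∧ g (t + 1) ≤ g t ∧
      g (t + 1) * D (t + 1) ≤ g t * D t / 4 ∧ R (t + 1) - R t = g t / D t ∧ R t < R (t + 1) :=
    fun t ht => newton_step (hD0 t) (hD0 _) rfl rfl (hR t) (hopt t (t + 1))
      (hcon t (by omega)) (hcon _ ht)
  have hDanti : ∀ s t, s ≤ t → t ≤ W → D t ≤ D s := by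
    intro s t hst
    induction hst with
    | refl => intro _; exact le_rfl
    | step _ ih => intro h; exact (hstep _ h).1.le.trans (ih (by omega))
  have hRmono : ∀ s t, s ≤ t → t ≤ W → R s ≤ R t := by
    intro s t hst
    induction hst with
    | refl => intro _; exact le_rfl
    | step _ ih => intro h; exact (ih (by omega)).trans (hstep _ h).2.2.2.2.le
  have hgD : ∀ d s, s + d ≤ W → g (s + d) * D (s + d) ≤ (1 / 4) ^ d * (g s * D s) := by
    intro d
    induction d with
    | zero => intro s _; simp
    | succ d ih =>
      intro s h
      have h1 := (hstep (s + d) (by omega)).2.2.1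
      have h2 := ih s (by omega)
      rw [← add_assoc, pow_succ]
      nlinarith
  -- many indices, at mutual distance at least `L`, with denominators of the same size
  choose key hkey1 hkey2 using fun t => exists_bucket ha (sel t)
  obtain ⟨o, -, ho⟩ := Finset.exists_lt_card_fiber_of_mul_lt_card_of_maps_to
    (s := Finset.range (q * (q + 1) + 1)) (t := (Finset.univ : Finset (Option E)))
    (f := fun k => key (L * k)) (n := q + 1) (fun _ _ => Finset.mem_univ _)
    (by simp [Fintype.card_option, ← hq])
  obtain ⟨S, hS, hScard⟩ := Finset.exists_subset_card_eq ho
  let ix : Fin (q + 2) ↪o ℕ := S.orderEmbOfFin hScard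
  have hix : ∀ k, ix k ≤ q * (q + 1) ∧ key (L * ix k) = o := fun k => by
    have := hS (S.orderEmbOfFin_mem hScard k)
    simp only [Finset.mem_filter, Finset.mem_range] at this
    exact ⟨Nat.lt_succ_iff.1 this.1, this.2⟩
  let tm : Fin (q + 2) → ℕ := fun k => L * ix k
  have htmW : ∀ k, tm k ≤ W := fun k => Nat.mul_le_mul_left L (hix k).1
  have htmlt : ∀ k k', k < k' → tm k + L ≤ tm k' := fun k k' h => by
    have : ix k + 1 ≤ ix k' := ix.lt_iff_lt.2 h
    calc tm k + L = L * (ix k + 1) := by simp [tm]; ring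
      _ ≤ tm k' := Nat.mul_le_mul_left L this
  have hbucket : ∀ k k', D (tm k) ≤ q * D (tm k') := fun k k' => by
    have h1 := hkey2 (tm k)
    have h2 := hkey1 (tm k')
    rw [(hix k).2] at h1
    rw [(hix k').2] at h2
    have h3 : ((Fintype.card E : ℝ) + 1) = q := by rw [hq]; push_cast; ring
    rw [h3] at h1
    exact h1.trans (mul_le_mul_of_nonneg_left h2 (by positivity))
  have hL2 : 2 ≤ L := by rw [hL, hq]; nlinarith
  let τ := tm (Fin.last (q + 1))
  -- the deficits of the selected solutions at the parameter `R τ`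
  let Q : Fin (q + 1) → ℝ := fun k => R τ * D (tm k.castSucc) - N (tm k.castSucc)
  have hτ : ∀ k : Fin (q + 1), tm k.castSucc + 2 ≤ τ := fun k =>
    (Nat.add_le_add_left hL2 _).trans (htmlt _ _ (Fin.castSucc_lt_last k))
  have hτW : τ ≤ W := htmW _
  have hQeq : ∀ k, Q k = D (tm k.castSucc) * (R τ - R (tm k.castSucc + 1)) := fun k => by
    have := hD0 (tm k.castSucc)
    rw [hR]
    change R τ * D (tm k.castSucc) - N (tm k.castSucc) =
      D (tm k.castSucc) * (R τ - N (tm k.castSucc) / D (tm k.castSucc))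
    field_simp
  have hQlow : ∀ k, g (tm k.castSucc + 1) ≤ Q k := fun k => by
    set t := tm k.castSucc with ht
    have h1 := hτ k
    have h2 := hRmono (t + 2) τ h1 hτW
    have h3 := hstep (t + 1) (by omega)
    have h4 := hDanti t (t + 1) (by omega) (by omega)
    have h5 := hD0 (t + 1)
    have h6 : (R (t + 2) - R (t + 1)) * D (t + 1) = g (t + 1) := by
      rw [h3.2.2.2.1]; field_simp
    rw [hQeq k, ← h6]
    have h7 := h3.2.2.2.2
    change R (t + 1) < R (t + 2) at h7
    nlinarith
  have hQup : ∀ k, Q k ≤ q * g (tm k.castSucc + 1) := fun k => by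
    set t := tm k.castSucc with ht
    have h1 := hτ k
    have h2 : D τ * (R τ - R (t + 1)) ≤ g (t + 1) := by
      have h3 := hopt (t + 1) τ
      have h4 : 0 < g τ := hcon τ hτW
      change N τ - R (t + 1) * D τ ≤ g (t + 1) at h3
      simp only [hg] at h4 ⊢
      simp only [hg] at h3
      linarith
    have h5 := hRmono (t + 1) τ (by omega) hτW
    have h6 := hbucket k.castSucc (Fin.last _)
    rw [hQeq k]
    calc D t * (R τ - R (t + 1)) ≤ q * D τ * (R τ - R (t + 1)) :=
          mul_le_mul_of_nonneg_right h6 (by linarith)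
      _ = q * (D τ * (R τ - R (t + 1))) := by ring
      _ ≤ q * g (t + 1) := mul_le_mul_of_nonneg_left h2 (by positivity)
  have hgpos : ∀ k : Fin (q + 1), 0 < g (tm k.castSucc + 1) := fun k =>
    hcon _ (by have := hτ k; omega)
  have hdec : ∀ k k' : Fin (q + 1), k < k' → Q k' ≤ (q ^ 2 * (1 / 4) ^ L) * Q k := by
    intro k k' hkk
    have h0 := htmlt k.castSucc k'.castSucc (by simpa using hkk)
    set t := tm k.castSucc with ht
    set t' := tm k'.castSucc with ht'
    have hτ' := hτ k'
    obtain ⟨d, hd⟩ : ∃ d, t' = t + d := ⟨t' - t, by omega⟩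
    have hdL : L ≤ d := by omega
    have h1 := hgD d (t + 1) (by omega)
    have e1 : t + 1 + d = t' + 1 := by omega
    rw [e1] at h1
    have h2 : D (t + 1) ≤ q * D (t' + 1) := by
      have h3 := hDanti t (t + 1) (by omega) (by omega)
      have h4 := hbucket k.castSucc (Fin.last _)
      have h5 := hDanti (t' + 1) τ (by omega) hτW
      calc D (t + 1) ≤ D t := h3
        _ ≤ q * D τ := h4
        _ ≤ q * D (t' + 1) := mul_le_mul_of_nonneg_left h5 (by positivity)
    have h6 : ((1 : ℝ) / 4) ^ d ≤ (1 / 4) ^ L :=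
      pow_le_pow_of_le_one (by norm_num) (by norm_num) hdL
    have h7 : g (t' + 1) * D (t' + 1) ≤ ((1 / 4) ^ L * g (t + 1) * q) * D (t' + 1) := by
      refine h1.trans ?_
      have := hgpos k
      calc (1 / 4 : ℝ) ^ d * (g (t + 1) * D (t + 1))
          ≤ (1 / 4 : ℝ) ^ L * (g (t + 1) * (q * D (t' + 1))) :=
            mul_le_mul h6 (mul_le_mul_of_nonneg_left h2 this.le)
              (mul_nonneg this.le (hD0 _).le) (by positivity)
        _ = _ := by ring
    have h8 := le_of_mul_le_mul_right h7 (hD0 _)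
    calc Q k' ≤ q * g (t' + 1) := hQup k'
      _ ≤ q * ((1 / 4) ^ L * g (t + 1) * q) := mul_le_mul_of_nonneg_left h8 (by positivity)
      _ = (q ^ 2 * (1 / 4) ^ L) * g (t + 1) := by ring
      _ ≤ _ := mul_le_mul_of_nonneg_left (hQlow k) (by positivity)
  -- each deficit is a signed sub-sum of `R τ` and the numbers `R τ * a e - b e`
  let c : Option E → ℝ := fun o => o.elim (R τ) fun e => R τ * a e - b e
  let A : Fin (q + 1) → Option E → ℤ := fun k o =>
    o.elim 1 fun e => if e ∈ sel (tm k.castSucc) then 1 else 0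
  have hQsum : ∀ k, ∑ o, c o * A k o = Q k := fun k => by
    simp only [Fintype.sum_option, c, A, Option.elim, Q, hN, hD]
    push_cast
    simp only [mul_ite, mul_one, mul_zero, Finset.sum_ite_mem, Finset.univ_inter,
      Finset.sum_sub_distrib, mul_add, Finset.mul_sum]
    ring
  have hfin := one_le_of_geometric_subsums (q := q) (by simp [Fintype.card_option, hq]) c A
    (fun k o => by
      cases o with
      | none => simp [A]
      | some e => simp only [A, Option.elim]; split_ifs <;> simp)
    (η := q ^ 2 * (1 / 4) ^ L) (fun k => by rw [hQsum]; exact (hgpos k).trans_le (hQlow k))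
    (fun k k' h => by rw [hQsum, hQsum]; exact hdec k k' h)
  have hpow : ((q : ℝ) + 1) ≤ 2 ^ q := by
    have : q + 1 ≤ 2 ^ q := Nat.lt_two_pow_self
    exact_mod_cast this
  have hbig : ((q : ℝ) + 1) ^ (q + 1) * q ^ 2 < 4 ^ L := by
    calc ((q : ℝ) + 1) ^ (q + 1) * q ^ 2 ≤ (2 ^ q) ^ (q + 1) * (2 ^ q) ^ 2 :=
          mul_le_mul (pow_le_pow_left₀ (by positivity) hpow _)
            (pow_le_pow_left₀ (by positivity) (by linarith) _) (by positivity) (by positivity)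
      _ = 2 ^ L := by rw [← pow_add, ← pow_mul, hL]
      _ < 4 ^ L := pow_lt_pow_left₀ (by norm_num) (by norm_num) (by omega)
  have h4 : (0 : ℝ) < 4 ^ L := by positivity
  have : (q + 1 : ℝ) ^ (q + 1) * (q ^ 2 * (1 / 4) ^ L) < 1 := by
    rw [one_div, inv_pow, ← mul_assoc, ← div_eq_mul_inv, div_lt_one h4]
    exact hbig
  linarith

end Newton

/-! ### A primal-dual algorithm for matchings of bounded cardinality -/

/-- The state of the matching algorithm. Rows are matched to columns: `mate i = j + 1` means that
row `i` is matched to column `j`, and `mate i = 0` that it is free; alternative matchings use the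
same encoding. The dual solution is `u`, `v` together with the common value `mu` of `u` at the free
rows. The alternating forest rooted at the free rows has the rows with `row i ≠ 0` and the columns
with `col j ≠ 0`; for a row `i` of the forest, `alt i` is the matching that results from flipping
the tree path from a root to `i`: it covers the same columns as `mate` and leaves `i` free. -/
structure MatchState where
  halt : ℕ
  cnt : ℕ
  mate : ℕ → ℕ
  row : ℕ → ℕ
  col : ℕ → ℕ
  alt : ℕ → ℕ → ℕ
  u : ℕ → ℝ
  v : ℕ → ℝ
  mu : ℝ

/-- The outcome of the search for an edge of least slack that leaves the forest. -/
structure Pick where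
  slack : ℝ
  i : ℕ
  j : ℕ
  found : ℕ

namespace MatchState

/-- Compare the edge `(i, j)` with the best edge so far. -/
def pickStep (S : MatchState) (c : ℕ → ℕ → ℝ) (i j : ℕ) (b : Pick) : Pick :=
  open Classical in
  if S.row i ≠ 0 ∧ S.col j = 0 ∧ S.u i + S.v j - c i j < b.slack then
    ⟨S.u i + S.v j - c i j, i, j, 1⟩
  else b

/-- Scan the first `l` columns of row `i`. -/
def pickRow (S : MatchState) (c : ℕ → ℕ → ℝ) (i : ℕ) (b : Pick) : ℕ → Pick
  | 0 => b
  | l + 1 => S.pickStep c i l (S.pickRow c i b l)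

/-- Scan the first `k` rows. Only edges with slack below `mu` count. -/
def pick (S : MatchState) (m : ℕ) (c : ℕ → ℕ → ℝ) : ℕ → Pick
  | 0 => ⟨S.mu, 0, 0, 0⟩
  | k + 1 => S.pickRow c k (S.pick m c k) m

/-- One plus the last row below `k` that is matched to column `j`, or `0`. -/
def findMate (L : ℕ → ℕ) (j : ℕ) : ℕ → ℕ
  | 0 => 0
  | k + 1 => if L k = j + 1 then k + 1 else findMate L j k

/-- The change of the dual solution by `d` along the forest. -/
def shift (S : MatchState) (d : ℝ) : MatchState :=
  { S with
    u := fun i => if S.row i = 0 then S.u i else S.u i - d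
    v := fun j => if S.col j = 0 then S.v j else S.v j + d
    mu := S.mu - d }

/-- Restart the forest from the free rows. -/
def reset (S : MatchState) : MatchState :=
  { S with
    row := fun i => if S.mate i = 0 then 1 else 0
    col := fun _ => 0
    alt := fun _ => S.mate }

/-- Replace the matching by the larger matching `L`. -/
def augment (S : MatchState) (L : ℕ → ℕ) : MatchState :=
  { S with cnt := S.cnt + 1, mate := L }

/-- Add column `j` and its mate `i` to the forest. -/
def grow (S : MatchState) (L : ℕ → ℕ) (i j : ℕ) : MatchState :=
  { S with
    alt := Function.update S.alt i (Function.update L i 0)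
    row := Function.update S.row i 1
    col := Function.update S.col j 1 }

/-- After the dual change: use the tight edge `(i, j)`, where `f` is one plus the mate of
column `j`, or `0` if that column is free. -/
def advance (S : MatchState) (i j f : ℕ) : MatchState :=
  if f = 0 then (S.augment (Function.update (S.alt i) i (j + 1))).reset
  else S.grow (Function.update (S.alt i) i (j + 1)) (f - 1) j

/-- The algorithm is still running. -/
def Active (S : MatchState) (K : ℕ) : Prop := S.halt = 0 ∧ S.cnt < K

/-- One step of the algorithm: a dual change followed by growing the forest or by an
augmentation. -/
def step (n m K : ℕ) (c : ℕ → ℕ → ℝ) (S : MatchState) : MatchState :=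
  open Classical in
  if S.Active K then
    if (S.pick m c n).found = 0 then { S with halt := 1 }
    else (S.shift (S.pick m c n).slack).advance (S.pick m c n).i (S.pick m c n).j
      (findMate S.mate (S.pick m c n).j n)
  else S

/-- The empty matching, with a feasible dual solution. -/
def init (n m : ℕ) (c : ℕ → ℕ → ℝ) : MatchState :=
  let μ := ∑ i ∈ Finset.range n, ∑ j ∈ Finset.range m, max (c i j) 0
  reset { halt := 0, cnt := 0, mate := fun _ => 0, row := fun _ => 0, col := fun _ => 0,
          alt := fun _ _ => 0, u := fun _ => μ, v := fun _ => 0, mu := μ }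

/-- A number of steps after which the algorithm is no longer running. -/
def stepBound (m : ℕ) : ℕ := m * (m + 1) + m + 1

/-- The matching that the algorithm returns. -/
def final (n m K : ℕ) (c : ℕ → ℕ → ℝ) : ℕ → ℕ :=
  ((step n m K c)^[stepBound m] (init n m c)).mate

end MatchState

/-- A matching of profitable edges that are tight for the dual solution `u`, `v`. -/
structure IsTightMatching (n m : ℕ) (c : ℕ → ℕ → ℝ) (u v : ℕ → ℝ) (L : ℕ → ℕ) : Prop where
  le : ∀ i < n, L i ≤ m
  inj : ∀ i < n, ∀ i' < n, ∀ j, L i = j + 1 → L i' = j + 1 → i = i'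
  tight : ∀ i < n, ∀ j, L i = j + 1 → u i + v j = c i j
  pos : ∀ i < n, ∀ j, L i = j + 1 → 0 < c i j

/-- The number of matched rows. -/
def matchCard (n : ℕ) (L : ℕ → ℕ) : ℕ := ((Finset.range n).filter fun i => L i ≠ 0).card

theorem matchCard_update_pos {n : ℕ} {L : ℕ → ℕ} {i j : ℕ} (hi : i < n) (h : L i = 0) :
    matchCard n (Function.update L i (j + 1)) = matchCard n L + 1 := by
  have : (Finset.range n).filter (fun k => Function.update L i (j + 1) k ≠ 0) =
      insert i ((Finset.range n).filter fun k => L k ≠ 0) := by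
    ext k
    by_cases hk : k = i
    · subst hk; simp [hi]
    · simp [hk]
  rw [matchCard, this, Finset.card_insert_of_notMem (by simp [h]), matchCard]

theorem matchCard_update_zero {n : ℕ} {L : ℕ → ℕ} {i : ℕ} (hi : i < n) (h : L i ≠ 0) :
    matchCard n (Function.update L i 0) + 1 = matchCard n L := by
  have : (Finset.range n).filter (fun k => L k ≠ 0) =
      insert i ((Finset.range n).filter fun k => Function.update L i 0 k ≠ 0) := by
    ext k
    by_cases hk : k = i
    · subst hk; simp [hi, h]
    · simp [hk]
  rw [matchCard, matchCard, this, Finset.card_insert_of_notMem (by simp)]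

namespace MatchState

/-- The part of the invariant that concerns one alternative matching. -/
structure AltInv (n m : ℕ) (c : ℕ → ℕ → ℝ) (S : MatchState) (i : ℕ) (L : ℕ → ℕ) : Prop where
  tight : IsTightMatching n m c S.u S.v L
  free : L i = 0
  outside : ∀ i' < n, S.row i' = 0 → L i' = S.mate i'
  root : ∀ i' < n, i' ≠ i → L i' = 0 → S.mate i' = 0
  card : matchCard n L = S.cnt
  cover : ∀ j < m, (∃ i' < n, S.mate i' = j + 1) ↔ ∃ i' < n, L i' = j + 1

/-- The invariant of the matching algorithm. -/
structure Inv (n m K : ℕ) (c : ℕ → ℕ → ℝ) (S : MatchState) : Prop where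
  feas : ∀ i < n, ∀ j < m, c i j ≤ S.u i + S.v j
  mu_nonneg : 0 ≤ S.mu
  mu_le : ∀ i < n, S.mu ≤ S.u i
  v_nonneg : ∀ j < m, 0 ≤ S.v j
  tight : IsTightMatching n m c S.u S.v S.mate
  free : ∀ i < n, S.mate i = 0 → S.u i = S.mu
  v_cover : ∀ j < m, S.v j ≠ 0 → ∃ i < n, S.mate i = j + 1
  card : matchCard n S.mate = S.cnt
  cnt_le : S.cnt ≤ K
  row_free : ∀ i < n, S.mate i = 0 → S.row i ≠ 0
  col_iff : ∀ i < n, ∀ j < m, S.mate i = j + 1 → (S.col j = 0 ↔ S.row i = 0)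
  col_cover : ∀ j < m, S.col j ≠ 0 → ∃ i < n, S.mate i = j + 1
  alt : ∀ i < n, S.row i ≠ 0 → S.AltInv n m c i (S.alt i)
  stopped : S.halt ≠ 0 → ∀ i < n, ∀ j < m, S.row i ≠ 0 → S.col j = 0 →
    S.mu ≤ S.u i + S.v j - c i j

/-- What the search for an edge returns, when all edges that were scanned satisfy `P`. -/
structure PickSpec (S : MatchState) (c : ℕ → ℕ → ℝ) (P : ℕ → ℕ → Prop) (b : Pick) : Prop where
  le : ∀ i j, P i j → S.row i ≠ 0 → S.col j = 0 → b.slack ≤ S.u i + S.v j - c i j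
  not_found : b.found = 0 → b.slack = S.mu
  found : b.found ≠ 0 → P b.i b.j ∧ S.row b.i ≠ 0 ∧ S.col b.j = 0 ∧
    b.slack = S.u b.i + S.v b.j - c b.i b.j ∧ b.slack < S.mu

variable {n m K : ℕ} {c : ℕ → ℕ → ℝ} {S : MatchState}

theorem PickSpec.pickStep {P : ℕ → ℕ → Prop} {b : Pick} (h : PickSpec S c P b) (i j : ℕ) :
    PickSpec S c (fun i' j' => P i' j' ∨ i' = i ∧ j' = j) (S.pickStep c i j b) := by
  have hmu : b.slack ≤ S.mu := by
    by_cases h0 : b.found = 0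
    · exact (h.not_found h0).le
    · exact (h.found h0).2.2.2.2.le
  unfold MatchState.pickStep
  split_ifs with hc
  · refine ⟨?_, by simp, fun _ => ⟨.inr ⟨rfl, rfl⟩, hc.1, hc.2.1, rfl, hc.2.2.trans_le hmu⟩⟩
    rintro i' j' (hP | ⟨rfl, rfl⟩) hr hcol
    · exact hc.2.2.le.trans (h.le i' j' hP hr hcol)
    · exact le_rfl
  · refine ⟨?_, h.not_found, fun hf => ⟨.inl (h.found hf).1, (h.found hf).2⟩⟩
    rintro i' j' (hP | ⟨rfl, rfl⟩) hr hcol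
    · exact h.le i' j' hP hr hcol
    · by_contra hlt
      exact hc ⟨hr, hcol, not_le.1 hlt⟩

theorem PickSpec.congr {P P' : ℕ → ℕ → Prop} {b : Pick} (h : PickSpec S c P b)
    (hP : ∀ i j, P i j ↔ P' i j) : PickSpec S c P' b := by
  have : P = P' := by funext i j; exact propext (hP i j)
  rwa [← this]

theorem PickSpec.pickRow {P : ℕ → ℕ → Prop} {b : Pick} (h : PickSpec S c P b) (i l : ℕ) :
    PickSpec S c (fun i' j' => P i' j' ∨ i' = i ∧ j' < l) (S.pickRow c i b l) := by
  induction l with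
  | zero => exact h.congr fun i j => by simp
  | succ l ih =>
    refine (ih.pickStep i l).congr fun i' j' => ?_
    rw [or_assoc]
    refine or_congr Iff.rfl ?_
    rw [← and_or_left, Nat.lt_succ_iff, le_iff_lt_or_eq]

theorem pickSpec (S : MatchState) (m : ℕ) (c : ℕ → ℕ → ℝ) (k : ℕ) :
    PickSpec S c (fun i j => i < k ∧ j < m) (S.pick m c k) := by
  induction k with
  | zero => exact ⟨by simp, fun _ => rfl, fun h => absurd rfl h⟩
  | succ k ih =>
    refine (ih.pickRow k m).congr fun i j => ?_
    rw [← or_and_right, Nat.lt_succ_iff, le_iff_lt_or_eq]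

theorem findMate_eq_zero {L : ℕ → ℕ} {j k : ℕ} (h : findMate L j k = 0) :
    ∀ i < k, L i ≠ j + 1 := by
  induction k with
  | zero => simp
  | succ k ih =>
    unfold findMate at h
    split_ifs at h with hk
    intro i hi
    rcases Nat.lt_succ_iff_lt_or_eq.1 hi with hi | rfl
    · exact ih h i hi
    · exact hk

theorem findMate_ne_zero {L : ℕ → ℕ} {j k : ℕ} (h : findMate L j k ≠ 0) :
    findMate L j k - 1 < k ∧ L (findMate L j k - 1) = j + 1 := by
  induction k with
  | zero => simp [findMate] at h
  | succ k ih =>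
    unfold findMate at h ⊢
    split_ifs at h ⊢ with hk
    · simpa using hk
    · exact ⟨(ih h).1.trans (Nat.lt_succ_self k), (ih h).2⟩

theorem Inv.tight_shift (h : S.Inv n m K c) {L : ℕ → ℕ} {i : ℕ}
    (hL : S.AltInv n m c i L) (d : ℝ) : IsTightMatching n m c (S.shift d).u (S.shift d).v L := by
  refine ⟨hL.tight.le, hL.tight.inj, fun i' hi' j hj => ?_, hL.tight.pos⟩
  have hjm : j < m := by have := hL.tight.le i' hi'; omega
  rw [← hL.tight.tight i' hi' j hj]
  obtain ⟨i'', hi'', hm⟩ := (hL.cover j hjm).2 ⟨i', hi', hj⟩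
  have hiff := h.col_iff i'' hi'' j hjm hm
  by_cases hr : S.row i' = 0
  · have he : i'' = i' := h.tight.inj i'' hi'' i' hi' j hm (by rw [← hL.outside i' hi' hr, hj])
    subst he
    simp [shift, hr, hiff.2 hr]
  · have hc : S.col j ≠ 0 := fun hc => by
      have hr' := hiff.1 hc
      have he : i'' = i' := hL.tight.inj i'' hi'' i' hi' j (by rw [hL.outside _ hi'' hr', hm]) hj
      subst he
      exact hr hr'
    simp [shift, hr, hc]

theorem Inv.shift (h : S.Inv n m K c) {d : ℝ} (hd : 0 ≤ d) (hdm : d ≤ S.mu)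
    (hslack : ∀ i < n, ∀ j < m, S.row i ≠ 0 → S.col j = 0 → d ≤ S.u i + S.v j - c i j) :
    (S.shift d).Inv n m K c where
  feas i hi j hj := by
    have h1 := h.feas i hi j hj
    have h2 := hslack i hi j hj
    by_cases hr : S.row i = 0 <;> by_cases hc : S.col j = 0 <;> simp [MatchState.shift, hr, hc]
    · exact h1
    · linarith
    · have := h2 hr hc; linarith
    · linarith
  mu_nonneg := by simpa [MatchState.shift] using hdm
  mu_le i hi := by
    have := h.mu_le i hi
    by_cases hr : S.row i = 0 <;> simp [MatchState.shift, hr] <;> linarith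
  v_nonneg j hj := by
    have := h.v_nonneg j hj
    by_cases hc : S.col j = 0 <;> simp [MatchState.shift, hc] <;> linarith
  tight := by
    refine ⟨h.tight.le, h.tight.inj, fun i hi j hj => ?_, h.tight.pos⟩
    have hjm : j < m := by have := h.tight.le i hi; have : S.mate i = j + 1 := hj; omega
    have hiff := h.col_iff i hi j hjm hj
    rw [← h.tight.tight i hi j hj]
    by_cases hr : S.row i = 0
    · simp [MatchState.shift, hr, hiff.2 hr]
    · simp [MatchState.shift, hr, mt hiff.1 hr]
  free i hi hm := by
    have h1 := h.free i hi hm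
    have h2 := h.row_free i hi hm
    simp [MatchState.shift, h2, h1]
  v_cover j hj hv := by
    by_cases hc : S.col j = 0
    · exact h.v_cover j hj (by simpa [MatchState.shift, hc] using hv)
    · exact h.col_cover j hj hc
  card := h.card
  cnt_le := h.cnt_le
  row_free := h.row_free
  col_iff := h.col_iff
  col_cover := h.col_cover
  alt i hi hr :=
    have hA := h.alt i hi hr
    ⟨h.tight_shift hA d, hA.free, hA.outside, hA.root, hA.card, hA.cover⟩
  stopped hs i hi j hj hr hc := by
    have := h.stopped hs i hi j hj hr hc
    have hr' : S.row i ≠ 0 := hr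
    have hc' : S.col j = 0 := hc
    simp [MatchState.shift, hr', hc']
    linarith

theorem Inv.reset (h : ∀ i < n, ∀ j < m, c i j ≤ S.u i + S.v j) (h₁ : 0 ≤ S.mu)
    (h₂ : ∀ i < n, S.mu ≤ S.u i) (h₃ : ∀ j < m, 0 ≤ S.v j)
    (h₄ : IsTightMatching n m c S.u S.v S.mate) (h₅ : ∀ i < n, S.mate i = 0 → S.u i = S.mu)
    (h₆ : ∀ j < m, S.v j ≠ 0 → ∃ i < n, S.mate i = j + 1) (h₇ : matchCard n S.mate = S.cnt)
    (h₈ : S.cnt ≤ K) (h₉ : S.halt = 0) : S.reset.Inv n m K c where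
  feas := h
  mu_nonneg := h₁
  mu_le := h₂
  v_nonneg := h₃
  tight := h₄
  free := h₅
  v_cover := h₆
  card := h₇
  cnt_le := h₈
  row_free i _ hi := by
    have : S.mate i = 0 := hi
    simp [MatchState.reset, this]
  col_iff i _ j _ hi := by
    have : S.mate i = j + 1 := hi
    simp [MatchState.reset, this]
  col_cover j _ hj := by simp [MatchState.reset] at hj
  alt i _ hr := by
    refine ⟨h₄, by simpa [MatchState.reset] using hr, fun _ _ _ => rfl, fun _ _ _ => id, h₇,
      fun _ _ => Iff.rfl⟩
  stopped hs := absurd h₉ hs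

theorem inv_init (n m K : ℕ) (c : ℕ → ℕ → ℝ) : (init n m c).Inv n m K c := by
  have hmu : 0 ≤ ∑ i ∈ Finset.range n, ∑ j ∈ Finset.range m, max (c i j) 0 :=
    Finset.sum_nonneg fun i _ => Finset.sum_nonneg fun j _ => le_max_right _ _
  refine Inv.reset (fun i hi j hj => ?_) hmu (fun _ _ => le_rfl) (fun _ _ => le_rfl)
    ⟨by simp, by simp, by simp, by simp⟩ (fun _ _ _ => rfl) (by simp) (by simp [matchCard])
    (Nat.zero_le _) rfl
  have h1 := Finset.single_le_sum (f := fun j => max (c i j) 0) (fun j _ => le_max_right _ _)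
    (Finset.mem_range.2 hj)
  have h2 := Finset.single_le_sum (f := fun i => ∑ j ∈ Finset.range m, max (c i j) 0)
    (fun i _ => Finset.sum_nonneg fun j _ => le_max_right _ _) (Finset.mem_range.2 hi)
  have h3 := le_max_left (c i j) 0
  simp only at h1 h2 ⊢
  linarith

/-- Adding a tight edge from a row `i` of the forest to a column outside of `L = alt i`. -/
theorem AltInv.tight_update {L : ℕ → ℕ} {i j : ℕ} (hL : S.AltInv n m c i L) (hj : j < m)
    (htight : S.u i + S.v j = c i j) (hpos : 0 < c i j) (hnew : ∀ i' < n, L i' ≠ j + 1) :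
    IsTightMatching n m c S.u S.v (Function.update L i (j + 1)) := by
  refine ⟨fun i' hi' => ?_, fun i₁ h₁ i₂ h₂ j' e₁ e₂ => ?_, fun i' hi' j' e => ?_,
    fun i' hi' j' e => ?_⟩
  · rw [Function.update_apply]; split_ifs
    · exact hj
    · exact hL.tight.le i' hi'
  · rw [Function.update_apply] at e₁ e₂
    split_ifs at e₁ e₂ with a₁ a₂ a₃
    · rw [a₁, a₂]
    · rw [← e₁] at e₂; exact absurd e₂ (hnew _ h₂)
    · rw [← e₂] at e₁; exact absurd e₁ (hnew _ h₁)
    · exact hL.tight.inj i₁ h₁ i₂ h₂ j' e₁ e₂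
  · rw [Function.update_apply] at e
    split_ifs at e with a
    · obtain rfl : j = j' := by omega
      rw [a]; exact htight
    · exact hL.tight.tight i' hi' j' e
  · rw [Function.update_apply] at e
    split_ifs at e with a
    · obtain rfl : j = j' := by omega
      rw [a]; exact hpos
    · exact hL.tight.pos i' hi' j' e

/-- Augmentation along a tight edge to a free column. -/
theorem Inv.augment (h : S.Inv n m K c) (hs : S.halt = 0) (hK : S.cnt < K) {i j : ℕ}
    (hi : i < n) (hj : j < m) (hr : S.row i ≠ 0) (htight : S.u i + S.v j = c i j)
    (hpos : 0 < c i j) (hfree : ∀ i' < n, S.mate i' ≠ j + 1) :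
    (S.augment (Function.update (S.alt i) i (j + 1))).reset.Inv n m K c := by
  have hA := h.alt i hi hr
  have hnew : ∀ i' < n, S.alt i i' ≠ j + 1 := fun i' hi' e => by
    obtain ⟨i'', hi'', e'⟩ := (hA.cover j hj).2 ⟨i', hi', e⟩
    exact hfree i'' hi'' e'
  refine Inv.reset h.feas h.mu_nonneg h.mu_le h.v_nonneg
    (hA.tight_update hj htight hpos hnew) (fun i' hi' e => ?_) (fun j' hj' hv => ?_) ?_ hK hs
  · simp only [MatchState.augment, Function.update_apply] at e
    split_ifs at e with a
    exact h.free i' hi' (hA.root i' hi' a e)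
  · obtain ⟨i', hi', e⟩ := (hA.cover j' hj').1 (h.v_cover j' hj' hv)
    refine ⟨i', hi', ?_⟩
    have : i' ≠ i := by rintro rfl; rw [hA.free] at e; omega
    simp [MatchState.augment, this, e]
  · simp only [MatchState.augment]
    rw [matchCard_update_pos hi hA.free, hA.card]

/-- Growing the forest by a tight edge to a matched column. -/
theorem Inv.grow (h : S.Inv n m K c) (hs : S.halt = 0) {i j k : ℕ} (hi : i < n)
    (hj : j < m) (hk : k < n) (hr : S.row i ≠ 0) (hc : S.col j = 0)
    (htight : S.u i + S.v j = c i j) (hpos : 0 < c i j) (hmate : S.mate k = j + 1) :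
    (S.grow (Function.update (S.alt i) i (j + 1)) k j).Inv n m K c := by
  have hA := h.alt i hi hr
  have hrk : S.row k = 0 := (h.col_iff k hk j hj hmate).1 hc
  have hki : k ≠ i := by rintro rfl; exact hr hrk
  have hAk : S.alt i k = j + 1 := by rw [hA.outside k hk hrk, hmate]
  -- `B` is `alt i` without the edge between `k` and `j`
  set B := Function.update (S.alt i) k 0 with hB
  have hLeq : Function.update (Function.update (S.alt i) i (j + 1)) k 0 =
      Function.update B i (j + 1) := Function.update_comm hki.symm _ _ _
  have hBj : ∀ i' < n, B i' ≠ j + 1 := fun i' hi' e => by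
    rw [hB, Function.update_apply] at e
    split_ifs at e with a
    exact a (hA.tight.inj i' hi' k hk j e hAk)
  have hBle : ∀ i' j', B i' = j' + 1 → S.alt i i' = j' + 1 := fun i' j' e => by
    rw [hB, Function.update_apply] at e
    split_ifs at e with a
    exact e
  have hnewtight : IsTightMatching n m c S.u S.v (Function.update B i (j + 1)) := by
    refine ⟨fun i' hi' => ?_, fun i₁ h₁ i₂ h₂ j' e₁ e₂ => ?_, fun i' hi' j' e => ?_,
      fun i' hi' j' e => ?_⟩
    · rw [Function.update_apply]; split_ifs
      · exact hj
      · rw [hB, Function.update_apply]; split_ifs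
        · exact Nat.zero_le _
        · exact hA.tight.le i' hi'
    · rw [Function.update_apply] at e₁ e₂
      split_ifs at e₁ e₂ with a₁ a₂ a₃
      · rw [a₁, a₂]
      · rw [← e₁] at e₂; exact absurd e₂ (hBj _ h₂)
      · rw [← e₂] at e₁; exact absurd e₁ (hBj _ h₁)
      · exact hA.tight.inj i₁ h₁ i₂ h₂ j' (hBle _ _ e₁) (hBle _ _ e₂)
    · rw [Function.update_apply] at e
      split_ifs at e with a
      · obtain rfl : j = j' := by omega
        rw [a]; exact htight
      · exact hA.tight.tight i' hi' j' (hBle _ _ e)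
    · rw [Function.update_apply] at e
      split_ifs at e with a
      · obtain rfl : j = j' := by omega
        rw [a]; exact hpos
      · exact hA.tight.pos i' hi' j' (hBle _ _ e)
  have hnew : AltInv n m c (S.grow (Function.update (S.alt i) i (j + 1)) k j) k
      (Function.update B i (j + 1)) := by
    refine ⟨hnewtight, ?_, fun i' hi' e => ?_, fun i' hi' a e => ?_, ?_, fun j' hj' => ?_⟩
    · simp [hki, hB]
    · simp only [MatchState.grow, Function.update_apply] at e ⊢
      split_ifs at e with a
      have : i' ≠ i := by rintro rfl; exact hr e
      simp [this, hB, a, hA.outside i' hi' e]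
    · rw [Function.update_apply] at e
      split_ifs at e with b
      rw [hB, Function.update_apply, if_neg a] at e
      exact hA.root i' hi' b e
    · have h1 : matchCard n B + 1 = matchCard n (S.alt i) :=
        matchCard_update_zero hk (by omega)
      rw [matchCard_update_pos hi (by simp [hB, hki.symm, hA.free]), h1]
      exact hA.card
    · change (∃ i' < n, S.mate i' = j' + 1) ↔ _
      rw [hA.cover j' hj']
      constructor
      · rintro ⟨i', hi', e⟩
        by_cases a : j' = j
        · exact ⟨i, hi, by simp [a]⟩
        · refine ⟨i', hi', ?_⟩
          have h1 : i' ≠ i := by rintro rfl; rw [hA.free] at e; omega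
          have h2 : i' ≠ k := by rintro rfl; rw [hAk] at e; omega
          simp [h1, hB, h2, e]
      · rintro ⟨i', hi', e⟩
        rw [Function.update_apply] at e
        split_ifs at e with a
        · obtain rfl : j = j' := by omega
          exact ⟨k, hk, hAk⟩
        · exact ⟨i', hi', hBle _ _ e⟩
  refine ⟨h.feas, h.mu_nonneg, h.mu_le, h.v_nonneg, h.tight, h.free, h.v_cover, h.card, h.cnt_le,
    fun i' hi' e => ?_, fun i' hi' j' hj' e => ?_, fun j' hj' e => ?_, fun i' hi' e => ?_,
    fun hs' => absurd hs hs'⟩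
  · simp only [MatchState.grow, Function.update_apply]
    split_ifs
    · simp
    · exact h.row_free i' hi' e
  · have e : S.mate i' = j' + 1 := e
    simp only [MatchState.grow, Function.update_apply]
    by_cases a : i' = k
    · have : j' = j := by rw [a, hmate] at e; omega
      simp [a, this]
    · have : j' ≠ j := by
        rintro rfl
        exact a (h.tight.inj i' hi' k hk _ e hmate)
      simp only [a, this, if_false]
      exact h.col_iff i' hi' j' hj' e
  · simp only [MatchState.grow, Function.update_apply] at e
    split_ifs at e with a
    · exact ⟨k, hk, by rw [a]; exact hmate⟩
    · exact h.col_cover j' hj' e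
  · by_cases a : i' = k
    · subst a
      have : (S.grow (Function.update (S.alt i) i (j + 1)) i' j).alt i' =
          Function.update B i (j + 1) := by
        rw [← hLeq]; simp [MatchState.grow]
      rw [this]
      exact hnew
    · have e' : S.row i' ≠ 0 := by simpa [MatchState.grow, a] using e
      have hA' := h.alt i' hi' e'
      have : (S.grow (Function.update (S.alt i) i (j + 1)) k j).alt i' = S.alt i' := by
        simp [MatchState.grow, a]
      rw [this]
      refine ⟨hA'.tight, hA'.free, fun i'' hi'' e'' => hA'.outside i'' hi'' ?_, hA'.root,
        hA'.card, hA'.cover⟩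
      simp only [MatchState.grow, Function.update_apply] at e''
      split_ifs at e'' with b
      exact e''

/-- The number of columns in the forest. -/
def colCard (m : ℕ) (S : MatchState) : ℕ := ((Finset.range m).filter fun j => S.col j ≠ 0).card

/-- The measure of progress: augmentations count more than growing the forest. -/
def progress (m : ℕ) (S : MatchState) : ℕ := S.cnt * (m + 1) + S.colCard m

theorem colCard_le (m : ℕ) (S : MatchState) : S.colCard m ≤ m :=
  (Finset.card_filter_le _ _).trans (Finset.card_range m).le

theorem Inv.step (h : S.Inv n m K c) : (S.step n m K c).Inv n m K c ∧
    ((S.step n m K c).Active K → S.progress m < (S.step n m K c).progress m) := by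
  unfold MatchState.step
  split_ifs with hact hf
  · have hp := pickSpec S m c n
    refine ⟨⟨h.feas, h.mu_nonneg, h.mu_le, h.v_nonneg, h.tight, h.free, h.v_cover, h.card,
      h.cnt_le, h.row_free, h.col_iff, h.col_cover,
      fun i hi hr => have hA := h.alt i hi hr
        ⟨hA.tight, hA.free, hA.outside, hA.root, hA.card, hA.cover⟩,
      fun _ i hi j hj hr hc => ?_⟩, fun ha => absurd ha.1 (by simp)⟩
    rw [← hp.not_found hf]
    exact hp.le i j ⟨hi, hj⟩ hr hc
  · have hp := pickSpec S m c n
    obtain ⟨⟨hi, hj⟩, hr, hc, hsl, hlt⟩ := hp.found hf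
    set b := S.pick m c n with hb
    have hsh := h.shift (d := b.slack) (by have := h.feas _ hi _ hj; linarith) hlt.le
      (fun i hi j hj hr hc => hp.le i j ⟨hi, hj⟩ hr hc)
    have ht : (S.shift b.slack).u b.i + (S.shift b.slack).v b.j = c b.i b.j := by
      simp [MatchState.shift, hr, hc]; linarith
    have hpos : 0 < c b.i b.j := by
      rw [← ht]
      have h1 := hsh.mu_le b.i hi
      have h2 := hsh.v_nonneg b.j hj
      have h3 : (S.shift b.slack).mu = S.mu - b.slack := rfl
      linarith
    unfold advance
    split_ifs with hz
    · refine ⟨hsh.augment hact.1 hact.2 hi hj hr ht hpos (findMate_eq_zero hz), fun _ => ?_⟩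
      have := S.colCard_le m
      simp only [progress, MatchState.reset, MatchState.augment, MatchState.shift]
      rw [Nat.succ_mul]
      omega
    · obtain ⟨hk, hm⟩ := findMate_ne_zero hz
      refine ⟨hsh.grow hact.1 hi hj hk hr hc ht hpos hm, fun _ => ?_⟩
      simp only [progress, colCard, MatchState.grow, MatchState.shift]
      refine Nat.add_lt_add_left (Finset.card_lt_card ⟨fun j' => ?_, fun hsub => ?_⟩) _
      · simp only [Finset.mem_filter, Function.update_apply]
        rintro ⟨h1, h2⟩
        refine ⟨h1, ?_⟩
        split_ifs <;> simp [h2]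
      · have := hsub (Finset.mem_filter.2 ⟨Finset.mem_range.2 hj, by simp⟩)
        simp [hc] at this
  · exact ⟨h, fun ha => absurd ha hact⟩

theorem step_of_not_active (h : ¬ S.Active K) : S.step n m K c = S := if_neg h

theorem inv_iterate (n m K : ℕ) (c : ℕ → ℕ → ℝ) (t : ℕ) :
    ((MatchState.step n m K c)^[t] (init n m c)).Inv n m K c := by
  induction t with
  | zero => exact inv_init n m K c
  | succ t ih => rw [Function.iterate_succ_apply']; exact ih.step.1

theorem progress_iterate (n m K : ℕ) (c : ℕ → ℕ → ℝ) (t : ℕ)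
    (h : ((MatchState.step n m K c)^[t] (init n m c)).Active K) :
    t ≤ ((MatchState.step n m K c)^[t] (init n m c)).progress m := by
  induction t with
  | zero => exact Nat.zero_le _
  | succ t ih =>
    rw [Function.iterate_succ_apply'] at h ⊢
    have hact : ((MatchState.step n m K c)^[t] (init n m c)).Active K := by
      by_contra hna
      rw [step_of_not_active hna] at h
      exact hna h
    exact (ih hact).trans_lt ((inv_iterate n m K c t).step.2 h)

theorem not_active_of_le (hK : K ≤ m) {t : ℕ} (ht : stepBound m ≤ t) :
    ¬ ((MatchState.step n m K c)^[t] (init n m c)).Active K := fun h => by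
  have h1 := progress_iterate n m K c t h
  have h2 := ((MatchState.step n m K c)^[t] (init n m c)).colCard_le m
  have h3 := (inv_iterate n m K c t).cnt_le.trans hK
  have h4 := Nat.mul_le_mul_right (m + 1) h3
  unfold progress at h1
  unfold stepBound at ht
  omega

/-- Complementary slackness: with `mu = 0` or `cnt = K`, the dual solution proves that the matching
has maximal weight. -/
theorem Inv.optimal (h : S.Inv n m K c) (hend : S.mu = 0 ∨ S.cnt = K)
    (x : Fin n → Fin m → ℝ) (hx : ∀ i j, 0 ≤ x i j) (hrow : ∀ i, ∑ j, x i j ≤ 1)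
    (hcol : ∀ j, ∑ i, x i j ≤ 1) (hK : ∑ i, ∑ j, x i j ≤ K) :
    ∑ i, ∑ j, x i j * c i j ≤
      ∑ i : Fin n, ∑ j : Fin m, if S.mate i = j + 1 then c i j else 0 := by
  have hsum1 : ∑ i, ∑ j, x i j * c i j ≤
      ∑ i : Fin n, (S.u i - S.mu) + S.mu * ∑ i, ∑ j, x i j + ∑ j : Fin m, S.v j := by
    calc ∑ i, ∑ j, x i j * c i j
        ≤ ∑ i, ∑ j, (x i j * (S.u i - S.mu) + S.mu * x i j + x i j * S.v j) := by
          refine Finset.sum_le_sum fun i _ => Finset.sum_le_sum fun j _ => ?_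
          have := mul_le_mul_of_nonneg_left (h.feas i i.2 j j.2) (hx i j)
          linarith
      _ = ∑ i : Fin n, (∑ j, x i j) * (S.u i - S.mu) + S.mu * ∑ i, ∑ j, x i j
          + ∑ j : Fin m, (∑ i, x i j) * S.v j := by
          simp only [Finset.sum_add_distrib, Finset.sum_mul, Finset.mul_sum]
          congr 1
          exact Finset.sum_comm
      _ ≤ _ := by
          refine add_le_add (add_le_add (Finset.sum_le_sum fun i _ => ?_) le_rfl)
            (Finset.sum_le_sum fun j _ => ?_)
          · have := h.mu_le i i.2
            exact mul_le_of_le_one_left (by linarith) (hrow i)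
          · exact mul_le_of_le_one_left (h.v_nonneg j j.2) (hcol j)
  have hmu : S.mu * ∑ i, ∑ j, x i j ≤ S.cnt * S.mu := by
    rcases hend with h0 | h0
    · simp [h0]
    · rw [h0, mul_comm]; exact mul_le_mul_of_nonneg_right hK h.mu_nonneg
  have hone : ∀ i : Fin n, S.mate i ≠ 0 →
      ∃ j : Fin m, ∀ j' : Fin m, S.mate i = j' + 1 ↔ j' = j := fun i hi => by
    have := h.tight.le i i.2
    refine ⟨⟨S.mate i - 1, by omega⟩, fun j' => ?_⟩
    rw [Fin.ext_iff]
    simp only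
    omega
  have hcard : (S.cnt : ℝ) = ∑ i : Fin n, if S.mate i = 0 then (0 : ℝ) else 1 := by
    rw [← h.card, matchCard, Finset.sum_fin_eq_sum_range
      (fun i : Fin n => if S.mate i = 0 then (0 : ℝ) else 1), Finset.card_filter]
    push_cast
    refine Finset.sum_congr rfl fun i hi => ?_
    by_cases h0 : S.mate i = 0 <;> simp [h0, Finset.mem_range.1 hi]
  have hu : ∑ i : Fin n, (S.u i - S.mu) + S.cnt * S.mu =
      ∑ i : Fin n, ∑ j : Fin m, if S.mate i = j + 1 then S.u i else 0 := by
    rw [hcard, Finset.sum_mul, ← Finset.sum_add_distrib]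
    refine Finset.sum_congr rfl fun i _ => ?_
    by_cases h0 : S.mate i = 0
    · simp [h0, h.free i i.2 h0]
    · obtain ⟨j, hj⟩ := hone i h0
      simp [h0, hj]
  have hv : ∑ j : Fin m, S.v j =
      ∑ i : Fin n, ∑ j : Fin m, if S.mate i = j + 1 then S.v j else 0 := by
    rw [Finset.sum_comm]
    refine Finset.sum_congr rfl fun j _ => ?_
    by_cases h0 : S.v j = 0
    · simp [h0]
    · obtain ⟨i, hi, e⟩ := h.v_cover j j.2 h0
      have : ∀ i' : Fin n, S.mate i' = j + 1 ↔ i' = ⟨i, hi⟩ := fun i' => by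
        rw [Fin.ext_iff]
        constructor
        · exact fun e' => h.tight.inj i' i'.2 i hi j e' e
        · intro e'; simp only at e'; rw [e', e]
      simp [this]
  have hw : ∑ i : Fin n, ∑ j : Fin m, (if S.mate i = j + 1 then c i j else 0) =
      ∑ i : Fin n, ∑ j : Fin m, (if S.mate i = j + 1 then S.u i else 0) +
      ∑ i : Fin n, ∑ j : Fin m, (if S.mate i = j + 1 then S.v j else 0) := by
    simp only [← Finset.sum_add_distrib]
    refine Finset.sum_congr rfl fun i _ => Finset.sum_congr rfl fun j _ => ?_
    split_ifs with h0
    · exact (h.tight.tight i i.2 j h0).symm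
    · simp
  rw [hw, ← hu, ← hv]
  linarith

/-- The matching returned by the algorithm is feasible, consists of profitable edges, and has
maximal weight among all (even fractional) matchings of size at most `K`. -/
theorem final_spec (n : ℕ) {m K : ℕ} (hK : K ≤ m) (c : ℕ → ℕ → ℝ) :
    (∀ i < n, final n m K c i ≤ m) ∧
    (∀ i < n, ∀ i' < n, ∀ j, final n m K c i = j + 1 → final n m K c i' = j + 1 → i = i') ∧
    (∀ i < n, ∀ j, final n m K c i = j + 1 → 0 < c i j) ∧
    matchCard n (final n m K c) ≤ K ∧
    ∀ x : Fin n → Fin m → ℝ, (∀ i j, 0 ≤ x i j) → (∀ i, ∑ j, x i j ≤ 1) →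
      (∀ j, ∑ i, x i j ≤ 1) → ∑ i, ∑ j, x i j ≤ K →
      ∑ i, ∑ j, x i j * c i j ≤
        ∑ i : Fin n, ∑ j : Fin m, if final n m K c i = j + 1 then c i j else 0 := by
  have h := inv_iterate n m K c (stepBound m)
  have hna := not_active_of_le (n := n) (c := c) hK (le_refl (stepBound m))
  set S := (MatchState.step n m K c)^[stepBound m] (init n m c) with hS
  have hmate : final n m K c = S.mate := rfl
  rw [hmate]
  refine ⟨h.tight.le, h.tight.inj, h.tight.pos, h.card.trans_le h.cnt_le, ?_⟩
  by_cases hs : S.halt = 0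
  · have hcnt : S.cnt = K := by
      have := h.cnt_le
      by_contra hne
      exact hna ⟨hs, by omega⟩
    exact h.optimal (.inr hcnt)
  · exact (h.shift h.mu_nonneg le_rfl (h.stopped hs)).optimal
      (.inl (by simp [MatchState.shift]))

end MatchState

/-! ### Newton's method for the optimal allocation -/

/-- The odds `p / (1 - p)`. -/
def odds (p : ℕ → ℕ → ℝ) (i j : ℕ) : ℝ := p i j / (1 - p i j)

/-- The weight of the edge `(i, j)` in the parametric assignment problem with parameter `R`. -/
def netWeight (p : ℕ → ℕ → ℝ) (w : ℕ → ℝ) (R : ℝ) (i j : ℕ) : ℝ := odds p i j * (w i - R)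

/-- The numerator of the objective, for the allocation encoded by `L`. -/
def objNum (n : ℕ) (p : ℕ → ℕ → ℝ) (w : ℕ → ℝ) (L : ℕ → ℕ) : ℝ :=
  ∑ i ∈ Finset.range n, if L i = 0 then 0 else odds p i (L i - 1) * w i

/-- The denominator of the objective, for the allocation encoded by `L`. -/
def objDen (n : ℕ) (p : ℕ → ℕ → ℝ) (L : ℕ → ℕ) : ℝ :=
  1 + ∑ i ∈ Finset.range n, if L i = 0 then 0 else odds p i (L i - 1)

/-- The state of Newton's method: the current lower bound `R` on the optimal value, the last
matching, and whether a further step is needed. -/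
structure NewtonState where
  go : ℕ
  R : ℝ
  mate : ℕ → ℕ

namespace NewtonState

/-- Solve the assignment problem for the current parameter, and move the parameter to the value
of the solution. -/
def step (n m K : ℕ) (p : ℕ → ℕ → ℝ) (w : ℕ → ℝ) (S : NewtonState) : NewtonState :=
  open Classical in
  if S.go = 0 then S
  else
    let L := MatchState.final n m K (netWeight p w S.R)
    if objNum n p w L - S.R * objDen n p L ≤ 0 then ⟨0, S.R, L⟩
    else ⟨S.go, objNum n p w L / objDen n p L, L⟩

/-- The starting point: value `0`. -/
def init : NewtonState := ⟨1, 0, fun _ => 0⟩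

/-- The number of Newton steps that always suffices. -/
def stepBound (n m : ℕ) : ℕ := newtonBound (n * m + 1) + 1

/-- The result of Newton's method. -/
def final (n m K : ℕ) (p : ℕ → ℕ → ℝ) (w : ℕ → ℝ) : NewtonState :=
  (step n m K p w)^[stepBound n m] init

end NewtonState

namespace PositionAuction

variable {n m : ℕ} (A : PositionAuction n m)

/-- The click-through rates, extended by zero. -/
def rate (i j : ℕ) : ℝ := if h : i < n ∧ j < m then A.p ⟨i, h.1⟩ ⟨j, h.2⟩ else 0

/-- A vector, extended by zero. -/
def extend (w : Fin n → ℝ) (i : ℕ) : ℝ := if h : i < n then w ⟨i, h⟩ else 0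

@[simp] theorem extend_coe (w : Fin n → ℝ) (i : Fin n) : extend w i = w i := by simp [extend]

@[simp] theorem rate_coe (i : Fin n) (j : Fin m) : A.rate i j = A.p i j := by simp [rate]

theorem exp_logOdds (i : Fin n) (j : Fin m) :
    Real.exp (A.logOdds i j) = odds A.rate i j := by
  have h1 := A.p_pos i j
  have h2 := A.p_lt_one i j
  rw [logOdds, Real.exp_log (div_pos h1 (by linarith)), odds, rate_coe]

theorem odds_pos (i : Fin n) (j : Fin m) : 0 < odds A.rate i j := by
  rw [← exp_logOdds]; exact Real.exp_pos _

/-- The encoding `L` of a partial matching of advertisers to positions is a feasible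
allocation. -/
structure IsFeasible (L : ℕ → ℕ) : Prop where
  le : ∀ i < n, L i ≤ m
  inj : ∀ i < n, ∀ i' < n, ∀ j, L i = j + 1 → L i' = j + 1 → i = i'
  card : matchCard n L ≤ A.K

variable {A}

theorem sum_ite_mate {β : Type*} [AddCommMonoid β] {k : ℕ} (hk : k ≤ m) (f : ℕ → β) :
    ∑ j : Fin m, (if k = j + 1 then f j else 0) = if k = 0 then 0 else f (k - 1) := by
  rcases k with _ | k
  · simp
  · have : ∀ j : Fin m, k + 1 = j + 1 ↔ j = ⟨k, hk⟩ := fun j => by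
      rw [Fin.ext_iff]; simp only; omega
    simp only [this]
    simp

theorem IsFeasible.sum_eq_matchCard {L : ℕ → ℕ} (h : A.IsFeasible L) :
    ∑ i : Fin n, ∑ j : Fin m, (if L i = j + 1 then 1 else 0) = matchCard n L := by
  rw [matchCard, Finset.card_filter, Finset.sum_range]
  refine Finset.sum_congr rfl fun i _ => ?_
  rw [sum_ite_mate (h.le i i.2) (fun _ => 1)]
  by_cases h0 : L i = 0 <;> simp [h0]

/-- The allocation that is encoded by `L`. -/
def IsFeasible.alloc {L : ℕ → ℕ} (h : A.IsFeasible L) : A.Allocation :=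
  ⟨fun i j => if L i = j + 1 then 1 else 0, by
    have hval : ∀ (i : Fin n) (j : Fin m), (((if L i = j + 1 then 1 else 0 : Fin 2) : Fin 2) : ℕ) =
        if L i = j + 1 then 1 else 0 := fun i j => by split_ifs <;> rfl
    simp only [hval]
    refine ⟨fun i => ?_, fun j => ?_, h.sum_eq_matchCard.trans_le h.card⟩
    · rw [sum_ite_mate (h.le i i.2) (fun _ => 1)]
      split_ifs <;> simp
    · rw [← Finset.card_filter, Finset.card_le_one]
      intro i hi i' hi'
      rw [Finset.mem_filter] at hi hi'
      exact Fin.ext (h.inj i i.2 i' i'.2 j hi.2 hi'.2)⟩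

theorem IsFeasible.alloc_val {L : ℕ → ℕ} (h : A.IsFeasible L) (i : Fin n) (j : Fin m) :
    (h.alloc.1 i j : ℕ) = if L i = j + 1 then 1 else 0 := by
  simp only [alloc]; split_ifs <;> rfl

/-- The total weight of the ads shown. -/
def denom (A : PositionAuction n m) (x : A.Allocation) : ℝ :=
  1 + ∑ i, ∑ j, (x.1 i j : ℕ) * odds A.rate i j

theorem clickRate_eq (x : A.Allocation) (i : Fin n) :
    A.clickRate x i = (∑ j, (x.1 i j : ℕ) * odds A.rate i j) / A.denom x := by
  simp only [clickRate, exp_logOdds, denom]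

theorem denom_pos (x : A.Allocation) : 0 < A.denom x :=
  add_pos_of_pos_of_nonneg one_pos (Finset.sum_nonneg fun i _ => Finset.sum_nonneg fun j _ =>
    mul_nonneg (Nat.cast_nonneg _) (A.odds_pos i j).le)

theorem clickRate_nonneg (x : A.Allocation) (i : Fin n) : 0 ≤ A.clickRate x i := by
  rw [clickRate_eq]
  exact div_nonneg (Finset.sum_nonneg fun j _ =>
    mul_nonneg (Nat.cast_nonneg _) (A.odds_pos i j).le) (denom_pos x).le

theorem clickRate_le_one (x : A.Allocation) (i : Fin n) : A.clickRate x i ≤ 1 := by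
  rw [clickRate_eq, div_le_one (denom_pos x), denom]
  have h := Finset.single_le_sum (f := fun i => ∑ j, ((x.1 i j : ℕ) : ℝ) * odds A.rate i j)
    (fun i _ => Finset.sum_nonneg fun j _ =>
      mul_nonneg (Nat.cast_nonneg _) (A.odds_pos i j).le) (Finset.mem_univ i)
  exact h.trans (le_add_of_nonneg_left zero_le_one)

/-- The parametric objective of an allocation is a sum over its edges. -/
theorem sum_netWeight (w : Fin n → ℝ) (R : ℝ) (x : Fin n → Fin m → ℝ) :
    ∑ i, ∑ j, x i j * netWeight A.rate (extend w) R i j =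
      ∑ i, ∑ j, w i * (x i j * odds A.rate i j) - R * ∑ i, ∑ j, x i j * odds A.rate i j := by
  simp only [Finset.mul_sum, ← Finset.sum_sub_distrib, netWeight, extend_coe]
  exact Finset.sum_congr rfl fun i _ => Finset.sum_congr rfl fun j _ => by ring

theorem sum_mul_clickRate (w : Fin n → ℝ) (x : A.Allocation) :
    ∑ i, w i * A.clickRate x i =
      (∑ i, ∑ j, w i * ((x.1 i j : ℕ) * odds A.rate i j)) / A.denom x := by
  refine Eq.trans (Finset.sum_congr rfl fun i _ => ?_) (Finset.sum_div _ _ _).symm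
  rw [clickRate_eq, ← Finset.mul_sum, mul_div_assoc]

theorem objNum_eq {L : ℕ → ℕ} (h : A.IsFeasible L) (w : Fin n → ℝ) :
    objNum n A.rate (extend w) L =
      ∑ i, ∑ j, w i * ((h.alloc.1 i j : ℕ) * odds A.rate i j) := by
  rw [objNum, Finset.sum_range]
  refine Finset.sum_congr rfl fun i _ => ?_
  rw [← sum_ite_mate (h.le i i.2) (fun j => odds A.rate i j * extend w i)]
  refine Finset.sum_congr rfl fun j _ => ?_
  rw [h.alloc_val, extend_coe]
  split_ifs <;> simp [mul_comm]

theorem objDen_eq {L : ℕ → ℕ} (h : A.IsFeasible L) :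
    objDen n A.rate L = A.denom h.alloc := by
  rw [objDen, denom, Finset.sum_range]
  congr 1
  refine Finset.sum_congr rfl fun i _ => ?_
  rw [← sum_ite_mate (h.le i i.2) (fun j => odds A.rate i j)]
  refine Finset.sum_congr rfl fun j _ => ?_
  rw [h.alloc_val]
  split_ifs <;> simp

theorem clickRate_alloc {L : ℕ → ℕ} (h : A.IsFeasible L) (i : Fin n) :
    A.clickRate h.alloc i =
      if L i = 0 then 0 else odds A.rate i (L i - 1) / objDen n A.rate L := by
  rw [clickRate_eq, objDen_eq h]
  have : ∑ j, ((h.alloc.1 i j : ℕ) : ℝ) * odds A.rate i j =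
      if L i = 0 then 0 else odds A.rate i (L i - 1) := by
    rw [← sum_ite_mate (h.le i i.2) (fun j => odds A.rate i j)]
    refine Finset.sum_congr rfl fun j _ => ?_
    rw [h.alloc_val]
    split_ifs <;> simp
  rw [this]
  split_ifs <;> simp

theorem isFeasible_final (A : PositionAuction n m) (c : ℕ → ℕ → ℝ) :
    A.IsFeasible (MatchState.final n m A.K c) :=
  have h := MatchState.final_spec n A.K_le c
  ⟨h.1, h.2.1, h.2.2.2.1⟩

/-- The matching algorithm maximizes the parametric objective over all feasible allocations. -/
theorem parametric_optimal (w : Fin n → ℝ) (R : ℝ) (x : A.Allocation) :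
    (∑ i, ∑ j, w i * ((x.1 i j : ℕ) * odds A.rate i j)) - R * A.denom x ≤
      objNum n A.rate (extend w) (MatchState.final n m A.K (netWeight A.rate (extend w) R)) -
        R * objDen n A.rate (MatchState.final n m A.K (netWeight A.rate (extend w) R)) := by
  have hf := A.isFeasible_final (netWeight A.rate (extend w) R)
  have h := (MatchState.final_spec n A.K_le (netWeight A.rate (extend w) R)).2.2.2.2
    (fun i j => ((x.1 i j : ℕ) : ℝ)) (fun i j => Nat.cast_nonneg _)
    (fun i => by exact_mod_cast x.2.1 i) (fun j => by exact_mod_cast x.2.2.1 j)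
    (by exact_mod_cast x.2.2.2)
  have e : (∑ i : Fin n, ∑ j : Fin m,
      if MatchState.final n m A.K (netWeight A.rate (extend w) R) i = j + 1 then
        netWeight A.rate (extend w) R i j else 0) =
      ∑ i, ∑ j, ((hf.alloc.1 i j : ℕ) : ℝ) * netWeight A.rate (extend w) R i j := by
    refine Finset.sum_congr rfl fun i _ => Finset.sum_congr rfl fun j _ => ?_
    rw [hf.alloc_val]
    split_ifs <;> simp
  rw [e, sum_netWeight, sum_netWeight] at h
  rw [objNum_eq hf, objDen_eq hf]
  unfold denom
  linarith

/-- The result of Newton's method: it has stopped, its matching is a feasible allocation all of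
whose ads have weights above the optimal value `R`, and `R` is attained by it. -/
structure IsOptimalResult (A : PositionAuction n m) (w : Fin n → ℝ) (S : NewtonState) :
    Prop where
  go : S.go = 0
  feasible : A.IsFeasible S.mate
  nonneg : 0 ≤ S.R
  value : ∑ i, w i * A.clickRate feasible.alloc i = S.R
  optimal : ∀ x : A.Allocation, ∑ i, w i * A.clickRate x i ≤ S.R
  lt_weight : ∀ i : Fin n, S.mate i ≠ 0 → S.R < w i

/-- Newton's sequence of parameters. -/
def newtonSeq (A : PositionAuction n m) (w : Fin n → ℝ) : ℕ → ℝ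
  | 0 => 0
  | t + 1 =>
    let L := MatchState.final n m A.K (netWeight A.rate (extend w) (newtonSeq A w t))
    objNum n A.rate (extend w) L / objDen n A.rate L

/-- The empty allocation. -/
theorem isFeasible_empty (A : PositionAuction n m) : A.IsFeasible fun _ => 0 :=
  ⟨by simp, by simp, by simp [matchCard]⟩

theorem final_isOptimalResult (A : PositionAuction n m) (w : Fin n → ℝ) :
    IsOptimalResult A w (NewtonState.final n m A.K A.rate (extend w)) := by
  classical
  set R := newtonSeq A w with hR
  set L : ℕ → ℕ → ℕ := fun t => MatchState.final n m A.K (netWeight A.rate (extend w) (R t))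
    with hL
  have hf : ∀ t, A.IsFeasible (L t) := fun t => A.isFeasible_final _
  set g : ℕ → ℝ := fun t => objNum n A.rate (extend w) (L t) - R t * objDen n A.rate (L t)
    with hg
  have hden : ∀ t, 0 < objDen n A.rate (L t) := fun t => by
    rw [objDen_eq (hf t)]; exact denom_pos _
  have hopt : ∀ t (x : A.Allocation),
      (∑ i, ∑ j, w i * ((x.1 i j : ℕ) * odds A.rate i j)) - R t * A.denom x ≤ g t :=
    fun t x => parametric_optimal w (R t) x
  -- the values of the parametric problems are nonnegative
  have hg0 : ∀ t, 0 ≤ g t := fun t => by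
    cases t with
    | zero =>
      have := hopt 0 A.isFeasible_empty.alloc
      rw [← objNum_eq A.isFeasible_empty, ← objDen_eq A.isFeasible_empty] at this
      simpa [objNum, hR, newtonSeq] using this
    | succ t =>
      have := hopt (t + 1) (hf t).alloc
      rw [← objNum_eq (hf t), ← objDen_eq (hf t)] at this
      have e : R (t + 1) = objNum n A.rate (extend w) (L t) / objDen n A.rate (L t) := rfl
      rw [e, div_mul_cancel₀ _ (hden t).ne', sub_self] at this
      exact this
  have hzero : ∃ t ≤ newtonBound (n * m + 1), g t ≤ 0 := by
    let sel : ℕ → Finset (Fin n × Fin m) := fun t =>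
      Finset.univ.filter fun e => L t e.1 = e.2 + 1
    have hsel : ∀ (t : ℕ) (f : Fin n → Fin m → ℝ), ∑ e ∈ sel t, f e.1 e.2 =
        ∑ i, ∑ j, ((hf t).alloc.1 i j : ℕ) * f i j := fun t f => by
      simp only [sel, Finset.sum_filter, Fintype.sum_prod_type]
      refine Finset.sum_congr rfl fun i _ => Finset.sum_congr rfl fun j _ => ?_
      rw [(hf t).alloc_val]
      split_ifs <;> simp
    have hN : ∀ t, ∑ e ∈ sel t, w e.1 * odds A.rate e.1 e.2 =
        objNum n A.rate (extend w) (L t) := fun t => by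
      rw [hsel t (fun i j => w i * odds A.rate i j), objNum_eq (hf t)]
      exact Finset.sum_congr rfl fun i _ => Finset.sum_congr rfl fun j _ => by ring
    have hD : ∀ t, 1 + ∑ e ∈ sel t, odds A.rate e.1 e.2 = objDen n A.rate (L t) := fun t => by
      rw [hsel t (fun i j => odds A.rate i j), objDen_eq (hf t), denom]
    have := exists_newton_nonpos (E := Fin n × Fin m)
      (a := fun e => odds A.rate e.1 e.2) (b := fun e => w e.1 * odds A.rate e.1 e.2)
      (sel := sel) (R := R) (fun e => A.odds_pos e.1 e.2)
      (fun t => by rw [hN, hD]; rfl)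
      (fun t s => by
        rw [hN, hN, hD, hD]
        have := hopt t (hf s).alloc
        rwa [← objNum_eq (hf s), ← objDen_eq (hf s)] at this)
    simp only [hN, hD] at this
    simp only [Fintype.card_prod, Fintype.card_fin] at this
    exact this
  obtain ⟨t₀, ht₀, hgt₀⟩ := hzero
  have hex : ∃ t, g t ≤ 0 := ⟨t₀, hgt₀⟩
  set t := Nat.find hex with ht
  have htg : g t ≤ 0 := Nat.find_spec hex
  have htb : t ≤ newtonBound (n * m + 1) := (Nat.find_min' hex hgt₀).trans ht₀
  have hiter : ∀ s ≤ t, ∃ L', (NewtonState.step n m A.K A.rate (extend w))^[s]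
      NewtonState.init = ⟨1, R s, L'⟩ := by
    intro s
    induction s with
    | zero => intro _; exact ⟨_, rfl⟩
    | succ s ih =>
      intro hs
      obtain ⟨L', hL'⟩ := ih (by omega)
      refine ⟨L s, ?_⟩
      rw [Function.iterate_succ_apply', hL', NewtonState.step, if_neg one_ne_zero]
      have : ¬ g s ≤ 0 := Nat.find_min hex (by omega)
      exact if_neg this
  have hfinal : NewtonState.final n m A.K A.rate (extend w) = ⟨0, R t, L t⟩ := by
    obtain ⟨L', hL'⟩ := hiter t le_rfl
    have h1 : (NewtonState.step n m A.K A.rate (extend w))^[t + 1] NewtonState.init =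
        ⟨0, R t, L t⟩ := by
      rw [Function.iterate_succ_apply', hL', NewtonState.step, if_neg one_ne_zero]
      exact if_pos htg
    have h2 : NewtonState.stepBound n m = (newtonBound (n * m + 1) - t) + (t + 1) := by
      rw [NewtonState.stepBound]; omega
    rw [NewtonState.final, h2, Function.iterate_add_apply, h1]
    exact Function.iterate_fixed (show NewtonState.step n m A.K A.rate (extend w)
      ⟨0, R t, L t⟩ = ⟨0, R t, L t⟩ from if_pos rfl) _
  have hgt : g t = 0 := le_antisymm htg (hg0 t)
  have hRt : objNum n A.rate (extend w) (L t) = R t * objDen n A.rate (L t) := by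
    have := hgt; simp only [hg] at this; linarith
  have hval : ∑ i, w i * A.clickRate (hf t).alloc i = R t := by
    rw [sum_mul_clickRate, ← objNum_eq (hf t), ← objDen_eq (hf t), hRt,
      mul_div_assoc, div_self (hden t).ne', mul_one]
  have hoptR : ∀ x : A.Allocation, ∑ i, w i * A.clickRate x i ≤ R t := fun x => by
    rw [sum_mul_clickRate, div_le_iff₀ (denom_pos x)]
    have := hopt t x
    linarith
  rw [hfinal]
  refine ⟨rfl, hf t, ?_, hval, hoptR, fun i hi => ?_⟩
  · refine le_trans (le_of_eq ?_) (hoptR A.isFeasible_empty.alloc)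
    simp [clickRate_alloc]
  · have hi : L t i ≠ 0 := hi
    have hle := (hf t).le i i.2
    obtain ⟨j, hj⟩ : ∃ j : Fin m, L t i = j + 1 := ⟨⟨L t i - 1, by omega⟩, by simp only; omega⟩
    have := (MatchState.final_spec n A.K_le (netWeight A.rate (extend w) (R t))).2.2.1 i i.2 j hj
    rw [netWeight, extend_coe] at this
    have := (pos_iff_pos_of_mul_pos this).1 (A.odds_pos i j)
    simp only
    linarith

end PositionAuction

namespace RealRAM

/-! ### Programs for matchings and for Newton's method -/

/-! The arrays of natural numbers are: `0` sizes, `1` output allocation, `2`-`4` loop variables,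
`5` mate, `6` row, `7` col, `8` alt, `9` cnt, `10` halt, `11` found, `12` and `13` the picked edge,
`14` its mate, `15` go. The arrays of real numbers are: `0` click-through rates, `1` reports,
`2` accuracy, `3` payments, `4` weights of the advertisers, `5` weights of the edges, `6` and `7`
dual solution, `8` mu, `9` slack, `10` R, `11` numerator, `12` denominator, `13` click-through rates
of the output allocation, `14` saved optimal value or integration variable, `15` integrand. -/

/-- A scalar natural-number variable. -/
abbrev nvar (a : ℕ) : NatExpr := .get a (.const 0) (.const 0)

/-- An entry of a one-dimensional natural-number array. -/
abbrev nentry (a : ℕ) (i : NatExpr) : NatExpr := .get a i (.const 0)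

/-- A scalar real variable. -/
abbrev rvar (a : ℕ) : RealExpr := .get a (.const 0) (.const 0)

/-- An entry of a one-dimensional real array. -/
abbrev rentry (a : ℕ) (i : NatExpr) : RealExpr := .get a i (.const 0)

/-- Assignment to a scalar natural-number variable. -/
abbrev setNvar (a : ℕ) (e : NatExpr) : Prog := .setNat a (.const 0) (.const 0) e

/-- Assignment to a scalar real variable. -/
abbrev setRvar (a : ℕ) (e : RealExpr) : Prog := .setReal a (.const 0) (.const 0) e

/-- The number of advertisers. -/
abbrev sizeN : NatExpr := .get 0 (.const 0) (.const 0)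

/-- The number of positions. -/
abbrev sizeM : NatExpr := .get 0 (.const 0) (.const 1)

/-- The maximal number of ads. -/
abbrev sizeK : NatExpr := .get 0 (.const 0) (.const 2)

/-- The test `e = 0`. -/
abbrev isZero (e : NatExpr) : Test := .natLe e (.const 0)

/-- The odds of the click-through rate in cell `(i, j)`. -/
abbrev oddsExpr (i j : NatExpr) : RealExpr :=
  .div (.get 0 i j) (.sub (.const 1) (.get 0 i j))

/-- Compute the weights of the edges. -/
def fillProg : Prog :=
  forLoop 2 sizeN (forLoop 3 sizeM
    (.setReal 5 (nvar 2) (nvar 3)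
      (.mul (oddsExpr (nvar 2) (nvar 3)) (.sub (rentry 4 (nvar 2)) (rvar 10)))))

/-- `MatchState.reset`. -/
def resetProg : Prog :=
  .seq
    (forLoop 2 sizeN (.seq
      (.branch (isZero (nentry 5 (nvar 2))) (.setNat 6 (nvar 2) (.const 0) (.const 1))
        (.setNat 6 (nvar 2) (.const 0) (.const 0)))
      (forLoop 3 sizeN (.setNat 8 (nvar 2) (nvar 3) (nentry 5 (nvar 3))))))
    (forLoop 3 sizeM (.setNat 7 (nvar 3) (.const 0) (.const 0)))

/-- `MatchState.init`. -/
def initProg : Prog :=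
  .seq (setRvar 8 (.const 0)) <|
  .seq (forLoop 2 sizeN (forLoop 3 sizeM
    (.branch (.realLe (.const 0) (.get 5 (nvar 2) (nvar 3)))
      (setRvar 8 (.add (rvar 8) (.get 5 (nvar 2) (nvar 3)))) .skip))) <|
  .seq (.seq (setNvar 9 (.const 0)) (setNvar 10 (.const 0))) <|
  .seq (forLoop 2 sizeN (.seq (.setNat 5 (nvar 2) (.const 0) (.const 0))
    (.setReal 6 (nvar 2) (.const 0) (rvar 8)))) <|
  .seq (forLoop 3 sizeM (.setReal 7 (nvar 3) (.const 0) (.const 0)))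
  resetProg

/-- `MatchState.pick`. -/
def pickProg : Prog :=
  .seq (.seq (setRvar 9 (rvar 8)) (.seq (setNvar 11 (.const 0))
    (.seq (setNvar 12 (.const 0)) (setNvar 13 (.const 0)))))
  (forLoop 2 sizeN (forLoop 3 sizeM
    (.branch (.and (.not (isZero (nentry 6 (nvar 2)))) (.and (isZero (nentry 7 (nvar 3)))
        (.not (.realLe (rvar 9) (.sub (.add (rentry 6 (nvar 2)) (rentry 7 (nvar 3)))
          (.get 5 (nvar 2) (nvar 3)))))))
      (.seq (setRvar 9 (.sub (.add (rentry 6 (nvar 2)) (rentry 7 (nvar 3)))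
          (.get 5 (nvar 2) (nvar 3))))
        (.seq (setNvar 11 (.const 1)) (.seq (setNvar 12 (nvar 2)) (setNvar 13 (nvar 3)))))
      .skip)))

/-- `MatchState.shift`. -/
def shiftProg : Prog :=
  .seq (forLoop 2 sizeN (.branch (isZero (nentry 6 (nvar 2))) .skip
    (.setReal 6 (nvar 2) (.const 0) (.sub (rentry 6 (nvar 2)) (rvar 9))))) <|
  .seq (forLoop 3 sizeM (.branch (isZero (nentry 7 (nvar 3))) .skip
    (.setReal 7 (nvar 3) (.const 0) (.add (rentry 7 (nvar 3)) (rvar 9)))))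
  (setRvar 8 (.sub (rvar 8) (rvar 9)))

/-- `MatchState.findMate`. -/
def findProg : Prog :=
  .seq (setNvar 14 (.const 0))
  (forLoop 2 sizeN
    (.branch (.and (.natLe (nentry 5 (nvar 2)) (.add (nvar 13) (.const 1)))
        (.natLe (.add (nvar 13) (.const 1)) (nentry 5 (nvar 2))))
      (setNvar 14 (.add (nvar 2) (.const 1))) .skip))

/-- `MatchState.augment`. -/
def augmentProg : Prog :=
  .seq (forLoop 2 sizeN (.setNat 5 (nvar 2) (.const 0) (.get 8 (nvar 12) (nvar 2))))
  (.seq (.setNat 5 (nvar 12) (.const 0) (.add (nvar 13) (.const 1)))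
    (setNvar 9 (.add (nvar 9) (.const 1))))

/-- `MatchState.grow`. -/
def growProg : Prog :=
  .seq (forLoop 2 sizeN (.setNat 8 (.sub (nvar 14) (.const 1)) (nvar 2)
    (.get 8 (nvar 12) (nvar 2)))) <|
  .seq (.setNat 8 (.sub (nvar 14) (.const 1)) (nvar 12) (.add (nvar 13) (.const 1))) <|
  .seq (.setNat 8 (.sub (nvar 14) (.const 1)) (.sub (nvar 14) (.const 1)) (.const 0)) <|
  .seq (.setNat 6 (.sub (nvar 14) (.const 1)) (.const 0) (.const 1))
    (.setNat 7 (nvar 13) (.const 0) (.const 1))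

/-- `MatchState.step` for an active state. -/
def stepProg : Prog :=
  .seq pickProg
  (.branch (isZero (nvar 11)) (setNvar 10 (.const 1))
    (.seq shiftProg (.seq findProg
      (.branch (isZero (nvar 14)) (.seq augmentProg resetProg) growProg))))

/-- `MatchState.final`. -/
def matchProg : Prog :=
  .seq initProg
  (.loop (.and (isZero (nvar 10)) (.natLe (.add (nvar 9) (.const 1)) sizeK)) stepProg)

/-- `objNum` and `objDen`. -/
def evalProg : Prog :=
  .seq (.seq (setRvar 11 (.const 0)) (setRvar 12 (.const 1)))
  (forLoop 2 sizeN (.branch (isZero (nentry 5 (nvar 2))) .skip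
    (.seq
      (setRvar 11 (.add (rvar 11) (.mul (oddsExpr (nvar 2) (.sub (nentry 5 (nvar 2)) (.const 1)))
        (rentry 4 (nvar 2)))))
      (setRvar 12 (.add (rvar 12) (oddsExpr (nvar 2) (.sub (nentry 5 (nvar 2)) (.const 1))))))))

/-- `NewtonState.final`. -/
def newtonProg : Prog :=
  .seq (.seq (setRvar 10 (.const 0)) (setNvar 15 (.const 1)))
  (.loop (.not (isZero (nvar 15)))
    (.seq fillProg (.seq matchProg (.seq evalProg
      (.branch (.realLe (.sub (rvar 11) (.mul (rvar 10) (rvar 12))) (.const 0))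
        (setNvar 15 (.const 0)) (setRvar 10 (.div (rvar 11) (rvar 12))))))))

/-! ### Simulation of the matching algorithm -/

variable {O : Oracle} {n m K : ℕ} {s : Store}

/-- The sizes are stored in array `0`. -/
structure Sizes (n m K : ℕ) (s : Store) : Prop where
  n : s.nat 0 0 0 = n
  m : s.nat 0 0 1 = m
  K : s.nat 0 0 2 = K

theorem Sizes.of_eq {s' : Store} (h : Sizes n m K s) (e : s'.nat 0 = s.nat 0) :
    Sizes n m K s' := ⟨by rw [e, h.n], by rw [e, h.m], by rw [e, h.K]⟩

theorem runs_shift (hs : Sizes n m K s) :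
    Runs O shiftProg s (n * 5 + m * 5 + 5) fun s' =>
      (∀ i < n, s'.real 6 i 0 =
        if s.nat 6 i 0 = 0 then s.real 6 i 0 else s.real 6 i 0 - s.real 9 0 0) ∧
      (∀ j < m, s'.real 7 j 0 =
        if s.nat 7 j 0 = 0 then s.real 7 j 0 else s.real 7 j 0 + s.real 9 0 0) ∧
      s'.real 8 0 0 = s.real 8 0 0 - s.real 9 0 0 := by
  refine Runs.mono (Runs.seq (Runs.forLoop (n := n) (T := 3) (fun k s' => ∀ i < n, s'.real 6 i 0 =
      if s.nat 6 i 0 = 0 ∨ k ≤ i then s.real 6 i 0 else s.real 6 i 0 - s.real 9 0 0) rfl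
      (fun s' hf => by simp [hf.nat 0 rfl, hs.n]) (fun _ _ _ h => by simpa using h) (by simp)
      fun k hk s' hf hk' hI => Runs.straight rfl (by decide) ?_)
    fun s₁ hf₁ h₁ => Runs.seq (Runs.forLoop (n := m) (T := 3) (fun k s' => ∀ i < m, s'.real 7 i 0 =
      if s.nat 7 i 0 = 0 ∨ k ≤ i then s.real 7 i 0 else s.real 7 i 0 + s.real 9 0 0) rfl
      (fun s' hf => by simp [hf.nat 0 rfl, hf₁.nat 0 rfl, hs.m]) (fun _ _ _ h => by simpa using h)
      (by simp [hf₁.real 7 rfl])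
      fun k hk s' hf hk' hI => Runs.straight rfl (by decide) ?_)
    fun s₂ hf₂ h₂ => Runs.straight (T := 1)
      (Q := fun s' => (∀ i < n, s'.real 6 i 0 =
        if s.nat 6 i 0 = 0 then s.real 6 i 0 else s.real 6 i 0 - s.real 9 0 0) ∧
      (∀ j < m, s'.real 7 j 0 =
        if s.nat 7 j 0 = 0 then s.real 7 j 0 else s.real 7 j 0 + s.real 9 0 0) ∧
      s'.real 8 0 0 = s.real 8 0 0 - s.real 9 0 0) rfl (by decide) ?_) (by omega) fun _ _ h => h
  · intro i hi
    simp [Prog.eval, hk', hf.nat 6 rfl, hf.real 9 rfl]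
    have := hI i hi
    grind [Store.writeReal_real]
  · intro i hi
    simp [Prog.eval, hk', hf.nat 7 rfl, hf₁.nat 7 rfl, hf.real 9 rfl, hf₁.real 9 rfl]
    have := hI i hi
    grind [Store.writeReal_real]
  · simp [Prog.eval, hf₂.real 6 rfl, hf₂.real 8 rfl, hf₁.real 8 rfl, hf₂.real 9 rfl, hf₁.real 9 rfl]
    refine ⟨fun i hi => ?_, fun j hj => ?_⟩
    · rw [h₁ i hi]; grind
    · rw [h₂ j hj]; grind

theorem runs_reset (hs : Sizes n m K s) :
    Runs O resetProg s ((n * (3 + (n * (1 + 2) + 2) + 2) + 2) + (m * (1 + 2) + 2)) fun s' =>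
      (∀ i < n, s'.nat 6 i 0 = if s.nat 5 i 0 = 0 then 1 else 0) ∧
      (∀ i < n, ∀ i' < n, s'.nat 8 i i' = s.nat 5 i' 0) ∧ ∀ j < m, s'.nat 7 j 0 = 0 := by
  refine Runs.seq (Runs.forLoop (n := n) (fun k s' => ∀ i < k,
      s'.nat 6 i 0 = (if s.nat 5 i 0 = 0 then 1 else 0) ∧ ∀ i' < n, s'.nat 8 i i' = s.nat 5 i' 0)
      rfl (fun s' hf => by simp [hf.nat 0 rfl, hs.n]) (fun _ _ _ h => by simpa using h) (by simp)
      fun k hk s' hf hk' hI => ?_)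
    fun s₁ hf₁ h₁ => (Runs.forLoop (n := m) (fun k s' => ∀ j < k, s'.nat 7 j 0 = 0) rfl
      (fun s' hf => by simp [hf.nat 0 rfl, hf₁.nat 0 rfl, hs.m]) (fun _ _ _ h => by simpa using h)
      (by simp) fun k hk s' hf hk' hI => Runs.straight rfl (by decide) ?_).mono le_rfl
      fun s₂ hf₂ h₂ => ?_
  · refine Runs.seq (Runs.straight (Q := fun s₁ => (∀ i < k + 1,
      s₁.nat 6 i 0 = (if s.nat 5 i 0 = 0 then 1 else 0)) ∧ s₁.nat 8 = s'.nat 8 ∧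
      s₁.nat 2 0 0 = k) rfl (by decide) ?_) fun s₁ hf₁ h₁ =>
      (Runs.forLoop (n := n) (fun l s₂ => (∀ i < k, ∀ i' < n, s₂.nat 8 i i' = s.nat 5 i' 0) ∧
        ∀ i' < l, s₂.nat 8 k i' = s.nat 5 i' 0) rfl
        (fun s' hf' => by simp [hf'.nat 0 rfl, hf₁.nat 0 rfl, hf.nat 0 rfl, hs.n])
        (fun _ _ _ h => by simpa using h)
        ⟨fun i hi => by rw [h₁.2.1]; exact (hI i hi).2, by simp⟩
        fun l hl s₃ hf₃ hl' hI' => Runs.straight rfl (by decide) ?_).mono le_rfl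
        fun s₃ hf₃ h₃ => ?_
    · have e5 := hf.nat 5 rfl
      simp only [Prog.eval, Test.Holds, NatExpr.value, hk', e5, Nat.le_zero]
      split_ifs with h0
      · refine ⟨fun i hi => ?_, by funext; simp, by simp [hk']⟩
        have := hI i
        grind [Store.writeNat_nat]
      · refine ⟨fun i hi => ?_, by funext; simp, by simp [hk']⟩
        have := hI i
        grind [Store.writeNat_nat]
    · have e5 : s₃.nat 5 = s.nat 5 := by rw [hf₃.nat 5 rfl, hf₁.nat 5 rfl, hf.nat 5 rfl]
      have e2 : s₃.nat 2 0 0 = k := by rw [hf₃.nat 2 rfl]; exact h₁.2.2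
      simp only [Prog.eval, NatExpr.value, hl', e2, e5, Store.writeNat_nat]
      refine ⟨fun i hi i' hi' => ?_, fun i' hi' => ?_⟩
      · have := hI'.1 i hi i' hi'
        grind
      · have := hI'.2 i'
        grind
    · intro i hi
      refine ⟨?_, fun i' hi' => ?_⟩
      · rw [hf₃.nat 6 rfl]; exact h₁.1 i hi
      · rcases Nat.lt_succ_iff_lt_or_eq.1 hi with h | rfl
        · exact h₃.1 i h i' hi'
        · exact h₃.2 i' hi'
  · intro j hj
    have := hI j
    simp only [Prog.eval, NatExpr.value, hk', Store.writeNat_nat]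
    grind
  · refine ⟨fun i hi => ?_, fun i hi i' hi' => ?_, h₂⟩
    · rw [hf₂.nat 6 rfl]; exact (h₁ i hi).1
    · rw [hf₂.nat 8 rfl]; exact (h₁ i hi).2 i' hi'

/-- The memory represents the state `S` of the matching algorithm. -/
structure MatchRep (n m : ℕ) (S : MatchState) (s : Store) : Prop where
  halt : s.nat 10 0 0 = S.halt
  cnt : s.nat 9 0 0 = S.cnt
  mate : ∀ i < n, s.nat 5 i 0 = S.mate i
  row : ∀ i < n, s.nat 6 i 0 = S.row i
  col : ∀ j < m, s.nat 7 j 0 = S.col j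
  alt : ∀ i < n, ∀ i' < n, s.nat 8 i i' = S.alt i i'
  u : ∀ i < n, s.real 6 i 0 = S.u i
  v : ∀ j < m, s.real 7 j 0 = S.v j
  mu : s.real 8 0 0 = S.mu

/-- The memory holds the edge weights `c`. -/
def CostRep (n m : ℕ) (c : ℕ → ℕ → ℝ) (s : Store) : Prop :=
  ∀ i < n, ∀ j < m, s.real 5 i j = c i j

/-- The memory holds the result of the search for an edge. -/
structure PickRep (b : Pick) (s : Store) : Prop where
  slack : s.real 9 0 0 = b.slack
  found : s.nat 11 0 0 = b.found
  i : s.nat 12 0 0 = b.i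
  j : s.nat 13 0 0 = b.j

variable {S : MatchState} {c : ℕ → ℕ → ℝ}

theorem runs_pick (hs : Sizes n m K s) (hS : MatchRep n m S s) (hc : CostRep n m c s) :
    Runs O pickProg s (4 + (n * (m * (6 + 2) + 2 + 2) + 2)) (PickRep (S.pick m c n)) := by
  refine Runs.seq (Runs.straight (Q := PickRep (S.pick m c 0)) rfl (by decide)
    ⟨by simp [Prog.eval, MatchState.pick, hS.mu], by simp [Prog.eval, MatchState.pick],
      by simp [Prog.eval, MatchState.pick], by simp [Prog.eval, MatchState.pick]⟩)
    fun s₁ hf₁ h₁ => Runs.forLoop (n := n) (fun k => PickRep (S.pick m c k)) rfl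
      (fun s' hf => by simp [hf.nat 0 rfl, hf₁.nat 0 rfl, hs.n])
      (fun _ _ _ h => ⟨by simpa using h.slack, by simpa using h.found, by simpa using h.i,
        by simpa using h.j⟩) h₁
      fun k hk s₂ hf₂ hk' hI => (Runs.forLoop (n := m)
        (fun l => PickRep (S.pickRow c k (S.pick m c k) l)) rfl
        (fun s' hf => by simp [hf.nat 0 rfl, hf₂.nat 0 rfl, hf₁.nat 0 rfl, hs.m])
        (fun _ _ _ h => ⟨by simpa using h.slack, by simpa using h.found, by simpa using h.i,
          by simpa using h.j⟩) hI
        fun l hl s₃ hf₃ hl' hI' => Runs.straight rfl (by decide) ?_)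
  have e2 : s₃.nat 2 0 0 = k := by rw [hf₃.nat 2 rfl, hk']
  have e6 : s₃.nat 6 k 0 = S.row k := by
    rw [hf₃.nat 6 rfl, hf₂.nat 6 rfl, hf₁.nat 6 rfl, hS.row k hk]
  have e7 : s₃.nat 7 l 0 = S.col l := by
    rw [hf₃.nat 7 rfl, hf₂.nat 7 rfl, hf₁.nat 7 rfl, hS.col l hl]
  have eu : s₃.real 6 k 0 = S.u k := by
    rw [hf₃.real 6 rfl, hf₂.real 6 rfl, hf₁.real 6 rfl, hS.u k hk]
  have ev : s₃.real 7 l 0 = S.v l := by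
    rw [hf₃.real 7 rfl, hf₂.real 7 rfl, hf₁.real 7 rfl, hS.v l hl]
  have ec : s₃.real 5 k l = c k l := by
    rw [hf₃.real 5 rfl, hf₂.real 5 rfl, hf₁.real 5 rfl, hc k hk l hl]
  simp only [Prog.eval, Test.Holds, NatExpr.value, RealExpr.value, e2, hl', e6, e7, eu, ev, ec,
    hI'.slack, Nat.le_zero, not_le, MatchState.pickRow, MatchState.pickStep]
  by_cases h : ¬ S.row k = 0 ∧ S.col l = 0 ∧
      S.u k + S.v l - c k l < (S.pickRow c k (S.pick m c k) l).slack
  · rw [if_pos h, if_pos h]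
    constructor <;> simp [e2, hl']
  · rw [if_neg h, if_neg h]
    exact hI'

theorem runs_find (hs : Sizes n m K s) {L : ℕ → ℕ} (hL : ∀ i < n, s.nat 5 i 0 = L i) :
    Runs O findProg s (1 + (n * (3 + 2) + 2)) fun s' =>
      s'.nat 14 0 0 = MatchState.findMate L (s.nat 13 0 0) n := by
  refine Runs.seq (Runs.straight (Q := fun s' => s'.nat 14 0 0 = 0) rfl (by decide)
    (by simp [Prog.eval]))
    fun s₁ hf₁ h₁ => Runs.forLoop (n := n)
      (fun k s' => s'.nat 14 0 0 = MatchState.findMate L (s.nat 13 0 0) k) rfl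
      (fun s' hf => by simp [hf.nat 0 rfl, hf₁.nat 0 rfl, hs.n])
      (fun _ _ _ h => by simpa using h) h₁
      fun k hk s₂ hf₂ hk' hI => Runs.straight rfl (by decide) ?_
  have e5 : s₂.nat 5 k 0 = L k := by rw [hf₂.nat 5 rfl, hf₁.nat 5 rfl, hL k hk]
  have e13 : s₂.nat 13 0 0 = s.nat 13 0 0 := by rw [hf₂.nat 13 rfl, hf₁.nat 13 rfl]
  simp only [Prog.eval, Test.Holds, NatExpr.value, hk', e5, e13, ← le_antisymm_iff,
    MatchState.findMate]
  split_ifs with h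
  · simp
  · exact hI

theorem runs_augment (hs : Sizes n m K s) {L : ℕ → ℕ}
    (hL : ∀ i < n, s.nat 8 (s.nat 12 0 0) i = L i) :
    Runs O augmentProg s ((n * (1 + 2) + 2) + 2) fun s' =>
      (∀ i < n, s'.nat 5 i 0 =
        Function.update L (s.nat 12 0 0) (s.nat 13 0 0 + 1) i) ∧
      s'.nat 9 0 0 = s.nat 9 0 0 + 1 := by
  refine Runs.seq (Runs.forLoop (n := n) (fun k s' => ∀ i < k, s'.nat 5 i 0 = L i) rfl
      (fun s' hf => by simp [hf.nat 0 rfl, hs.n])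
      (fun _ _ _ h => by simpa using h) (by simp)
      fun k hk s₂ hf₂ hk' hI => Runs.straight rfl (by decide) ?_)
    fun s₁ hf₁ h₁ => Runs.straight rfl (by decide) ?_
  · intro i hi
    have e8 : s₂.nat 8 (s₂.nat 12 0 0) k = L k := by
      rw [hf₂.nat 8 rfl, hf₂.nat 12 rfl, hL k hk]
    simp only [Prog.eval, NatExpr.value, hk', e8, Store.writeNat_nat]
    have := hI i
    grind
  · simp only [Prog.eval, NatExpr.value, Store.writeNat_nat, hf₁.nat 12 rfl, hf₁.nat 13 rfl,
      hf₁.nat 9 rfl]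
    refine ⟨fun i hi => ?_, by simp⟩
    have := h₁ i hi
    rw [Function.update_apply]
    grind

theorem runs_grow (hs : Sizes n m K s) {L : ℕ → ℕ}
    (hL : ∀ i < n, s.nat 8 (s.nat 12 0 0) i = L i) :
    Runs O growProg s ((n * (1 + 2) + 2) + 4) fun s' =>
      (∀ i < n, s'.nat 8 (s.nat 14 0 0 - 1) i = Function.update
        (Function.update L (s.nat 12 0 0) (s.nat 13 0 0 + 1)) (s.nat 14 0 0 - 1) 0 i) ∧
      (∀ r, r ≠ s.nat 14 0 0 - 1 → ∀ i, s'.nat 8 r i = s.nat 8 r i) ∧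
      (∀ i, s'.nat 6 i 0 = if i = s.nat 14 0 0 - 1 then 1 else s.nat 6 i 0) ∧
      ∀ j, s'.nat 7 j 0 = if j = s.nat 13 0 0 then 1 else s.nat 7 j 0 := by
  refine Runs.seq (Runs.forLoop (n := n)
      (fun k s' => ∀ r i, s'.nat 8 r i = if r = s.nat 14 0 0 - 1 ∧ i < k then L i
        else s.nat 8 r i) rfl
      (fun s' hf => by simp [hf.nat 0 rfl, hs.n])
      (fun _ _ _ h => by simpa using h) (by simp)
      fun k hk s₂ hf₂ hk' hI => Runs.straight rfl (by decide) ?_)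
    fun s₁ hf₁ h₁ => Runs.straight rfl (by decide) ?_
  · intro r i
    have e8 : s₂.nat 8 (s₂.nat 12 0 0) k = L k := by
      have := hL k hk
      rw [hf₂.nat 12 rfl, hI]
      grind
    simp only [Prog.eval, NatExpr.value, hk', e8, Store.writeNat_nat, hf₂.nat 14 rfl, hI]
    grind
  · have e12 := hf₁.nat 12 rfl
    have e13 := hf₁.nat 13 rfl
    have e14 := hf₁.nat 14 rfl
    have e6 := hf₁.nat 6 rfl
    have e7 := hf₁.nat 7 rfl
    simp only [Prog.eval, NatExpr.value, Store.writeNat_nat, e12, e13, e14, e6, e7, h₁]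
    refine ⟨fun i hi => ?_, fun r hr i => ?_, fun i => ?_, fun j => ?_⟩
    · simp only [Function.update_apply]; grind
    · grind
    · grind
    · grind

/-- A bound on the running time of `stepProg`. -/
def stepTime (n m : ℕ) : ℕ :=
  (4 + (n * (m * (6 + 2) + 2 + 2) + 2)) + ((n * 5 + m * 5 + 5) + ((1 + (n * (3 + 2) + 2)) +
    (((n * (1 + 2) + 2) + 4) +
      ((n * (3 + (n * (1 + 2) + 2) + 2) + 2) + (m * (1 + 2) + 2)) + 1)) + 1)

theorem runs_step (hs : Sizes n m K s) (hS : MatchRep n m S s) (hc : CostRep n m c s)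
    (hact : S.Active K) :
    Runs O stepProg s (stepTime n m) (MatchRep n m (S.step n m K c)) := by
  refine Runs.seq (runs_pick hs hS hc) fun s₁ hf₁ h₁ => Runs.branch (fun hb => ?_) fun hb => ?_
  · have hz : (S.pick m c n).found = 0 := by
      simpa [h₁.found] using hb
    rw [MatchState.step, if_pos hact, if_pos hz]
    refine Runs.straight (c := setNvar 10 (.const 1)) rfl (by simp [Prog.cost]; omega) ?_
    constructor <;> simp [Prog.eval, hf₁.nat 9 rfl, hf₁.nat 5 rfl, hf₁.nat 6 rfl, hf₁.nat 7 rfl,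
      hf₁.nat 8 rfl, hf₁.real 6 rfl, hf₁.real 7 rfl, hf₁.real 8 rfl, hS.cnt, hS.mu]
    · exact hS.mate
    · exact hS.row
    · exact hS.col
    · exact hS.alt
    · exact hS.u
    · exact hS.v
  · have hz : (S.pick m c n).found ≠ 0 := by
      simpa [h₁.found] using hb
    rw [MatchState.step, if_pos hact, if_neg hz]
    obtain ⟨⟨hi, hj⟩, -⟩ := (MatchState.pickSpec S m c n).found hz
    set b := S.pick m c n with hb'
    have hs₁ := hs.of_eq (hf₁.nat 0 rfl)
    refine Runs.seq (runs_shift hs₁) fun s₂ hf₂ h₂ => ?_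
    have hs₂ := hs₁.of_eq (hf₂.nat 0 rfl)
    have hmate₂ : ∀ i < n, s₂.nat 5 i 0 = S.mate i := fun i hi => by
      rw [hf₂.nat 5 rfl, hf₁.nat 5 rfl, hS.mate i hi]
    refine Runs.seq (runs_find hs₂ hmate₂) fun s₃ hf₃ h₃ => ?_
    have hs₃ := hs₂.of_eq (hf₃.nat 0 rfl)
    -- the memory before the matching or the forest changes
    have e12 : s₃.nat 12 0 0 = b.i := by rw [hf₃.nat 12 rfl, hf₂.nat 12 rfl, h₁.i]
    have e13 : s₃.nat 13 0 0 = b.j := by rw [hf₃.nat 13 rfl, hf₂.nat 13 rfl, h₁.j]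
    have e14 : s₃.nat 14 0 0 = MatchState.findMate S.mate b.j n := by
      rw [h₃, hf₂.nat 13 rfl, h₁.j]
    have e10 : s₃.nat 10 0 0 = S.halt := by
      rw [hf₃.nat 10 rfl, hf₂.nat 10 rfl, hf₁.nat 10 rfl, hS.halt]
    have e9 : s₃.nat 9 0 0 = S.cnt := by
      rw [hf₃.nat 9 rfl, hf₂.nat 9 rfl, hf₁.nat 9 rfl, hS.cnt]
    have e5 : ∀ i < n, s₃.nat 5 i 0 = S.mate i := fun i hi => by
      rw [hf₃.nat 5 rfl, hmate₂ i hi]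
    have e6 : ∀ i < n, s₃.nat 6 i 0 = S.row i := fun i hi => by
      rw [hf₃.nat 6 rfl, hf₂.nat 6 rfl, hf₁.nat 6 rfl, hS.row i hi]
    have e7 : ∀ j < m, s₃.nat 7 j 0 = S.col j := fun j hj => by
      rw [hf₃.nat 7 rfl, hf₂.nat 7 rfl, hf₁.nat 7 rfl, hS.col j hj]
    have e8 : ∀ i < n, ∀ i' < n, s₃.nat 8 i i' = S.alt i i' := fun i hi i' hi' => by
      rw [hf₃.nat 8 rfl, hf₂.nat 8 rfl, hf₁.nat 8 rfl, hS.alt i hi i' hi']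
    have eu : ∀ i < n, s₃.real 6 i 0 = (S.shift b.slack).u i := fun i hi => by
      rw [hf₃.real 6 rfl, h₂.1 i hi, hf₁.nat 6 rfl, hf₁.real 6 rfl, hS.row i hi, hS.u i hi,
        h₁.slack]
      rfl
    have ev : ∀ j < m, s₃.real 7 j 0 = (S.shift b.slack).v j := fun j hj => by
      rw [hf₃.real 7 rfl, h₂.2.1 j hj, hf₁.nat 7 rfl, hf₁.real 7 rfl, hS.col j hj, hS.v j hj,
        h₁.slack]
      rfl
    have emu : s₃.real 8 0 0 = (S.shift b.slack).mu := by
      rw [hf₃.real 8 rfl, h₂.2.2, hf₁.real 8 rfl, hS.mu, h₁.slack]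
      rfl
    have hL : ∀ i < n, s₃.nat 8 (s₃.nat 12 0 0) i = S.alt b.i i := fun i hi' => by
      rw [e12, e8 _ hi _ hi']
    refine Runs.branch (fun hb => ?_) fun hb => ?_
    · have hf0 : MatchState.findMate S.mate b.j n = 0 := by simpa [e14] using hb
      rw [MatchState.advance, if_pos hf0]
      refine (Runs.seq (runs_augment hs₃ hL) fun s₄ hf₄ h₄ =>
        (runs_reset (hs₃.of_eq (hf₄.nat 0 rfl))).mono le_rfl fun s₅ hf₅ h₅ => ?_).mono
        (by omega) fun _ _ h => h
      rw [e12, e13] at h₄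
      refine ⟨?_, ?_, fun i hi => ?_, fun i hi => ?_, fun j hj => ?_, fun i hi i' hi' => ?_,
        fun i hi => ?_, fun j hj => ?_, ?_⟩
      · rw [hf₅.nat 10 rfl, hf₄.nat 10 rfl, e10]; rfl
      · rw [hf₅.nat 9 rfl, h₄.2, e9]; rfl
      · rw [hf₅.nat 5 rfl, h₄.1 i hi]; rfl
      · rw [h₅.1 i hi, h₄.1 i hi]; rfl
      · rw [h₅.2.2 j hj]; rfl
      · rw [h₅.2.1 i hi i' hi', h₄.1 i' hi']; rfl
      · rw [hf₅.real 6 rfl, hf₄.real 6 rfl, eu i hi]; rfl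
      · rw [hf₅.real 7 rfl, hf₄.real 7 rfl, ev j hj]; rfl
      · rw [hf₅.real 8 rfl, hf₄.real 8 rfl, emu]; rfl
    · have hf0 : MatchState.findMate S.mate b.j n ≠ 0 := by simpa [e14] using hb
      rw [MatchState.advance, if_neg hf0]
      refine (runs_grow hs₃ hL).mono (by omega) fun s₄ hf₄ h₄ => ?_
      rw [e12, e13, e14] at h₄
      refine ⟨?_, ?_, fun i hi => ?_, fun i hi => ?_, fun j hj => ?_, fun i hi i' hi' => ?_,
        fun i hi => ?_, fun j hj => ?_, ?_⟩
      · rw [hf₄.nat 10 rfl, e10]; rfl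
      · rw [hf₄.nat 9 rfl, e9]; rfl
      · rw [hf₄.nat 5 rfl, e5 i hi]; rfl
      · rw [h₄.2.2.1, e6 i hi]
        simp [MatchState.grow, MatchState.shift, Function.update_apply]
      · rw [h₄.2.2.2, e7 j hj]
        simp [MatchState.grow, MatchState.shift, Function.update_apply]
      · by_cases h : i = MatchState.findMate S.mate b.j n - 1
        · rw [h, h₄.1 i' hi']
          simp [MatchState.grow, MatchState.shift]
        · rw [h₄.2.1 i h, e8 i hi i' hi']
          simp [MatchState.grow, MatchState.shift, h]
      · rw [hf₄.real 6 rfl, eu i hi]; rfl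
      · rw [hf₄.real 7 rfl, ev j hj]; rfl
      · rw [hf₄.real 8 rfl, emu]; rfl

end RealRAM

namespace RealRAM

variable {O : Oracle} {n m K : ℕ} {s : Store} {c : ℕ → ℕ → ℝ}

/-- A bound on the running time of `initProg`. -/
def initTime (n m : ℕ) : ℕ :=
  1 + ((n * (m * (3 + 2) + 2 + 2) + 2) + (2 + ((n * (2 + 2) + 2) + ((m * (1 + 2) + 2) +
    ((n * (3 + (n * (1 + 2) + 2) + 2) + 2) + (m * (1 + 2) + 2))))))

theorem runs_init (hs : Sizes n m K s) (hc : CostRep n m c s) :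
    Runs O initProg s (initTime n m) (MatchRep n m (MatchState.init n m c)) := by
  set μ := ∑ i ∈ Finset.range n, ∑ j ∈ Finset.range m, max (c i j) 0 with hμ
  refine Runs.seq (Runs.straight (Q := fun s' => s'.real 8 0 0 = 0) rfl (by decide)
    (by simp [Prog.eval])) fun s₁ hf₁ h₁ => ?_
  have hs₁ := hs.of_eq (hf₁.nat 0 rfl)
  refine Runs.seq (P := fun s' => s'.real 8 0 0 = μ) (Runs.forLoop (n := n)
    (fun k s' => s'.real 8 0 0 = ∑ i ∈ Finset.range k, ∑ j ∈ Finset.range m, max (c i j) 0) rfl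
    (fun s' hf => by simp [hf.nat 0 rfl, hs₁.n]) (fun _ _ _ h => by simpa using h) (by simp [h₁])
    fun k hk s₂ hf₂ hk' hI => (Runs.forLoop (n := m)
      (fun l s' => s'.real 8 0 0 = ∑ i ∈ Finset.range k, ∑ j ∈ Finset.range m, max (c i j) 0 +
        ∑ j ∈ Finset.range l, max (c k j) 0) rfl
      (fun s' hf => by simp [hf.nat 0 rfl, hf₂.nat 0 rfl, hs₁.m])
      (fun _ _ _ h => by simpa using h) (by simp [hI])
      fun l hl s₃ hf₃ hl' hI' => Runs.straight rfl (by decide) ?_).mono le_rfl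
      fun s₃ hf₃ h₃ => by rw [h₃, Finset.sum_range_succ]) fun s₂ hf₂ h₂ => ?_
  · have e2 : s₃.nat 2 0 0 = k := by rw [hf₃.nat 2 rfl, hk']
    have ec : s₃.real 5 k l = c k l := by
      rw [hf₃.real 5 rfl, hf₂.real 5 rfl, hf₁.real 5 rfl, hc k hk l hl]
    simp only [Prog.eval, Test.Holds, NatExpr.value, RealExpr.value, e2, hl', ec, hI',
      Nat.cast_zero]
    split_ifs with h
    · simp [Finset.sum_range_succ, max_eq_left h, add_assoc]
    · simp [hI', Finset.sum_range_succ, max_eq_right (le_of_not_ge h)]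
  have hs₂ := hs₁.of_eq (hf₂.nat 0 rfl)
  refine Runs.seq (Runs.straight (Q := fun s' => s'.nat 9 0 0 = 0 ∧ s'.nat 10 0 0 = 0) rfl
    (by decide) (by simp [Prog.eval])) fun s₃ hf₃ h₃ => ?_
  have hs₃ := hs₂.of_eq (hf₃.nat 0 rfl)
  refine Runs.seq (Runs.forLoop (n := n)
    (fun k s' => ∀ i < k, s'.nat 5 i 0 = 0 ∧ s'.real 6 i 0 = μ) rfl
    (fun s' hf => by simp [hf.nat 0 rfl, hs₃.n]) (fun _ _ _ h => by simpa using h) (by simp)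
    fun k hk s₄ hf₄ hk' hI => Runs.straight rfl (by decide) ?_) fun s₄ hf₄ h₄ => ?_
  · intro i hi
    have e8 : s₄.real 8 0 0 = μ := by rw [hf₄.real 8 rfl, hf₃.real 8 rfl, h₂]
    have := hI i
    simp only [Prog.eval, NatExpr.value, RealExpr.value, hk', Store.writeNat_nat,
      Store.writeReal_nat, Store.writeReal_real, Store.writeNat_real, e8]
    grind
  have hs₄ := hs₃.of_eq (hf₄.nat 0 rfl)
  refine Runs.seq (Runs.forLoop (n := m) (fun k s' => ∀ j < k, s'.real 7 j 0 = 0) rfl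
    (fun s' hf => by simp [hf.nat 0 rfl, hs₄.m]) (fun _ _ _ h => by simpa using h) (by simp)
    fun k hk s₅ hf₅ hk' hI => Runs.straight rfl (by decide) ?_) fun s₅ hf₅ h₅ => ?_
  · intro j hj
    have := hI j
    simp only [Prog.eval, NatExpr.value, RealExpr.value, hk', Store.writeReal_real]
    grind
  refine (runs_reset (hs₄.of_eq (hf₅.nat 0 rfl))).mono le_rfl fun s₆ hf₆ h₆ => ?_
  have e5 : ∀ i < n, s₅.nat 5 i 0 = 0 := fun i hi => by rw [hf₅.nat 5 rfl, (h₄ i hi).1]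
  refine ⟨?_, ?_, fun i hi => ?_, fun i hi => ?_, fun j hj => ?_, fun i hi i' hi' => ?_,
    fun i hi => ?_, fun j hj => ?_, ?_⟩
  · rw [hf₆.nat 10 rfl, hf₅.nat 10 rfl, hf₄.nat 10 rfl, h₃.2]; rfl
  · rw [hf₆.nat 9 rfl, hf₅.nat 9 rfl, hf₄.nat 9 rfl, h₃.1]; rfl
  · rw [hf₆.nat 5 rfl, e5 i hi]; rfl
  · rw [h₆.1 i hi, e5 i hi]; rfl
  · rw [h₆.2.2 j hj]; rfl
  · rw [h₆.2.1 i hi i' hi', e5 i' hi']; rfl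
  · rw [hf₆.real 6 rfl, hf₅.real 6 rfl, (h₄ i hi).2]; rfl
  · rw [hf₆.real 7 rfl, h₅ j hj]; rfl
  · rw [hf₆.real 8 rfl, hf₅.real 8 rfl, hf₄.real 8 rfl, hf₃.real 8 rfl, h₂]; rfl

/-- A bound on the running time of `matchProg`. -/
def matchTime (n m : ℕ) : ℕ :=
  initTime n m + (MatchState.stepBound m * (stepTime n m + 1) + 1)

/-- Two iterates that are fixed points coincide. -/
theorem iterate_eq_of_fixed {α : Type*} {f : α → α} {x : α} {a b : ℕ}
    (ha : f (f^[a] x) = f^[a] x) (hb : f (f^[b] x) = f^[b] x) : f^[a] x = f^[b] x := by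
  rcases le_total a b with h | h
  · obtain ⟨d, rfl⟩ := Nat.exists_eq_add_of_le' h
    rw [Function.iterate_add_apply, Function.iterate_fixed ha]
  · obtain ⟨d, rfl⟩ := Nat.exists_eq_add_of_le' h
    rw [Function.iterate_add_apply, Function.iterate_fixed hb]

theorem runs_match (hK : K ≤ m) (hs : Sizes n m K s) (hc : CostRep n m c s) :
    Runs O matchProg s (matchTime n m) fun s' =>
      ∀ i < n, s'.nat 5 i 0 = MatchState.final n m K c i := by
  have htest : ∀ k s', Frame matchProg s s' →
      MatchRep n m ((MatchState.step n m K c)^[k] (MatchState.init n m c)) s' →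
      ((Test.and (isZero (nvar 10)) (.natLe (.add (nvar 9) (.const 1)) sizeK)).Holds O s' ↔
      ((MatchState.step n m K c)^[k] (MatchState.init n m c)).Active K) := fun k s' hf h => by
    simp only [Test.Holds, NatExpr.value, h.halt, h.cnt, hf.nat 0 rfl, hs.K, MatchState.Active,
      Nat.le_zero, Nat.succ_le_iff]
  refine Runs.seq (runs_init hs hc) fun s₁ hf₁ h₁ => ?_
  have hframe : ∀ s', Frame (.loop (.and (isZero (nvar 10))
      (.natLe (.add (nvar 9) (.const 1)) sizeK)) stepProg) s₁ s' → Frame matchProg s s' :=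
    fun s' hf => (hf₁.mono (fun a ha => by simp_all [matchProg, Prog.writesNat])
      (fun a ha => by simp_all [matchProg, Prog.writesReal])).trans
      (hf.mono (fun a ha => by simp_all [matchProg, Prog.writesNat])
      (fun a ha => by simp_all [matchProg, Prog.writesReal]))
  refine (Runs.loop (n := MatchState.stepBound m)
    (fun k => MatchRep n m ((MatchState.step n m K c)^[k] (MatchState.init n m c))) h₁
    fun k s₂ hf₂ hI hb => ?_).mono le_rfl ?_
  · have hact := (htest k s₂ (hframe s₂ hf₂) hI).1 hb
    refine ⟨?_, ?_⟩
    · by_contra hlt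
      exact MatchState.not_active_of_le hK (not_lt.1 hlt) hact
    · rw [Function.iterate_succ_apply']
      refine runs_step (hs.of_eq ((hframe s₂ hf₂).nat 0 rfl)) hI (fun i hi j hj => ?_) hact
      rw [(hframe s₂ hf₂).real 5 rfl, hc i hi j hj]
  · rintro s₂ hf₂ ⟨k, hI, hb⟩ i hi
    have hna : ¬ ((MatchState.step n m K c)^[k] (MatchState.init n m c)).Active K :=
      fun h => hb ((htest k s₂ (hframe s₂ hf₂) hI).2 h)
    rw [hI.mate i hi, MatchState.final, iterate_eq_of_fixed (MatchState.step_of_not_active hna)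
      (MatchState.step_of_not_active
        (MatchState.not_active_of_le hK (le_refl (MatchState.stepBound m))))]

/-! ### Simulation of Newton's method -/

/-- The memory holds the click-through rates `p` and the weights `w`. -/
structure DataRep (n m : ℕ) (p : ℕ → ℕ → ℝ) (w : ℕ → ℝ) (s : Store) : Prop where
  rate : ∀ i < n, ∀ j < m, s.real 0 i j = p i j
  weight : ∀ i < n, s.real 4 i 0 = w i

variable {p : ℕ → ℕ → ℝ} {w : ℕ → ℝ}

theorem DataRep.of_eq {s' : Store} (h : DataRep n m p w s) (e0 : s'.real 0 = s.real 0)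
    (e4 : s'.real 4 = s.real 4) : DataRep n m p w s' :=
  ⟨fun i hi j hj => by rw [e0, h.rate i hi j hj], fun i hi => by rw [e4, h.weight i hi]⟩

theorem runs_fill (hs : Sizes n m K s) (hd : DataRep n m p w s) :
    Runs O fillProg s (n * (m * (1 + 2) + 2 + 2) + 2)
      (CostRep n m (netWeight p w (s.real 10 0 0))) := by
  refine Runs.forLoop (n := n) (fun k s' => ∀ i < k, ∀ j < m,
    s'.real 5 i j = netWeight p w (s.real 10 0 0) i j) rfl
    (fun s' hf => by simp [hf.nat 0 rfl, hs.n]) (fun _ _ _ h => by simpa using h) (by simp)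
    fun k hk s₁ hf₁ hk' hI => (Runs.forLoop (n := m)
      (fun l s' => (∀ i < k, ∀ j < m, s'.real 5 i j = netWeight p w (s.real 10 0 0) i j) ∧
        ∀ j < l, s'.real 5 k j = netWeight p w (s.real 10 0 0) k j) rfl
      (fun s' hf => by simp [hf.nat 0 rfl, hf₁.nat 0 rfl, hs.m])
      (fun _ _ _ h => by simpa using h) ⟨hI, by simp⟩
      fun l hl s₂ hf₂ hl' hI' => Runs.straight rfl (by decide) ?_).mono le_rfl
      fun s₂ hf₂ h₂ => ?_
  · have e2 : s₂.nat 2 0 0 = k := by rw [hf₂.nat 2 rfl, hk']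
    have e0 : s₂.real 0 k l = p k l := by
      rw [hf₂.real 0 rfl, hf₁.real 0 rfl, hd.rate k hk l hl]
    have e4 : s₂.real 4 k 0 = w k := by
      rw [hf₂.real 4 rfl, hf₁.real 4 rfl, hd.weight k hk]
    have e10 : s₂.real 10 0 0 = s.real 10 0 0 := by rw [hf₂.real 10 rfl, hf₁.real 10 rfl]
    simp only [Prog.eval, NatExpr.value, RealExpr.value, e2, hl', e0, e4, e10,
      Store.writeReal_real, Nat.cast_one]
    refine ⟨fun i hi j hj => ?_, fun j hj => ?_⟩
    · have := hI'.1 i hi j hj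
      grind
    · by_cases h : j = l
      · simp [h, netWeight, odds]
      · simp only [h, and_false, if_false]
        exact hI'.2 j (by omega)
  · intro i hi j hj
    rcases Nat.lt_succ_iff_lt_or_eq.1 hi with h | rfl
    · exact h₂.1 i h j hj
    · exact h₂.2 j hj

theorem runs_eval (hs : Sizes n m K s) (hd : DataRep n m p w s) {L : ℕ → ℕ}
    (hL : ∀ i < n, s.nat 5 i 0 = L i) (hLm : ∀ i < n, L i ≤ m) :
    Runs O evalProg s (2 + (n * (4 + 2) + 2)) fun s' =>
      s'.real 11 0 0 = objNum n p w L ∧ s'.real 12 0 0 = objDen n p L := by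
  refine Runs.seq (Runs.straight (Q := fun s' => s'.real 11 0 0 = 0 ∧ s'.real 12 0 0 = 1) rfl
    (by decide) (by simp [Prog.eval])) fun s₁ hf₁ h₁ => Runs.forLoop (n := n)
    (fun k s' => s'.real 11 0 0 = objNum k p w L ∧ s'.real 12 0 0 = objDen k p L) rfl
    (fun s' hf => by simp [hf.nat 0 rfl, hf₁.nat 0 rfl, hs.n]) (fun _ _ _ h => by simpa using h)
    (by simpa [objNum, objDen] using h₁)
    fun k hk s₂ hf₂ hk' hI => Runs.straight rfl (by decide) ?_
  have e5 : s₂.nat 5 k 0 = L k := by rw [hf₂.nat 5 rfl, hf₁.nat 5 rfl, hL k hk]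
  have e4 : s₂.real 4 k 0 = w k := by rw [hf₂.real 4 rfl, hf₁.real 4 rfl, hd.weight k hk]
  simp only [Prog.eval, Test.Holds, NatExpr.value, RealExpr.value, hk', e5, e4, hI.1,
    Nat.le_zero]
  split_ifs with h
  · simp [objNum, objDen, Finset.sum_range_succ, h] at hI ⊢
    exact hI
  · have e0 : s₂.real 0 k (L k - 1) = p k (L k - 1) := by
      rw [hf₂.real 0 rfl, hf₁.real 0 rfl, hd.rate k hk _ (by have := hLm k hk; omega)]
    simp [hk', e5, e0, hI.2, objNum, objDen, Finset.sum_range_succ, h, odds, add_assoc]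

/-- The memory represents the state `S` of Newton's method. -/
structure NewtonRep (n : ℕ) (p : ℕ → ℕ → ℝ) (S : NewtonState) (s : Store) : Prop where
  go : s.nat 15 0 0 = S.go
  R : s.real 10 0 0 = S.R
  mate : S.go = 0 → ∀ i < n, s.nat 5 i 0 = S.mate i
  den : S.go = 0 → s.real 12 0 0 = objDen n p S.mate

/-- A bound on the running time of one Newton step. -/
def newtonStepTime (n m : ℕ) : ℕ :=
  (n * (m * (1 + 2) + 2 + 2) + 2) + (matchTime n m + ((2 + (n * (4 + 2) + 2)) + 3))

/-- A bound on the running time of `newtonProg`. -/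
def newtonTime (n m : ℕ) : ℕ :=
  2 + (NewtonState.stepBound n m * (newtonStepTime n m + 1) + 1)

theorem runs_newton (hK : K ≤ m) (hs : Sizes n m K s) (hd : DataRep n m p w s)
    (hgo : (NewtonState.final n m K p w).go = 0) :
    Runs O newtonProg s (newtonTime n m) (NewtonRep n p (NewtonState.final n m K p w)) := by
  refine Runs.seq (Runs.straight (Q := NewtonRep n p NewtonState.init) rfl
    (by decide) ⟨by simp [Prog.eval, NewtonState.init], by simp [Prog.eval, NewtonState.init],
      fun h => absurd h one_ne_zero, fun h => absurd h one_ne_zero⟩) fun s₁ hf₁ h₁ => ?_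
  have hs₁ := hs.of_eq (hf₁.nat 0 rfl)
  have hd₁ := hd.of_eq (hf₁.real 0 rfl) (hf₁.real 4 rfl)
  have hfix : ∀ {S : NewtonState}, S.go = 0 → NewtonState.step n m K p w S = S :=
    fun h => if_pos h
  refine (Runs.loop (n := NewtonState.stepBound n m)
    (fun k => NewtonRep n p ((NewtonState.step n m K p w)^[k] NewtonState.init)) h₁
    fun k s₂ hf₂ hI hb => ?_).mono le_rfl ?_
  · have hne : ((NewtonState.step n m K p w)^[k] NewtonState.init).go ≠ 0 := by
      simpa [hI.go] using hb
    refine ⟨?_, ?_⟩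
    · by_contra hlt
      obtain ⟨d, rfl⟩ := Nat.exists_eq_add_of_le' (not_lt.1 hlt)
      rw [Function.iterate_add_apply] at hne
      change ((NewtonState.step n m K p w)^[d] (NewtonState.final n m K p w)).go ≠ 0 at hne
      rw [Function.iterate_fixed (hfix hgo)] at hne
      exact hne hgo
    · rw [Function.iterate_succ_apply']
      set S := (NewtonState.step n m K p w)^[k] NewtonState.init with hS
      set L := MatchState.final n m K (netWeight p w S.R) with hL
      have hs₂ := hs₁.of_eq (hf₂.nat 0 rfl)
      have hd₂ := hd₁.of_eq (hf₂.real 0 rfl) (hf₂.real 4 rfl)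
      refine Runs.seq (runs_fill hs₂ hd₂) fun s₃ hf₃ h₃ => ?_
      have hs₃ := hs₂.of_eq (hf₃.nat 0 rfl)
      have hd₃ := hd₂.of_eq (hf₃.real 0 rfl) (hf₃.real 4 rfl)
      rw [hI.R] at h₃
      refine Runs.seq (runs_match hK hs₃ h₃) fun s₄ hf₄ h₄ => ?_
      have hs₄ := hs₃.of_eq (hf₄.nat 0 rfl)
      have hd₄ := hd₃.of_eq (hf₄.real 0 rfl) (hf₄.real 4 rfl)
      refine Runs.seq (runs_eval hs₄ hd₄ h₄ (MatchState.final_spec n hK _).1)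
        fun s₅ hf₅ h₅ => ?_
      have e5 : ∀ i < n, s₅.nat 5 i 0 = L i := fun i hi => by rw [hf₅.nat 5 rfl, h₄ i hi]
      have e10 : s₅.real 10 0 0 = S.R := by
        rw [hf₅.real 10 rfl, hf₄.real 10 rfl, hf₃.real 10 rfl, hI.R]
      rw [NewtonState.step, if_neg hne]
      refine Runs.straight rfl (by decide) ?_
      simp only [Prog.eval, Test.Holds, NatExpr.value, RealExpr.value, h₅.1, h₅.2, e10,
        Nat.cast_zero]
      split_ifs with h
      · exact ⟨by simp, by simpa using e10, fun _ i hi => by simpa using e5 i hi,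
          fun _ => by simpa using h₅.2⟩
      · refine ⟨?_, by simp, fun h => absurd h hne, fun h => absurd h hne⟩
        simp [hf₅.nat 15 rfl, hf₄.nat 15 rfl, hf₃.nat 15 rfl, hI.go]
  · rintro s₂ hf₂ ⟨k, hI, hb⟩
    have h0 : ((NewtonState.step n m K p w)^[k] NewtonState.init).go = 0 := by
      simpa [hI.go] using hb
    rw [NewtonState.final, ← iterate_eq_of_fixed (hfix h0) (hfix hgo)]
    exact hI

end RealRAM

/-! ### Lower Riemann sums of monotone functions -/

/-- The lower Riemann sum of an increasing function on `[0, V]` with cells of width `ε`, the last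
one cut off at `V`. -/
def lowerSum (ε V : ℝ) (f : ℝ → ℝ) : ℝ :=
  ∑ k ∈ Finset.range ⌈V / ε⌉₊, min ε (V - k * ε) * f (k * ε)

theorem lowerSum_aux {f : ℝ → ℝ} (hf : Monotone f) {ε V : ℝ} (hε : 0 < ε) (hV : 0 ≤ V) (k : ℕ) :
    ∑ j ∈ Finset.range k, (min ((j + 1 : ℕ) * ε) V - min (j * ε) V) * f (min (j * ε) V) ≤
        ∫ z in (0 : ℝ)..min (k * ε) V, f z ∧
      ∫ z in (0 : ℝ)..min (k * ε) V, f z ≤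
        ∑ j ∈ Finset.range k, (min ((j + 1 : ℕ) * ε) V - min (j * ε) V) * f (min (j * ε) V) +
          ε * (f (min (k * ε) V) - f 0) := by
  induction k with
  | zero => simp [hV]
  | succ k ih =>
    have hb : min (k * ε) V ≤ min ((k + 1 : ℕ) * ε) V := by
      apply min_le_min_right; push_cast; nlinarith
    have hw : min ((k + 1 : ℕ) * ε) V - min (k * ε) V ≤ ε := by
      push_cast
      rcases min_cases ((k + 1 : ℝ) * ε) V with ⟨h1, h2⟩ | ⟨h1, h2⟩ <;>
        rcases min_cases ((k : ℝ) * ε) V with ⟨h3, h4⟩ | ⟨h3, h4⟩ <;> nlinarith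
    set b := min (k * ε) V with hbdef
    set b' := min ((k + 1 : ℕ) * ε) V with hbdef'
    have hint : ∀ x y : ℝ, IntervalIntegrable f volume x y := fun x y => hf.intervalIntegrable
    have hsplit : ∫ z in (0 : ℝ)..b', f z = (∫ z in (0 : ℝ)..b, f z) + ∫ z in b..b', f z :=
      (intervalIntegral.integral_add_adjacent_intervals (hint _ _) (hint _ _)).symm
    have hlo : (b' - b) * f b ≤ ∫ z in b..b', f z := by
      rw [← smul_eq_mul, ← intervalIntegral.integral_const]
      exact intervalIntegral.integral_mono_on hb intervalIntegrable_const (hint _ _)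
        fun x hx => hf hx.1
    have hhi : ∫ z in b..b', f z ≤ (b' - b) * f b' := by
      rw [← smul_eq_mul, ← intervalIntegral.integral_const]
      exact intervalIntegral.integral_mono_on hb (hint _ _) intervalIntegrable_const
        fun x hx => hf hx.2
    rw [Finset.sum_range_succ, hsplit]
    have hmono : f b ≤ f b' := hf hb
    refine ⟨by linarith [ih.1], ?_⟩
    have h3 : (b' - b) * (f b' - f b) ≤ ε * (f b' - f b) :=
      mul_le_mul_of_nonneg_right hw (by linarith)
    linarith [ih.2]

theorem lowerSum_eq {ε V : ℝ} (hε : 0 < ε) (f : ℝ → ℝ) :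
    lowerSum ε V f = ∑ j ∈ Finset.range ⌈V / ε⌉₊,
      (min ((j + 1 : ℕ) * ε) V - min (j * ε) V) * f (min (j * ε) V) := by
  refine Finset.sum_congr rfl fun j hj => ?_
  have h1 : (j : ℝ) < V / ε := Nat.lt_ceil.1 (Finset.mem_range.1 hj)
  rw [lt_div_iff₀ hε] at h1
  rw [min_eq_left h1.le, ← min_sub_sub_right]
  congr 2
  push_cast
  ring

/-- The lower sum underestimates the integral of an increasing function by at most `ε` times
the increase of the function. -/
theorem lowerSum_bounds {f : ℝ → ℝ} (hf : Monotone f) {ε V : ℝ} (hε : 0 < ε) (hV : 0 ≤ V) :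
    lowerSum ε V f ≤ ∫ z in (0 : ℝ)..V, f z ∧
      ∫ z in (0 : ℝ)..V, f z ≤ lowerSum ε V f + ε * (f V - f 0) := by
  have h := lowerSum_aux hf hε hV ⌈V / ε⌉₊
  have hV' : V ≤ ⌈V / ε⌉₊ * ε := (div_le_iff₀ hε).1 (Nat.le_ceil _)
  rw [← lowerSum_eq hε, min_eq_right hV'] at h
  exact h

theorem lowerSum_le_mul {f : ℝ → ℝ} (hf : Monotone f) {ε V : ℝ} (hε : 0 < ε) (hV : 0 ≤ V) :
    lowerSum ε V f ≤ V * f V := by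
  refine (lowerSum_bounds hf hε hV).1.trans ?_
  have h := intervalIntegral.integral_mono_on (μ := volume) (f := f) (g := fun _ => f V) hV
    hf.intervalIntegrable intervalIntegrable_const fun x hx => hf hx.2
  rw [intervalIntegral.integral_const] at h
  simpa using h

theorem lowerSum_nonneg {f : ℝ → ℝ} (hf : ∀ z, 0 ≤ f z) {ε V : ℝ} (hε : 0 < ε) :
    0 ≤ lowerSum ε V f := by
  refine Finset.sum_nonneg fun k hk => mul_nonneg (le_min hε.le ?_) (hf _)
  have h1 : (k : ℝ) < V / ε := Nat.lt_ceil.1 (Finset.mem_range.1 hk)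
  rw [lt_div_iff₀ hε] at h1
  linarith

namespace PositionAuction

variable {n m : ℕ} {A : PositionAuction n m}

/-! ### Optimal allocations, and mechanisms given by programs -/

/-- The allocation that the program selects for the weights `w`. -/
def best (A : PositionAuction n m) (w : Fin n → ℝ) : A.Allocation :=
  (final_isOptimalResult A w).feasible.alloc

/-- The optimal value for the weights `w`. -/
def bestValue (A : PositionAuction n m) (w : Fin n → ℝ) : ℝ :=
  (NewtonState.final n m A.K A.rate (extend w)).R

theorem sum_best (A : PositionAuction n m) (w : Fin n → ℝ) :
    ∑ i, w i * A.clickRate (A.best w) i = A.bestValue w := (final_isOptimalResult A w).value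

theorem sum_le_bestValue (w : Fin n → ℝ) (x : A.Allocation) :
    ∑ i, w i * A.clickRate x i ≤ A.bestValue w := (final_isOptimalResult A w).optimal x

/-- Only advertisers with positive weights are shown. -/
theorem clickRate_best_eq_zero {w : Fin n → ℝ} {i : Fin n} (h : w i ≤ 0) :
    A.clickRate (A.best w) i = 0 := by
  have hr := final_isOptimalResult A w
  rw [best, clickRate_alloc, if_pos]
  by_contra hne
  have := hr.lt_weight i hne
  have := hr.nonneg
  linarith

theorem measurableStore_input (A : PositionAuction n m) (ε : ℝ) :
    RealRAM.MeasurableStore fun v => A.input v ε where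
  nat a i j := measurable_const
  real a i j := by
    simp only [input]
    split_ifs
    all_goals first
      | exact measurable_const
      | exact (measurable_pi_apply (X := fun _ : Fin n => ℝ≥0) _).coe_nnreal_real

namespace Mechanism

theorem clickProb_nonneg (M : A.Mechanism) (v : Fin n → ℝ≥0) (i : Fin n) : 0 ≤ M.clickProb v i :=
  Finset.sum_nonneg fun x _ => mul_nonneg (M.prob v x).2 (clickRate_nonneg x i)

theorem clickProb_le_one (M : A.Mechanism) (v : Fin n → ℝ≥0) (i : Fin n) :
    M.clickProb v i ≤ 1 := by
  have h : (∑ x, (M.prob v x : ℝ)) = 1 := by exact_mod_cast M.prob_sum v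
  rw [← h]
  exact Finset.sum_le_sum fun x _ =>
    mul_le_of_le_one_right (M.prob v x).2 (clickRate_le_one x i)

/-- A linear objective that is optimal among allocations is optimal among lotteries. -/
theorem sum_mul_clickProb_le (M : A.Mechanism) (v : Fin n → ℝ≥0) {w : Fin n → ℝ} {B : ℝ}
    (h : ∀ x : A.Allocation, ∑ i, w i * A.clickRate x i ≤ B) :
    ∑ i, w i * M.clickProb v i ≤ B := by
  have h1 : (∑ x, (M.prob v x : ℝ)) = 1 := by exact_mod_cast M.prob_sum v
  calc ∑ i, w i * M.clickProb v i
      = ∑ x, (M.prob v x : ℝ) * ∑ i, w i * A.clickRate x i := by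
        simp only [clickProb, Finset.mul_sum]
        rw [Finset.sum_comm]
        exact Finset.sum_congr rfl fun x _ => Finset.sum_congr rfl fun i _ => by ring
    _ ≤ ∑ x, (M.prob v x : ℝ) * B :=
        Finset.sum_le_sum fun x _ => mul_le_mul_of_nonneg_left (h x) (M.prob v x).2
    _ = B := by rw [← Finset.sum_mul, h1, one_mul]

theorem measurable_clickProb (M : A.Mechanism) (i : Fin n) :
    Measurable fun v => M.clickProb v i :=
  Finset.measurable_sum _ fun x _ => (M.measurable_prob x).coe_nnreal_real.mul_const _

/-- The click probability of `i` as a function of its own report. -/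
def curve (M : A.Mechanism) (r : Fin n → ℝ≥0) (i : Fin n) (z : ℝ) : ℝ :=
  M.clickProb (Function.update r i z.toNNReal) i

theorem curve_update (M : A.Mechanism) (r : Fin n → ℝ≥0) (i : Fin n) (w : ℝ≥0) :
    M.curve (Function.update r i w) i = M.curve r i := by
  funext z; simp [curve]

@[simp] theorem curve_coe (M : A.Mechanism) (r : Fin n → ℝ≥0) (i : Fin n) (w : ℝ≥0) :
    M.curve r i w = M.clickProb (Function.update r i w) i := by
  simp [curve]

theorem curve_self (M : A.Mechanism) (r : Fin n → ℝ≥0) (i : Fin n) :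
    M.curve r i (r i) = M.clickProb r i := by simp

/-- A program that computes an allocation and payments on all inputs defines a mechanism: its
output is measurable in the reports. -/
theorem exists_of_runs {c : RealRAM.Prog} {O : RealRAM.Oracle} {ε : ℝ} (hO : O.IsMeasurable)
    (a : (Fin n → ℝ≥0) → A.Allocation) (t : (Fin n → ℝ≥0) → Fin n → ℝ≥0)
    (T : (Fin n → ℝ≥0) → ℕ)
    (h : ∀ v, RealRAM.Runs O c (A.input v ε) (T v) fun s =>
      (∀ (i : Fin n) (j : Fin m), s.nat 1 i j = ((a v).1 i j : ℕ)) ∧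
        ∀ i : Fin n, s.real 3 i 0 = t v i) :
    ∃ M : A.Mechanism, (∀ v i, M.clickProb v i = A.clickRate (a v) i) ∧
      (∀ v i, M.pay v i = t v i) ∧ ∀ v, M.ComputedBy c O ε v (T v) := by
  classical
  choose τ s hexec hτ hout using h
  have hms := (measurableStore_input A ε).of_exec hO fun v => ⟨τ v, hexec v⟩
  have hset : ∀ x : A.Allocation, MeasurableSet {v | a v = x} := fun x => by
    have e : {v | a v = x} =
        ⋂ (i : Fin n) (j : Fin m), {v | (s v).nat 1 i j = (x.1 i j : ℕ)} := by
      ext v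
      simp only [Set.mem_ofPred_eq, Set.mem_iInter, (hout v).1]
      constructor
      · rintro rfl i j; rfl
      · intro h
        exact Subtype.ext (funext fun i => funext fun j => Fin.ext (h i j))
    rw [e]
    exact MeasurableSet.iInter fun i => MeasurableSet.iInter fun j =>
      measurableSet_eq_fun (hms.nat 1 i j) measurable_const
  let M : A.Mechanism :=
    { prob := fun v x => if a v = x then 1 else 0
      prob_sum := fun v => by simp
      pay := t
      measurable_prob := fun x => Measurable.ite (hset x) measurable_const measurable_const
      measurable_pay := fun i => by
        have e : (fun v => t v i) = fun v => ((s v).real 3 i 0).toNNReal := by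
          funext v; rw [(hout v).2 i, Real.toNNReal_coe]
        rw [e]
        exact (hms.real 3 i 0).real_toNNReal }
  refine ⟨M, fun v i => ?_, fun _ _ => rfl, fun v =>
    ⟨τ v, s v, a v, hexec v, hτ v, if_pos rfl, (hout v).1, (hout v).2⟩⟩
  have : ∀ x, ((M.prob v x : ℝ≥0) : ℝ) = if a v = x then 1 else 0 := fun x => by
    simp only [M]; split_ifs <;> simp
  simp only [clickProb, this]
  simp

/-! ### The Vickrey-Clarke-Groves mechanism -/

theorem sum_update_mul (v : Fin n → ℝ≥0) (i : Fin n) (w : ℝ≥0) (y : Fin n → ℝ) :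
    ∑ k, (Function.update v i w k : ℝ) * y k = (∑ k, (v k : ℝ) * y k) - v i * y i + w * y i := by
  rw [← Finset.add_sum_erase _ _ (Finset.mem_univ i),
    ← Finset.add_sum_erase _ (fun k => (v k : ℝ) * y k) (Finset.mem_univ i),
    Finset.sum_congr rfl (g := fun k => (v k : ℝ) * y k) fun k hk => by
      rw [Function.update_of_ne (Finset.ne_of_mem_erase hk)]]
  simp only [Function.update_self]
  ring

/-- The externality that advertiser `i` imposes on the others. -/
theorem vcg_pay_nonneg (A : PositionAuction n m) (v : Fin n → ℝ≥0) (i : Fin n) :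
    0 ≤ A.bestValue (fun k => (Function.update v i 0 k : ℝ)) -
      A.bestValue (fun k => (v k : ℝ)) + v i * A.clickRate (A.best fun k => (v k : ℝ)) i := by
  have h := sum_le_bestValue (fun k => (Function.update v i 0 k : ℝ)) (A.best fun k => (v k : ℝ))
  rw [sum_update_mul, sum_best A fun k => (v k : ℝ)] at h
  simp only [NNReal.coe_zero, zero_mul, add_zero] at h
  linarith

variable {M : A.Mechanism}

theorem vcg_utility_le
    (hy : ∀ v i, M.clickProb v i = A.clickRate (A.best fun k => (v k : ℝ)) i)
    (hp : ∀ v i, (M.pay v i : ℝ) = A.bestValue (fun k => (Function.update v i 0 k : ℝ)) -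
      A.bestValue (fun k => (v k : ℝ)) + v i * A.clickRate (A.best fun k => (v k : ℝ)) i)
    (i : Fin n) (r : Fin n → ℝ≥0) (w : ℝ≥0) :
    M.utility i r w ≤ A.bestValue (fun k => (Function.update r i w k : ℝ)) -
      A.bestValue (fun k => (Function.update r i 0 k : ℝ)) := by
  have h := sum_le_bestValue (fun k => (Function.update r i w k : ℝ)) (A.best fun k => (r k : ℝ))
  rw [sum_update_mul, sum_best A fun k => (r k : ℝ)] at h
  rw [utility, hy, hp]
  linarith

theorem vcg_utility
    (hy : ∀ v i, M.clickProb v i = A.clickRate (A.best fun k => (v k : ℝ)) i)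
    (hp : ∀ v i, (M.pay v i : ℝ) = A.bestValue (fun k => (Function.update v i 0 k : ℝ)) -
      A.bestValue (fun k => (v k : ℝ)) + v i * A.clickRate (A.best fun k => (v k : ℝ)) i)
    (i : Fin n) (r : Fin n → ℝ≥0) (w : ℝ≥0) :
    M.utility i (Function.update r i w) w =
      A.bestValue (fun k => (Function.update r i w k : ℝ)) -
      A.bestValue (fun k => (Function.update r i 0 k : ℝ)) := by
  rw [utility, hy, hp, Function.update_idem]
  simp only [Function.update_self]
  ring

theorem vcg_isIC
    (hy : ∀ v i, M.clickProb v i = A.clickRate (A.best fun k => (v k : ℝ)) i)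
    (hp : ∀ v i, (M.pay v i : ℝ) = A.bestValue (fun k => (Function.update v i 0 k : ℝ)) -
      A.bestValue (fun k => (v k : ℝ)) + v i * A.clickRate (A.best fun k => (v k : ℝ)) i) :
    M.IsIC := fun i r w => (vcg_utility_le hy hp i r w).trans_eq (vcg_utility hy hp i r w).symm

theorem vcg_isIR
    (hy : ∀ v i, M.clickProb v i = A.clickRate (A.best fun k => (v k : ℝ)) i)
    (hp : ∀ v i, (M.pay v i : ℝ) = A.bestValue (fun k => (Function.update v i 0 k : ℝ)) -
      A.bestValue (fun k => (v k : ℝ)) + v i * A.clickRate (A.best fun k => (v k : ℝ)) i) :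
    M.IsIR := fun i r w => by
  have h := sum_le_bestValue (fun k => (Function.update r i w k : ℝ))
    (A.best fun k => (Function.update r i 0 k : ℝ))
  have e := sum_best A fun k => (Function.update r i 0 k : ℝ)
  rw [sum_update_mul] at h e
  have h0 : 0 ≤ (w : ℝ) * A.clickRate (A.best fun k => (Function.update r i 0 k : ℝ)) i :=
    mul_nonneg w.2 (clickRate_nonneg _ _)
  rw [vcg_utility hy hp]
  simp only [NNReal.coe_zero, zero_mul, add_zero] at e
  linarith

/-! ### Payments for monotone allocation rules -/

/-- In an incentive compatible mechanism a higher report is clicked more often. -/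
theorem IsIC.monotone_curve (h : M.IsIC) (r : Fin n → ℝ≥0) (i : Fin n) :
    Monotone (M.curve r i) := by
  intro z z' hz
  have hle : z.toNNReal ≤ z'.toNNReal := Real.toNNReal_mono hz
  have h1 := h i (Function.update r i z.toNNReal) z'.toNNReal
  have h2 := h i (Function.update r i z'.toNNReal) z.toNNReal
  simp only [utility, Function.update_idem] at h1 h2
  rcases hle.eq_or_lt with e | hlt
  · simp [curve, e]
  · have hlt' : (z.toNNReal : ℝ) < z'.toNNReal := hlt
    simp only [curve]
    nlinarith

/-- The envelope inequality: truthful utility is at least the area under the curve. -/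
theorem IsIC.integral_curve_le (h : M.IsIC) (hir : M.IsIR) (r : Fin n → ℝ≥0) (i : Fin n) :
    ∫ z in (0 : ℝ)..r i, M.curve r i z ≤ M.utility i r (r i) := by
  set U : ℝ → ℝ := fun z => M.utility i (Function.update r i z.toNNReal) z.toNNReal with hU
  have hmono := h.monotone_curve r i
  have hstep : ∀ z z' : ℝ, 0 ≤ z → 0 ≤ z' → (z' - z) * M.curve r i z ≤ U z' - U z := by
    intro z z' hz hz'
    have h1 := h i (Function.update r i z.toNNReal) z'.toNNReal
    simp only [hU, utility, Function.update_idem, curve, Real.coe_toNNReal _ hz,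
      Real.coe_toNNReal _ hz'] at h1 ⊢
    linarith
  have hU0 : 0 ≤ U 0 := hir i r _
  have hUr : U (r i) = M.utility i r (r i) := by simp [hU]
  have key : ∀ ε : ℝ, 0 < ε → ∫ z in (0 : ℝ)..r i, M.curve r i z ≤
      U (r i) + ε * (M.curve r i (r i) - M.curve r i 0) := by
    intro ε hε
    refine (lowerSum_bounds hmono hε (r i).2).2.trans (add_le_add_left ?_ _)
    rw [lowerSum_eq hε]
    have hb : ∀ j : ℕ, 0 ≤ min ((j : ℝ) * ε) (r i) := fun j =>
      le_min (by positivity) (r i).2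
    calc ∑ j ∈ Finset.range ⌈(r i : ℝ) / ε⌉₊, (min ((j + 1 : ℕ) * ε) (r i : ℝ) -
          min (j * ε) (r i : ℝ)) * M.curve r i (min (j * ε) (r i : ℝ))
        ≤ ∑ j ∈ Finset.range ⌈(r i : ℝ) / ε⌉₊, (U (min ((j + 1 : ℕ) * ε) (r i : ℝ)) -
          U (min (j * ε) (r i : ℝ))) :=
          Finset.sum_le_sum fun j _ => hstep _ _ (hb j) (hb (j + 1))
      _ = U (r i) - U 0 := by
          rw [Finset.sum_range_sub (fun j : ℕ => U (min ((j : ℝ) * ε) (r i : ℝ))),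
            min_eq_right ((div_le_iff₀ hε).1 (Nat.le_ceil _))]
          simp
      _ ≤ U (r i) := by linarith
  rw [← hUr]
  refine le_of_forall_pos_le_add fun δ hδ => ?_
  set Δ := M.curve r i (r i) - M.curve r i 0 with hΔ
  have hΔ0 : 0 ≤ Δ := sub_nonneg.2 (hmono (r i).2)
  have := key (δ / (Δ + 1)) (by positivity)
  refine this.trans (add_le_add_right ?_ _)
  rw [div_mul_eq_mul_div, div_le_iff₀ (by linarith)]
  nlinarith

/-- Misreporting cannot pay when the payment is the Myerson payment. -/
theorem sub_mul_le_integral (hmono : ∀ r i, Monotone (M.curve r i)) (r : Fin n → ℝ≥0)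
    (i : Fin n) (w : ℝ≥0) : ((w : ℝ) - r i) * M.clickProb r i ≤
      (∫ z in (0 : ℝ)..w, M.curve r i z) - ∫ z in (0 : ℝ)..r i, M.curve r i z := by
  have hint : ∀ x y : ℝ, IntervalIntegrable (M.curve r i) volume x y :=
    fun x y => (hmono r i).intervalIntegrable
  rw [intervalIntegral.integral_interval_sub_left (hint _ _) (hint _ _), ← M.curve_self r i]
  rcases le_total (r i : ℝ) w with h | h
  · have := intervalIntegral.integral_mono_on (μ := volume) (f := fun _ => M.curve r i (r i))
      (g := M.curve r i) h intervalIntegrable_const (hint _ _) fun x hx => hmono r i hx.1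
    rwa [intervalIntegral.integral_const, smul_eq_mul] at this
  · have := intervalIntegral.integral_mono_on (μ := volume) (g := fun _ => M.curve r i (r i))
      (f := M.curve r i) h (hint _ _) intervalIntegrable_const fun x hx => hmono r i hx.2
    rw [intervalIntegral.integral_const, smul_eq_mul] at this
    rw [intervalIntegral.integral_symm]
    linarith

theorem lowerSum_curve_bounds {ε : ℝ} (hε : 0 < ε) (hmono : ∀ r i, Monotone (M.curve r i))
    (r : Fin n → ℝ≥0) (i : Fin n) :
    lowerSum ε (r i) (M.curve r i) ≤ ∫ z in (0 : ℝ)..r i, M.curve r i z ∧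
      ∫ z in (0 : ℝ)..r i, M.curve r i z ≤ lowerSum ε (r i) (M.curve r i) + ε := by
  obtain ⟨h1, h2⟩ := lowerSum_bounds (hmono r i) hε (r i).2
  refine ⟨h1, h2.trans (add_le_add_right ?_ _)⟩
  have h3 := M.clickProb_le_one r i
  rw [← curve_self] at h3
  have h4 : 0 ≤ M.curve r i 0 := M.clickProb_nonneg _ _
  calc ε * (M.curve r i (r i) - M.curve r i 0) ≤ ε * 1 :=
        mul_le_mul_of_nonneg_left (by linarith) hε.le
    _ = ε := mul_one ε

/-- The payment rule computed in the revenue maximization: the Myerson payment, with the lower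
Riemann sum in place of the integral. -/
def HasLowerSumPayments (M : A.Mechanism) (ε : ℝ) : Prop :=
  ∀ r i, (M.pay r i : ℝ) = r i * M.clickProb r i - lowerSum ε (r i) (M.curve r i)

namespace HasLowerSumPayments

variable {ε : ℝ}

theorem pay_ge (hp : M.HasLowerSumPayments ε) (hε : 0 < ε)
    (hmono : ∀ r i, Monotone (M.curve r i)) (r : Fin n → ℝ≥0) (i : Fin n) :
    r i * M.clickProb r i - ∫ z in (0 : ℝ)..r i, M.curve r i z ≤ M.pay r i := by
  have := (lowerSum_curve_bounds hε hmono r i).1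
  rw [hp]; linarith

theorem abs_pay_sub_le (hp : M.HasLowerSumPayments ε) (hε : 0 < ε)
    (hmono : ∀ r i, Monotone (M.curve r i)) (r : Fin n → ℝ≥0) (i : Fin n) :
    |(M.pay r i : ℝ) - (r i * M.clickProb r i - ∫ z in (0 : ℝ)..r i, M.curve r i z)| ≤ ε := by
  obtain ⟨h1, h2⟩ := lowerSum_curve_bounds hε hmono r i
  rw [hp, abs_le]
  constructor <;> linarith

theorem isApproxIC (hp : M.HasLowerSumPayments ε) (hε : 0 < ε)
    (hmono : ∀ r i, Monotone (M.curve r i)) : M.IsApproxIC ε := fun i r w => by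
  have h1 := sub_mul_le_integral hmono r i w
  have h2 := (lowerSum_curve_bounds hε hmono r i).1
  have h3 := (lowerSum_curve_bounds hε hmono (Function.update r i w) i).2
  have e1 := hp r i
  have e2 := hp (Function.update r i w) i
  simp only [utility, e1, e2, curve_update, Function.update_self] at h3 ⊢
  linarith

theorem isIR (hp : M.HasLowerSumPayments ε) (hε : 0 < ε) : M.IsIR := fun i r w => by
  have := lowerSum_nonneg (V := w) (f := M.curve r i) (fun z => M.clickProb_nonneg _ _) hε
  have e := hp (Function.update r i w) i
  simp only [utility, e, curve_update, Function.update_self]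
  linarith

end HasLowerSumPayments

end Mechanism

end PositionAuction

namespace ValueDist

/-! ### Virtual values -/

/-- Lebesgue measure on `[0, ∞)`. -/
def base : Measure ℝ≥0 := Measure.map Real.toNNReal ((volume : Measure ℝ).restrict (Set.Ici 0))

instance : SFinite base := by unfold base; infer_instance

variable (D : ValueDist)

theorem law_eq : D.law = base.withDensity fun v => (D.pdf v : ℝ≥0∞) := rfl

instance : IsProbabilityMeasure D.law where
  measure_univ := by
    rw [law_eq, withDensity_apply _ MeasurableSet.univ, Measure.restrict_univ, base,
      lintegral_map D.measurable_pdf.coe_nnreal_ennreal measurable_real_toNNReal]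
    exact D.lintegral_pdf

/-- The reciprocal of the hazard rate, `(1 - F v) / f v`. -/
def mills (v : ℝ≥0) : ℝ≥0∞ := (1 - D.cdf v) / (D.pdf v : ℝ≥0∞)

theorem virtualValue_eq (v : ℝ≥0) :
    D.virtualValue v = ((v : ℝ) : EReal) - (D.mills v : EReal) := rfl

theorem monotone_cdf : Monotone D.cdf := fun _ _ h => measure_mono (Set.Iic_subset_Iic.2 h)

theorem cdf_le_one (v : ℝ≥0) : D.cdf v ≤ 1 := prob_le_one

theorem measurable_cdf : Measurable D.cdf := D.monotone_cdf.measurable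

theorem measurable_mills : Measurable D.mills :=
  (D.measurable_cdf.const_sub 1).div (measurable_coe_nnreal_ennreal.comp D.measurable_pdf)

theorem law_Ioi (z : ℝ≥0) : D.law (Set.Ioi z) = 1 - D.cdf z := by
  rw [← Set.compl_Iic, prob_compl_eq_one_sub measurableSet_Iic, cdf]

/-- The virtual value as a real number, and `0` where it is `-∞`. This is what the program computes
from the values of the distribution function and of the density. -/
def score (v : ℝ≥0) : ℝ :=
  if D.pdf v = 0 then (if (D.cdf v).toReal < 1 then 0 else v)
  else v - (1 - (D.cdf v).toReal) / D.pdf v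

theorem cdf_toReal_lt_one_iff (v : ℝ≥0) : (D.cdf v).toReal < 1 ↔ 1 - D.cdf v ≠ 0 := by
  have hne : D.cdf v ≠ ∞ := ne_top_of_le_ne_top ENNReal.one_ne_top (D.cdf_le_one v)
  rw [← ENNReal.toReal_one, ENNReal.toReal_lt_toReal hne ENNReal.one_ne_top, Ne,
    tsub_eq_zero_iff_le, not_le]

theorem mills_eq_top_iff (v : ℝ≥0) :
    D.mills v = ∞ ↔ D.pdf v = 0 ∧ (D.cdf v).toReal < 1 := by
  rw [mills, ENNReal.div_eq_top, cdf_toReal_lt_one_iff]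
  have : 1 - D.cdf v ≠ ∞ := ne_top_of_le_ne_top ENNReal.one_ne_top tsub_le_self
  simp [this, and_comm]

theorem score_of_mills_eq_top {v : ℝ≥0} (h : D.mills v = ∞) : D.score v = 0 := by
  obtain ⟨h1, h2⟩ := (D.mills_eq_top_iff v).1 h
  rw [score, if_pos h1, if_pos h2]

theorem score_of_mills_ne_top {v : ℝ≥0} (h : D.mills v ≠ ∞) :
    D.score v = v - (D.mills v).toReal := by
  rw [Ne, mills_eq_top_iff] at h
  by_cases h0 : D.pdf v = 0
  · have h1 : ¬ (D.cdf v).toReal < 1 := fun h1 => h ⟨h0, h1⟩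
    have h2 : 1 - D.cdf v = 0 := by
      by_contra hne
      exact h1 ((D.cdf_toReal_lt_one_iff v).2 hne)
    rw [score, if_pos h0, if_neg h1, mills, h2]
    simp
  · rw [score, if_neg h0, mills, ENNReal.toReal_div,
      ENNReal.toReal_sub_of_le (D.cdf_le_one v) ENNReal.one_ne_top]
    simp

theorem virtualValue_of_mills_eq_top {v : ℝ≥0} (h : D.mills v = ∞) : D.virtualValue v = ⊥ := by
  rw [virtualValue_eq, h, EReal.coe_ennreal_top, EReal.sub_top]

theorem virtualValue_of_mills_ne_top {v : ℝ≥0} (h : D.mills v ≠ ∞) :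
    D.virtualValue v = (D.score v : EReal) := by
  rw [virtualValue_eq, score_of_mills_ne_top D h, EReal.coe_sub]
  congr 1
  exact (EReal.coe_toReal (by simpa using h) (by simp)).symm.trans (by simp)

/-- Regularity in terms of real numbers. -/
theorem IsRegular.score_le {D : ValueDist} (h : D.IsRegular) {z z' : ℝ≥0} (hz : z ≤ z')
    (htop : D.mills z ≠ ∞) : D.mills z' ≠ ∞ ∧ D.score z ≤ D.score z' := by
  have h1 := h hz
  rw [D.virtualValue_of_mills_ne_top htop] at h1
  have h2 : D.mills z' ≠ ∞ := fun h2 => by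
    rw [D.virtualValue_of_mills_eq_top h2, le_bot_iff] at h1
    exact EReal.coe_ne_bot _ h1
  rw [D.virtualValue_of_mills_ne_top h2] at h1
  exact ⟨h2, by exact_mod_cast h1⟩

/-! ### Expected areas under curves in one dimension -/

/-- Tonelli's theorem for the area below `v` under the graph of `g`. -/
theorem lintegral_area {g : ℝ≥0 → ℝ≥0∞} (hg : Measurable g) :
    ∫⁻ v, ∫⁻ z, (Set.Iio v).indicator g z ∂base ∂D.law = ∫⁻ z, (1 - D.cdf z) * g z ∂base := by
  have hmeas : Measurable (Function.uncurry fun v z : ℝ≥0 => (Set.Iio v).indicator g z) := by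
    have : (Function.uncurry fun v z : ℝ≥0 => (Set.Iio v).indicator g z) =
        Set.indicator {q : ℝ≥0 × ℝ≥0 | q.2 < q.1} fun q => g q.2 := by
      funext q; rfl
    rw [this]
    exact (hg.comp measurable_snd).indicator (measurableSet_lt measurable_snd measurable_fst)
  rw [lintegral_lintegral_swap hmeas.aemeasurable]
  refine lintegral_congr fun z => ?_
  have : (fun v : ℝ≥0 => (Set.Iio v).indicator g z) =
      (Set.Ioi z).indicator fun _ => g z := by
    funext v
    by_cases h : z < v <;> simp [Set.indicator, h]
  rw [this, lintegral_indicator measurableSet_Ioi, setLIntegral_const, law_Ioi, mul_comm]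

theorem lintegral_mills_mul {g : ℝ≥0 → ℝ≥0∞} (hg : Measurable g) :
    ∫⁻ v, D.mills v * g v ∂D.law = ∫⁻ z, (D.pdf z * D.mills z) * g z ∂base := by
  have hm : Measurable fun v => D.mills v * g v := D.measurable_mills.mul hg
  rw [law_eq, lintegral_withDensity_eq_lintegral_mul _ D.measurable_pdf.coe_nnreal_ennreal hm]
  exact lintegral_congr fun z => (mul_assoc _ _ _).symm

theorem lintegral_mills_mul_le {g : ℝ≥0 → ℝ≥0∞} (hg : Measurable g) :
    ∫⁻ v, D.mills v * g v ∂D.law ≤ ∫⁻ v, ∫⁻ z, (Set.Iio v).indicator g z ∂base ∂D.law := by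
  rw [lintegral_area D hg, lintegral_mills_mul D hg]
  exact lintegral_mono fun z => mul_le_mul_left ENNReal.mul_div_le _

/-- Equality holds when `g` vanishes where the virtual value is `-∞`. -/
theorem lintegral_mills_mul_ge {g : ℝ≥0 → ℝ≥0∞} (hg : Measurable g)
    (h0 : ∀ z, D.mills z = ∞ → g z = 0) :
    ∫⁻ v, ∫⁻ z, (Set.Iio v).indicator g z ∂base ∂D.law ≤ ∫⁻ v, D.mills v * g v ∂D.law := by
  rw [lintegral_area D hg, lintegral_mills_mul D hg]
  refine lintegral_mono fun z => ?_
  by_cases h : D.mills z = ∞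
  · simp [h0 z h]
  · refine mul_le_mul_left ?_ _
    by_cases hp : D.pdf z = 0
    · have h1 : ¬ (D.cdf z).toReal < 1 := fun h1 => h ((D.mills_eq_top_iff z).2 ⟨hp, h1⟩)
      rw [cdf_toReal_lt_one_iff, not_not] at h1
      rw [h1]
      exact zero_le
    · exact (ENNReal.mul_div_cancel (by simpa using hp) ENNReal.coe_ne_top).ge

theorem base_area_eq {f : ℝ → ℝ} (hf : Monotone f) (h0 : ∀ z, 0 ≤ f z) (v : ℝ≥0) :
    ∫⁻ z, (Set.Iio v).indicator (fun z : ℝ≥0 => ENNReal.ofReal (f z)) z ∂base =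
      ENNReal.ofReal (∫ z in (0 : ℝ)..v, f z) := by
  have hm : Measurable fun z : ℝ≥0 => ENNReal.ofReal (f z) :=
    ENNReal.measurable_ofReal.comp (hf.measurable.comp measurable_coe_nnreal_real)
  rw [base, lintegral_map (hm.indicator measurableSet_Iio) measurable_real_toNNReal,
    intervalIntegral.integral_of_le (NNReal.coe_nonneg v), ← integral_Ico_eq_integral_Ioc,
    ofReal_integral_eq_lintegral_ofReal _ (Filter.Eventually.of_forall h0),
    ← lintegral_indicator measurableSet_Ici, ← lintegral_indicator measurableSet_Ico]
  · refine lintegral_congr fun z => ?_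
    by_cases hz : 0 ≤ z
    · have : z.toNNReal < v ↔ z < v := by
        rw [← NNReal.coe_lt_coe, Real.coe_toNNReal _ hz]
      simp [Set.indicator, hz, this]
    · simp [Set.indicator, hz]
  · rw [← IntegrableOn, ← integrableOn_Icc_iff_integrableOn_Ico,
      integrableOn_Icc_iff_integrableOn_Ioc]
    exact (hf.intervalIntegrable (a := 0) (b := v)).1

end ValueDist

namespace PositionAuction

variable {n m : ℕ} {A : PositionAuction n m}

/-! ### Expected revenue -/

namespace Mechanism

variable {M : A.Mechanism} {D : Fin n → ValueDist}

/-- The area under the curve of click probabilities of advertiser `i`. -/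
def area (M : A.Mechanism) (i : Fin n) (v : Fin n → ℝ≥0) : ℝ≥0∞ :=
  ∫⁻ z, (Set.Iio (v i)).indicator
    (fun z => ENNReal.ofReal (M.clickProb (Function.update v i z) i)) z ∂ValueDist.base

theorem measurable_area (M : A.Mechanism) (i : Fin n) : Measurable (M.area i) := by
  refine Measurable.lintegral_prod_right (f := fun (v : Fin n → ℝ≥0) (z : ℝ≥0) =>
    (Set.Iio (v i)).indicator
      (fun z => ENNReal.ofReal (M.clickProb (Function.update v i z) i)) z) ?_
  have : (Function.uncurry fun (v : Fin n → ℝ≥0) (z : ℝ≥0) => (Set.Iio (v i)).indicator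
      (fun z => ENNReal.ofReal (M.clickProb (Function.update v i z) i)) z) =
      Set.indicator {q : (Fin n → ℝ≥0) × ℝ≥0 | q.2 < q.1 i}
        fun q => ENNReal.ofReal (M.clickProb (Function.update q.1 i q.2) i) := by
    funext q; rfl
  rw [this]
  refine Measurable.indicator ?_
    (measurableSet_lt measurable_snd ((measurable_pi_apply i).comp measurable_fst))
  exact ENNReal.measurable_ofReal.comp ((M.measurable_clickProb i).comp measurable_update')

theorem area_update (M : A.Mechanism) (i : Fin n) (v : Fin n → ℝ≥0) (w : ℝ≥0) :
    M.area i (Function.update v i w) = ∫⁻ z, (Set.Iio w).indicator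
      (fun z => ENNReal.ofReal (M.clickProb (Function.update v i z) i)) z ∂ValueDist.base := by
  simp [area]

theorem area_eq (hmono : ∀ r i, Monotone (M.curve r i)) (i : Fin n) (v : Fin n → ℝ≥0) :
    M.area i v = ENNReal.ofReal (∫ z in (0 : ℝ)..v i, M.curve v i z) := by
  rw [← ValueDist.base_area_eq (hmono v i) fun z => M.clickProb_nonneg _ _]
  simp only [area, curve_coe]

theorem measurable_mills_mul (M : A.Mechanism) (D : Fin n → ValueDist) (i : Fin n) :
    Measurable fun v => (D i).mills (v i) * ENNReal.ofReal (M.clickProb v i) :=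
  ((D i).measurable_mills.comp (measurable_pi_apply i)).mul
    (ENNReal.measurable_ofReal.comp (M.measurable_clickProb i))

theorem measurable_clickProb_update (M : A.Mechanism) (i : Fin n) (v : Fin n → ℝ≥0) :
    Measurable fun z => ENNReal.ofReal (M.clickProb (Function.update v i z) i) :=
  ENNReal.measurable_ofReal.comp ((M.measurable_clickProb i).comp (measurable_update v))

theorem lintegral_mills_le_area (M : A.Mechanism) (D : Fin n → ValueDist) (i : Fin n) :
    ∫⁻ v, (D i).mills (v i) * ENNReal.ofReal (M.clickProb v i) ∂Measure.pi (fun i => (D i).law) ≤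
      ∫⁻ v, M.area i v ∂Measure.pi fun i => (D i).law := by
  refine lintegral_le_of_lmarginal_le {i} (M.measurable_mills_mul D i) (M.measurable_area i) ?_
  rw [lmarginal_singleton, lmarginal_singleton]
  intro v
  simp only [area_update, Function.update_self]
  exact (D i).lintegral_mills_mul_le (M.measurable_clickProb_update i v)

theorem lintegral_area_le_mills (i : Fin n)
    (h0 : ∀ v, (D i).mills (v i) = ∞ → M.clickProb v i = 0) :
    ∫⁻ v, M.area i v ∂Measure.pi (fun i => (D i).law) ≤
      ∫⁻ v, (D i).mills (v i) * ENNReal.ofReal (M.clickProb v i)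
        ∂Measure.pi fun i => (D i).law := by
  refine lintegral_le_of_lmarginal_le {i} (M.measurable_area i) (M.measurable_mills_mul D i) ?_
  rw [lmarginal_singleton, lmarginal_singleton]
  intro v
  simp only [area_update, Function.update_self]
  refine (D i).lintegral_mills_mul_ge (M.measurable_clickProb_update i v) fun z hz => ?_
  rw [h0 _ (by simpa using hz), ENNReal.ofReal_zero]

/-- Under finite means, the expected inverse hazard rate is finite: it is at most the mean. -/
theorem lintegral_mills_lt_top (M : A.Mechanism) {i : Fin n} (hD : (D i).HasFiniteMean) :
    ∫⁻ v, (D i).mills (v i) * ENNReal.ofReal (M.clickProb v i)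
      ∂Measure.pi (fun i => (D i).law) < ∞ := by
  have h1 : ∫⁻ v, (D i).mills (v i) * ENNReal.ofReal (M.clickProb v i)
      ∂Measure.pi (fun i => (D i).law) ≤
      ∫⁻ v, (D i).mills (v i) * 1 ∂Measure.pi fun i => (D i).law :=
    lintegral_mono fun v => mul_le_mul_right (by
      rw [← ENNReal.ofReal_one]; exact ENNReal.ofReal_le_ofReal (M.clickProb_le_one v i)) _
  have hm : Measurable fun v => (D i).mills v * 1 := (D i).measurable_mills.mul measurable_const
  have h2 := (measurePreserving_eval (fun i => (D i).law) i).lintegral_comp hm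
  refine h1.trans_lt ?_
  change ∫⁻ v, (D i).mills (Function.eval i v) * 1 ∂Measure.pi (fun i => (D i).law) < ∞
  rw [h2]
  refine ((D i).lintegral_mills_mul_le measurable_const).trans_lt ?_
  refine lt_of_eq_of_lt (lintegral_congr fun v => ?_) hD
  have := ValueDist.base_area_eq (f := fun _ => 1) monotone_const (fun _ => zero_le_one) v
  simpa using this

/-- The revenue of an incentive compatible and individually rational mechanism is at most its
virtual surplus. -/
theorem revenue_add_le (hic : M.IsIC) (hir : M.IsIR) :
    M.revenue D + ∑ i, ∫⁻ v, (D i).mills (v i) * ENNReal.ofReal (M.clickProb v i)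
        ∂Measure.pi (fun i => (D i).law) ≤
      ∑ i, ∫⁻ v, (v i : ℝ≥0∞) * ENNReal.ofReal (M.clickProb v i)
        ∂Measure.pi fun i => (D i).law := by
  have hpay : ∀ i, Measurable fun v => (M.pay v i : ℝ≥0∞) :=
    fun i => measurable_coe_nnreal_ennreal.comp (M.measurable_pay i)
  rw [revenue, lintegral_finsetSum _ fun i _ => hpay i, ← Finset.sum_add_distrib]
  refine Finset.sum_le_sum fun i _ => ?_
  refine (add_le_add_right (M.lintegral_mills_le_area D i) _).trans ?_
  rw [← lintegral_add_left (hpay i)]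
  refine lintegral_mono fun v => ?_
  have h1 := hic.integral_curve_le hir v i
  have h0 : 0 ≤ ∫ z in (0 : ℝ)..v i, M.curve v i z :=
    intervalIntegral.integral_nonneg (v i).2 fun z _ => M.clickProb_nonneg _ _
  simp only [area_eq hic.monotone_curve, utility] at h1 ⊢
  rw [← ENNReal.ofReal_coe_nnreal, ← ENNReal.ofReal_coe_nnreal,
    ← ENNReal.ofReal_mul (NNReal.coe_nonneg (v i)),
    ← ENNReal.ofReal_add (NNReal.coe_nonneg (M.pay v i)) h0]
  exact ENNReal.ofReal_le_ofReal (by linarith)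

/-- A mechanism that charges at least the Myerson payments earns at least its virtual surplus,
if it never shows advertisers whose virtual value is `-∞`. -/
theorem le_revenue_add (hmono : ∀ r i, Monotone (M.curve r i))
    (hpay : ∀ r i, r i * M.clickProb r i - ∫ z in (0 : ℝ)..r i, M.curve r i z ≤ M.pay r i)
    (h0 : ∀ v i, (D i).mills (v i) = ∞ → M.clickProb v i = 0) :
    ∑ i, ∫⁻ v, (v i : ℝ≥0∞) * ENNReal.ofReal (M.clickProb v i)
        ∂Measure.pi (fun i => (D i).law) ≤
      M.revenue D + ∑ i, ∫⁻ v, (D i).mills (v i) * ENNReal.ofReal (M.clickProb v i)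
        ∂Measure.pi fun i => (D i).law := by
  have hpm : ∀ i, Measurable fun v => (M.pay v i : ℝ≥0∞) :=
    fun i => measurable_coe_nnreal_ennreal.comp (M.measurable_pay i)
  rw [revenue, lintegral_finsetSum _ fun i _ => hpm i, ← Finset.sum_add_distrib]
  refine Finset.sum_le_sum fun i _ => ?_
  refine le_trans ?_ (add_le_add_right (lintegral_area_le_mills i fun v => h0 v i) _)
  rw [← lintegral_add_left (hpm i)]
  refine lintegral_mono fun v => ?_
  have h1 := hpay v i
  have h0 : 0 ≤ ∫ z in (0 : ℝ)..v i, M.curve v i z :=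
    intervalIntegral.integral_nonneg (v i).2 fun z _ => M.clickProb_nonneg _ _
  simp only [area_eq hmono]
  rw [← ENNReal.ofReal_coe_nnreal, ← ENNReal.ofReal_coe_nnreal,
    ← ENNReal.ofReal_mul (NNReal.coe_nonneg (v i)),
    ← ENNReal.ofReal_add (NNReal.coe_nonneg (M.pay v i)) h0]
  exact ENNReal.ofReal_le_ofReal (by linarith)

/-- Comparison of virtual surpluses. The terms that are subtracted in a virtual surplus have been
moved to the other side, so that infinite ones do no harm. -/
theorem surplus_le {M' : A.Mechanism} {v : Fin n → ℝ≥0}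
    (hopt : ∑ i, (D i).score (v i) * M'.clickProb v i ≤
      ∑ i, (D i).score (v i) * M.clickProb v i)
    (h0 : ∀ i, (D i).mills (v i) = ∞ → M.clickProb v i = 0) :
    ∑ i, (v i : ℝ≥0∞) * ENNReal.ofReal (M'.clickProb v i) +
        ∑ i, (D i).mills (v i) * ENNReal.ofReal (M.clickProb v i) ≤
      ∑ i, (v i : ℝ≥0∞) * ENNReal.ofReal (M.clickProb v i) +
        ∑ i, (D i).mills (v i) * ENNReal.ofReal (M'.clickProb v i) := by
  by_cases hbad : ∃ i, (D i).mills (v i) = ∞ ∧ M'.clickProb v i ≠ 0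
  · obtain ⟨i, hi, hne⟩ := hbad
    have hpos : 0 < M'.clickProb v i := lt_of_le_of_ne (M'.clickProb_nonneg v i) hne.symm
    have : ∑ i, (D i).mills (v i) * ENNReal.ofReal (M'.clickProb v i) = ∞ := by
      rw [ENNReal.sum_eq_top]
      exact ⟨i, Finset.mem_univ i, by
        rw [hi, ENNReal.top_mul (ENNReal.ofReal_pos.2 hpos).ne']⟩
    rw [this, add_top]
    exact le_top
  · push Not at hbad
    have e1 : ∀ (N : A.Mechanism), ∑ i, (v i : ℝ≥0∞) * ENNReal.ofReal (N.clickProb v i) =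
        ENNReal.ofReal (∑ i, v i * N.clickProb v i) := fun N => by
      rw [ENNReal.ofReal_sum_of_nonneg fun i _ =>
        mul_nonneg (NNReal.coe_nonneg (v i)) (N.clickProb_nonneg v i)]
      refine Finset.sum_congr rfl fun i _ => ?_
      rw [ENNReal.ofReal_mul (NNReal.coe_nonneg (v i)), ENNReal.ofReal_coe_nnreal]
    have e2 : ∀ (N : A.Mechanism), (∀ i, (D i).mills (v i) = ∞ → N.clickProb v i = 0) →
        ∑ i, (D i).mills (v i) * ENNReal.ofReal (N.clickProb v i) =
        ENNReal.ofReal (∑ i, ((D i).mills (v i)).toReal * N.clickProb v i) := fun N hN => by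
      rw [ENNReal.ofReal_sum_of_nonneg fun i _ =>
        mul_nonneg ENNReal.toReal_nonneg (N.clickProb_nonneg v i)]
      refine Finset.sum_congr rfl fun i _ => ?_
      by_cases h : (D i).mills (v i) = ∞
      · simp [hN i h]
      · rw [ENNReal.ofReal_mul ENNReal.toReal_nonneg, ENNReal.ofReal_toReal h]
    have e3 : ∀ (N : A.Mechanism), (∀ i, (D i).mills (v i) = ∞ → N.clickProb v i = 0) →
        ∑ i, (D i).score (v i) * N.clickProb v i = ∑ i, v i * N.clickProb v i -
          ∑ i, ((D i).mills (v i)).toReal * N.clickProb v i := fun N hN => by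
      rw [← Finset.sum_sub_distrib]
      refine Finset.sum_congr rfl fun i _ => ?_
      by_cases h : (D i).mills (v i) = ∞
      · simp [hN i h]
      · rw [(D i).score_of_mills_ne_top h]; ring
    rw [e3 M h0, e3 M' hbad] at hopt
    have hnn : ∀ (N : A.Mechanism), 0 ≤ ∑ i, ((D i).mills (v i)).toReal * N.clickProb v i :=
      fun N => Finset.sum_nonneg fun i _ =>
        mul_nonneg ENNReal.toReal_nonneg (N.clickProb_nonneg v i)
    have hnn' : ∀ (N : A.Mechanism), 0 ≤ ∑ i, v i * N.clickProb v i :=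
      fun N => Finset.sum_nonneg fun i _ => mul_nonneg (v i).2 (N.clickProb_nonneg v i)
    rw [e1, e1, e2 M h0, e2 M' hbad, ← ENNReal.ofReal_add (hnn' _) (hnn _),
      ← ENNReal.ofReal_add (hnn' _) (hnn _)]
    exact ENNReal.ofReal_le_ofReal (by linarith)

/-- Myerson's theorem: a mechanism that maximizes the virtual surplus pointwise and charges at
least the Myerson payments earns at least as much as every incentive compatible and individually
rational mechanism. -/
theorem revenue_le {M' : A.Mechanism} (hD : ∀ i, (D i).HasFiniteMean)
    (hic : M'.IsIC) (hir : M'.IsIR) (hmono : ∀ r i, Monotone (M.curve r i))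
    (hpay : ∀ r i, r i * M.clickProb r i - ∫ z in (0 : ℝ)..r i, M.curve r i z ≤ M.pay r i)
    (h0 : ∀ v i, (D i).mills (v i) = ∞ → M.clickProb v i = 0)
    (hopt : ∀ v, ∑ i, (D i).score (v i) * M'.clickProb v i ≤
      ∑ i, (D i).score (v i) * M.clickProb v i) :
    M'.revenue D ≤ M.revenue D := by
  have h1 := revenue_add_le (D := D) hic hir
  have h2 := le_revenue_add (D := D) hmono hpay h0
  have hv : ∀ (N : A.Mechanism) (i : Fin n), Measurable fun v : Fin n → ℝ≥0 =>
      (v i : ℝ≥0∞) * ENNReal.ofReal (N.clickProb v i) := fun N i =>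
    (measurable_coe_nnreal_ennreal.comp (measurable_pi_apply i)).mul
      (ENNReal.measurable_ofReal.comp (N.measurable_clickProb i))
  have h3 := lintegral_mono (μ := Measure.pi fun i => (D i).law)
    fun v => surplus_le (hopt v) (h0 v)
  rw [lintegral_add_left (Finset.measurable_sum _ fun i _ => hv M' i),
    lintegral_add_left (Finset.measurable_sum _ fun i _ => hv M i),
    lintegral_finsetSum _ fun i _ => hv M' i, lintegral_finsetSum _ fun i _ => hv M i,
    lintegral_finsetSum _ fun i _ => M.measurable_mills_mul D i,
    lintegral_finsetSum _ fun i _ => M'.measurable_mills_mul D i] at h3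
  set B := ∑ i, ∫⁻ v, (D i).mills (v i) * ENNReal.ofReal (M.clickProb v i)
    ∂Measure.pi fun i => (D i).law with hB
  set B' := ∑ i, ∫⁻ v, (D i).mills (v i) * ENNReal.ofReal (M'.clickProb v i)
    ∂Measure.pi fun i => (D i).law with hB'
  have hfin : B ≠ ∞ := (ENNReal.sum_lt_top.2 fun i _ => M.lintegral_mills_lt_top (hD i)).ne
  have hfin' : B' ≠ ∞ := (ENNReal.sum_lt_top.2 fun i _ => M'.lintegral_mills_lt_top (hD i)).ne
  refine ENNReal.le_of_add_le_add_right hfin' (ENNReal.le_of_add_le_add_right hfin ?_)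
  calc M'.revenue D + B' + B ≤ _ := add_le_add_left h1 B
    _ ≤ _ := h3
    _ ≤ M.revenue D + B + B' := add_le_add_left h2 B'
    _ = M.revenue D + B' + B := add_right_comm _ _ _

end Mechanism

/-! ### Virtual surplus maximization -/

/-- The real virtual values at the reports `v`. -/
def scores (D : Fin n → ValueDist) (v : Fin n → ℝ≥0) (i : Fin n) : ℝ :=
  (D i).score (v i)

theorem scores_update (D : Fin n → ValueDist) (v : Fin n → ℝ≥0) (i : Fin n)
    (z : ℝ≥0) :
    scores D (Function.update v i z) = Function.update (scores D v) i ((D i).score z) := by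
  funext k
  by_cases h : k = i
  · subst h; simp [scores]
  · simp [scores, h]

/-- Raising one weight raises the click-through rate of that advertiser. Ties are harmless because
the allocation is a function of the weights. -/
theorem clickRate_best_mono (w : Fin n → ℝ) (i : Fin n) {a b : ℝ} (hab : a ≤ b) :
    A.clickRate (A.best (Function.update w i a)) i ≤
      A.clickRate (A.best (Function.update w i b)) i := by
  rcases hab.eq_or_lt with rfl | hlt
  · exact le_rfl
  have hsum : ∀ (c : ℝ) (y : Fin n → ℝ), ∑ k, Function.update w i c k * y k =
      c * y i + ∑ k ∈ Finset.univ.erase i, w k * y k := fun c y => by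
    rw [← Finset.add_sum_erase _ _ (Finset.mem_univ i), Function.update_self]
    congr 1
    exact Finset.sum_congr rfl fun k hk => by
      rw [Function.update_of_ne (Finset.ne_of_mem_erase hk)]
  have h1 := sum_le_bestValue (Function.update w i a) (A.best (Function.update w i b))
  have h2 := sum_le_bestValue (Function.update w i b) (A.best (Function.update w i a))
  rw [← sum_best, hsum, hsum] at h1 h2
  nlinarith

/-- The click-through rate of advertiser `i` under virtual surplus maximization, as a function of
its own report. -/
def scoreCurve (A : PositionAuction n m) (D : Fin n → ValueDist) (r : Fin n → ℝ≥0) (i : Fin n)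
    (z : ℝ) : ℝ :=
  A.clickRate (A.best (Function.update (scores D r) i ((D i).score z.toNNReal))) i

theorem monotone_scoreCurve {D : Fin n → ValueDist} (hD : ∀ i, (D i).IsRegular)
    (r : Fin n → ℝ≥0) (i : Fin n) : Monotone (A.scoreCurve D r i) := by
  intro z z' hz
  have hle : z.toNNReal ≤ z'.toNNReal := Real.toNNReal_mono hz
  by_cases htop : (D i).mills z.toNNReal = ∞
  · rw [scoreCurve, (D i).score_of_mills_eq_top htop,
      clickRate_best_eq_zero (by rw [Function.update_self])]
    exact clickRate_nonneg _ _
  · exact clickRate_best_mono _ i ((hD i).score_le hle htop).2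

theorem coe_sum_ereal {ι : Type*} (s : Finset ι) (f : ι → ℝ) :
    ((∑ i ∈ s, f i : ℝ) : EReal) = ∑ i ∈ s, (f i : EReal) :=
  map_sum (⟨⟨(↑), EReal.coe_zero⟩, EReal.coe_add⟩ : ℝ →+ EReal) f s

namespace Mechanism

variable {M : A.Mechanism} {D : Fin n → ValueDist}

theorem curve_eq_scoreCurve
    (hy : ∀ v i, M.clickProb v i = A.clickRate (A.best (scores D v)) i)
    (r : Fin n → ℝ≥0) (i : Fin n) : M.curve r i = A.scoreCurve D r i := by
  funext z
  rw [curve, hy, scores_update, scoreCurve]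

theorem clickProb_eq_zero_of_mills
    (hy : ∀ v i, M.clickProb v i = A.clickRate (A.best (scores D v)) i)
    (v : Fin n → ℝ≥0) (i : Fin n) (h : (D i).mills (v i) = ∞) : M.clickProb v i = 0 := by
  rw [hy]
  exact clickRate_best_eq_zero ((D i).score_of_mills_eq_top h).le

/-- The allocation maximizes the virtual surplus, also with virtual values `-∞`. -/
theorem virtualSurplus_le
    (hy : ∀ v i, M.clickProb v i = A.clickRate (A.best (scores D v)) i)
    (v : Fin n → ℝ≥0) (x : A.Allocation) :
    ∑ i, (A.clickRate x i : EReal) * (D i).virtualValue (v i) ≤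
      ∑ i, (M.clickProb v i : EReal) * (D i).virtualValue (v i) := by
  have hreal : ∀ y : Fin n → ℝ, (∀ i, (D i).mills (v i) = ∞ → y i = 0) →
      ∑ i, (y i : EReal) * (D i).virtualValue (v i) =
        ((∑ i, scores D v i * y i : ℝ) : EReal) := fun y hy0 => by
    rw [coe_sum_ereal]
    refine Finset.sum_congr rfl fun i _ => ?_
    by_cases h : (D i).mills (v i) = ∞
    · simp [hy0 i h]
    · rw [(D i).virtualValue_of_mills_ne_top h, EReal.coe_mul, mul_comm]
      rfl
  rw [hreal _ fun i h => clickProb_eq_zero_of_mills hy v i h]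
  by_cases hbad : ∃ i, (D i).mills (v i) = ∞ ∧ A.clickRate x i ≠ 0
  · obtain ⟨i, hi, hne⟩ := hbad
    have hpos : 0 < A.clickRate x i := lt_of_le_of_ne (clickRate_nonneg x i) hne.symm
    rw [← Finset.add_sum_erase _ _ (Finset.mem_univ i), (D i).virtualValue_of_mills_eq_top hi,
      EReal.coe_mul_bot_of_pos hpos, EReal.bot_add]
    exact bot_le
  · push Not at hbad
    rw [hreal _ hbad]
    simp only [hy]
    rw [sum_best]
    exact_mod_cast sum_le_bestValue _ x

end Mechanism

end PositionAuction

namespace RealRAM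

/-! ### The auction programs -/

/-- Store the click-through rate of advertiser `i` under the current matching in array `a`. -/
def clickProg (a : ℕ) (i : NatExpr) : Prog :=
  .branch (isZero (nentry 5 i)) (.setReal a i (.const 0) (.const 0))
    (.setReal a i (.const 0) (.div (oddsExpr i (.sub (nentry 5 i) (.const 1))) (rvar 12)))

/-- Write out the current matching and its click-through rates. -/
def outputProg : Prog :=
  forLoop 2 sizeN (.seq
    (forLoop 3 sizeM
      (.branch (.and (.natLe (nentry 5 (nvar 2)) (.add (nvar 3) (.const 1)))
          (.natLe (.add (nvar 3) (.const 1)) (nentry 5 (nvar 2))))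
        (.setNat 1 (nvar 2) (nvar 3) (.const 1)) (.setNat 1 (nvar 2) (nvar 3) (.const 0))))
    (clickProg 13 (nvar 2)))

/-- The Vickrey-Clarke-Groves auction: the optimal value is computed once for all reports, and once
without each of the advertisers. -/
def vcgProg : Prog :=
  .seq (forLoop 2 sizeN (.setReal 4 (nvar 2) (.const 0) (rentry 1 (nvar 2)))) <|
  .seq newtonProg <|
  .seq outputProg <|
  .seq (setRvar 14 (rvar 10)) <|
  forLoop 4 sizeN <|
    .seq (.setReal 4 (nvar 4) (.const 0) (.const 0)) <|
    .seq newtonProg <|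
    .seq (.setReal 3 (nvar 4) (.const 0)
      (.add (.sub (rvar 10) (rvar 14)) (.mul (rentry 1 (nvar 4)) (rentry 13 (nvar 4)))))
    (.setReal 4 (nvar 4) (.const 0) (rentry 1 (nvar 4)))

/-- Store the virtual value of advertiser `i` at `x` as the weight of `i`, and `0` if it is `-∞`.
Densities are nonnegative, so the first test decides whether the density vanishes. -/
def scoreProg (i : NatExpr) (x : RealExpr) : Prog :=
  .branch (.realLe (.pdf i x) (.const 0))
    (.branch (.realLe (.const 1) (.cdf i x)) (.setReal 4 i (.const 0) x)
      (.setReal 4 i (.const 0) (.const 0)))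
    (.setReal 4 i (.const 0) (.sub x (.div (.sub (.const 1) (.cdf i x)) (.pdf i x))))

/-- One cell of the lower sum: subtract its area from the payment, and go to the next cell.
The last cell is cut off at the report. -/
def cellProg : Prog :=
  .seq (scoreProg (nvar 4) (rvar 14)) <|
  .seq newtonProg <|
  .seq (clickProg 15 (nvar 4)) <|
  .seq (.branch (.realLe (.add (rvar 14) (rvar 2)) (rentry 1 (nvar 4)))
    (.setReal 3 (nvar 4) (.const 0)
      (.sub (rentry 3 (nvar 4)) (.mul (rvar 2) (rentry 15 (nvar 4)))))
    (.setReal 3 (nvar 4) (.const 0)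
      (.sub (rentry 3 (nvar 4))
        (.mul (.sub (rentry 1 (nvar 4)) (rvar 14)) (rentry 15 (nvar 4))))))
  (setRvar 14 (.add (rvar 14) (rvar 2)))

/-- The revenue-maximizing auction: virtual surplus maximization, with a payment for each
advertiser that subtracts a lower Riemann sum from the value of its clicks. -/
def myersonProg : Prog :=
  .seq (forLoop 2 sizeN (scoreProg (nvar 2) (rentry 1 (nvar 2)))) <|
  .seq newtonProg <|
  .seq outputProg <|
  forLoop 4 sizeN <|
    .seq (.seq (.setReal 3 (nvar 4) (.const 0) (.mul (rentry 1 (nvar 4)) (rentry 13 (nvar 4))))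
      (setRvar 14 (.const 0))) <|
    .seq (.loop (.not (.realLe (rentry 1 (nvar 4)) (rvar 14))) cellProg)
    (scoreProg (nvar 4) (rentry 1 (nvar 4)))

end RealRAM

namespace PositionAuction

open RealRAM

variable {n m : ℕ} {A : PositionAuction n m} {O : Oracle} {s s' : Store}
  {v : Fin n → ℝ≥0} {ε : ℝ} {w : Fin n → ℝ}

/-! ### Correctness of the auction programs -/

/-- The memory holds the input. -/
structure InputRep (A : PositionAuction n m) (v : Fin n → ℝ≥0) (ε : ℝ) (s : Store) : Prop where
  sizes : Sizes n m A.K s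
  rate : ∀ i < n, ∀ j < m, s.real 0 i j = A.rate i j
  report : ∀ i : Fin n, s.real 1 i 0 = v i
  accuracy : s.real 2 0 0 = ε

theorem inputRep_input (A : PositionAuction n m) (v : Fin n → ℝ≥0) (ε : ℝ) :
    InputRep A v ε (A.input v ε) where
  sizes := ⟨rfl, rfl, rfl⟩
  rate i hi j hj := rfl
  report i := by simp [input]
  accuracy := by simp [input]

theorem InputRep.of_frame {c : Prog} (h : InputRep A v ε s) (hf : Frame c s s')
    (h0 : c.writesNat 0 = false) (h1 : c.writesReal 0 = false) (h2 : c.writesReal 1 = false)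
    (h3 : c.writesReal 2 = false) : InputRep A v ε s' :=
  ⟨h.sizes.of_eq (hf.nat 0 h0), fun i hi j hj => by rw [hf.real 0 h1, h.rate i hi j hj],
    fun i => by rw [hf.real 1 h2, h.report], by rw [hf.real 2 h3, h.accuracy]⟩

/-- The memory holds the weights `w`. -/
def WeightRep (w : Fin n → ℝ) (s : Store) : Prop := ∀ i : Fin n, s.real 4 i 0 = w i

/-- The memory holds the optimal value and the optimal allocation for the weights `w`. -/
structure SolutionRep (A : PositionAuction n m) (w : Fin n → ℝ) (s : Store) : Prop where
  rate : ∀ i < n, ∀ j < m, s.real 0 i j = A.rate i j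
  value : s.real 10 0 0 = A.bestValue w
  mate : ∀ i < n, s.nat 5 i 0 = (NewtonState.final n m A.K A.rate (extend w)).mate i
  den : s.real 12 0 0 = objDen n A.rate (NewtonState.final n m A.K A.rate (extend w)).mate

theorem SolutionRep.of_frame {c : Prog} (h : SolutionRep A w s) (hf : Frame c s s')
    (h0 : c.writesNat 5 = false) (h1 : c.writesReal 0 = false) (h2 : c.writesReal 10 = false)
    (h3 : c.writesReal 12 = false) : SolutionRep A w s' :=
  ⟨fun i hi j hj => by rw [hf.real 0 h1, h.rate i hi j hj], by rw [hf.real 10 h2, h.value],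
    fun i hi => by rw [hf.nat 5 h0, h.mate i hi], by rw [hf.real 12 h3, h.den]⟩

theorem runs_solve (hi : InputRep A v ε s) (hw : WeightRep w s) :
    Runs O newtonProg s (newtonTime n m) (SolutionRep A w) := by
  have hgo := (final_isOptimalResult A w).go
  refine (runs_newton A.K_le hi.sizes ⟨hi.rate, fun i h => ?_⟩ hgo).mono le_rfl
    fun s' hf h => ⟨fun i hi' j hj => by rw [hf.real 0 rfl, hi.rate i hi' j hj], h.R,
      h.mate hgo, h.den hgo⟩
  rw [hw ⟨i, h⟩, ← extend_coe w]

/-- `clickProg` realizes the formula for the click-through rates of an encoded matching. -/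
theorem runs_click {a : ℕ} {e : NatExpr} {i : Fin n} (hs : SolutionRep A w s)
    (he : e.value s = i) :
    Runs O (clickProg a e) s 3 fun s' =>
      s' = s.writeReal a i 0 (A.clickRate (A.best w) i) := by
  refine Runs.straight rfl (by simp [clickProg, Prog.cost]) ?_
  have hr := final_isOptimalResult A w
  have hle := hr.feasible.le i i.2
  rw [best, clickRate_alloc]
  simp only [clickProg, Prog.eval, Test.Holds, NatExpr.value, RealExpr.value, he,
    hs.mate i i.2, Nat.le_zero, hs.den, Nat.cast_zero, Nat.cast_one]
  split_ifs with h
  · rfl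
  · rw [hs.rate i i.2 _ (by omega)]; rfl

theorem runs_output (hi : InputRep A v ε s) (hs : SolutionRep A w s) :
    Runs O outputProg s (n * ((m * (3 + 2) + 2) + 3 + 2) + 2) fun s' =>
      (∀ (i : Fin n) (j : Fin m), s'.nat 1 i j = ((A.best w).1 i j : ℕ)) ∧
        ∀ i : Fin n, s'.real 13 i 0 = A.clickRate (A.best w) i := by
  refine (Runs.forLoop (n := n) (T := (m * (3 + 2) + 2) + 3) (fun k s' => ∀ i : Fin n,
      (i : ℕ) < k → (∀ j : Fin m, s'.nat 1 i j = ((A.best w).1 i j : ℕ)) ∧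
        s'.real 13 i 0 = A.clickRate (A.best w) i) rfl
    (fun s' hf => by simp [hf.nat 0 rfl, hi.sizes.n]) (fun _ _ _ h => by simpa using h) (by simp)
    fun k hk s₁ hf₁ hk' hI => ?_).mono le_rfl
    fun s' _ h => ⟨fun i => (h i i.2).1, fun i => (h i i.2).2⟩
  have hi₁ := hi.of_frame hf₁ rfl rfl rfl rfl
  have hs₁ := hs.of_frame hf₁ rfl rfl rfl rfl
  refine Runs.seq (Runs.forLoop (n := m) (T := 3) (fun l s' => ∀ (i : Fin n) (j : Fin m),
      ((i : ℕ) < k ∨ (i : ℕ) = k ∧ (j : ℕ) < l) → s'.nat 1 i j = ((A.best w).1 i j : ℕ)) rfl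
    (fun s' hf => by simp [hf.nat 0 rfl, hi₁.sizes.m]) (fun _ _ _ h => by simpa using h)
    (fun i j h => (hI i (by omega)).1 j)
    fun l hl s₂ hf₂ hl' hI' => Runs.straight rfl (by decide) ?_) fun s₂ hf₂ h₂ => ?_
  · have e2 : s₂.nat 2 0 0 = k := by rw [hf₂.nat 2 rfl, hk']
    have e5 := (hs₁.of_frame hf₂ rfl rfl rfl rfl).mate k hk
    intro i j hij
    have hr := final_isOptimalResult A w
    have hI'' := hI' i j
    have hval := hr.feasible.alloc_val i j
    rw [← best] at hval
    simp only [Prog.eval, Test.Holds, NatExpr.value, e2, hl', e5, ← le_antisymm_iff]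
    split_ifs with h <;> grind [Store.writeNat_nat]
  · have e2 : s₂.nat 2 0 0 = k := by rw [hf₂.nat 2 rfl, hk']
    have hs₂ := hs₁.of_frame hf₂ rfl rfl rfl rfl
    refine (runs_click (i := ⟨k, hk⟩) hs₂ (by simpa using e2)).mono le_rfl fun s₃ hf₃ h₃ => ?_
    intro i hik
    refine ⟨fun j => ?_, ?_⟩
    · rw [hf₃.nat 1 rfl]
      exact h₂ i j (by have := j.2; omega)
    · rw [h₃, Store.writeReal_real]
      rcases Nat.lt_succ_iff_lt_or_eq.1 hik with h | h
      · rw [if_neg (by simp; omega), hf₂.real 13 rfl, (hI i h).2]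
      · have : i = ⟨k, hk⟩ := Fin.ext h
        subst this
        simp

/-- A bound on the running time of `vcgProg`. -/
def vcgTime (n m : ℕ) : ℕ :=
  (n * (1 + 2) + 2) + (newtonTime n m + ((n * ((m * (3 + 2) + 2) + 3 + 2) + 2) + (1 +
    (n * ((1 + (newtonTime n m + (1 + 1))) + 2) + 2))))

theorem runs_vcg (A : PositionAuction n m) (v : Fin n → ℝ≥0) (ε : ℝ) :
    Runs O vcgProg (A.input v ε) (vcgTime n m) fun s =>
      (∀ (i : Fin n) (j : Fin m), s.nat 1 i j = ((A.best fun k => (v k : ℝ)).1 i j : ℕ)) ∧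
        ∀ i : Fin n, s.real 3 i 0 = A.bestValue (fun k => (Function.update v i 0 k : ℝ)) -
          A.bestValue (fun k => (v k : ℝ)) +
          v i * A.clickRate (A.best fun k => (v k : ℝ)) i := by
  have hi := inputRep_input A v ε
  refine Runs.seq (P := WeightRep fun k => (v k : ℝ)) ((Runs.forLoop (n := n) (T := 1)
    (fun k s' => ∀ i : Fin n, (i : ℕ) < k → s'.real 4 i 0 = v i) rfl
    (fun s' hf => by simp [hf.nat 0 rfl, hi.sizes.n]) (fun _ _ _ h => by simpa using h) (by simp)
    fun k hk s₁ hf₁ hk' hI => Runs.straight rfl (by decide) ?_).mono le_rfl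
    fun s' _ h i => h i i.2) fun s₁ hf₁ h₁ => ?_
  · intro i hik
    have e1 : s₁.real 1 k 0 = v ⟨k, hk⟩ := by rw [hf₁.real 1 rfl]; exact hi.report ⟨k, hk⟩
    simp only [Prog.eval, NatExpr.value, RealExpr.value, hk', e1, Store.writeReal_real]
    have := hI i
    rcases Nat.lt_succ_iff_lt_or_eq.1 hik with h | h
    · rw [if_neg (by omega), this h]
    · have : i = ⟨k, hk⟩ := Fin.ext h
      subst this
      simp
  have hi₁ := hi.of_frame hf₁ rfl rfl rfl rfl
  refine Runs.seq (runs_solve hi₁ h₁) fun s₂ hf₂ h₂ => ?_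
  have hi₂ := hi₁.of_frame hf₂ rfl rfl rfl rfl
  refine Runs.seq (runs_output hi₂ h₂) fun s₃ hf₃ h₃ => ?_
  have hi₃ := hi₂.of_frame hf₃ rfl rfl rfl rfl
  refine Runs.seq (Runs.straight (Q := fun s' => s'.real 14 0 0 = A.bestValue fun k => (v k : ℝ))
    rfl (by decide) (by simp [Prog.eval, hf₃.real 10 rfl, h₂.value])) fun s₄ hf₄ h₄ => ?_
  have hi₄ := hi₃.of_frame hf₄ rfl rfl rfl rfl
  have hw₄ : WeightRep (fun k => (v k : ℝ)) s₄ := fun i => by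
    rw [hf₄.real 4 rfl, hf₃.real 4 rfl, hf₂.real 4 rfl, h₁]
  refine (Runs.forLoop (n := n) (fun k s' => WeightRep (fun k => (v k : ℝ)) s' ∧
    ∀ i : Fin n, (i : ℕ) < k →
      s'.real 3 i 0 = A.bestValue (fun k => (Function.update v i 0 k : ℝ)) -
          A.bestValue (fun k => (v k : ℝ)) +
          v i * A.clickRate (A.best fun k => (v k : ℝ)) i) rfl
    (fun s' hf => by simp [hf.nat 0 rfl, hi₄.sizes.n])
    (fun _ _ _ h => by simpa [WeightRep] using h) ⟨hw₄, by simp⟩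
    fun k hk s₅ hf₅ hk' hI => ?_).mono le_rfl
    fun s' hf h => ⟨fun i j => by rw [hf.nat 1 rfl, hf₄.nat 1 rfl, h₃.1], fun i => h.2 i i.2⟩
  have hi₅ := hi₄.of_frame hf₅ rfl rfl rfl rfl
  refine Runs.seq (Runs.straight (Q := fun s' =>
    WeightRep (fun l => (Function.update v ⟨k, hk⟩ 0 l : ℝ)) s' ∧
    ∀ i : Fin n, (i : ℕ) ≠ k → s'.real 4 i 0 = v i) rfl (by decide) ?_) fun s₆ hf₆ h₆ => ?_
  · have : ∀ i : Fin n, (i : ℕ) ≠ k → i ≠ ⟨k, hk⟩ := fun i h h' => h (by rw [h'])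
    refine ⟨fun i => ?_, fun i h => ?_⟩
    · simp only [Prog.eval, NatExpr.value, RealExpr.value, hk', Store.writeReal_real]
      by_cases h : (i : ℕ) = k
      · have : i = ⟨k, hk⟩ := Fin.ext h
        subst this
        simp
      · simp [h, this i h, hI.1 i]
    · simp [Prog.eval, hk', h, hI.1 i]
  have hi₆ := hi₅.of_frame hf₆ rfl rfl rfl rfl
  refine Runs.seq (runs_solve hi₆ h₆.1) fun s₇ hf₇ h₇ => Runs.straight rfl (by decide) ?_
  have hi₇ := hi₆.of_frame hf₇ rfl rfl rfl rfl
  have e4 : s₇.nat 4 0 0 = k := by rw [hf₇.nat 4 rfl, hf₆.nat 4 rfl, hk']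
  have e13 : s₇.real 13 k 0 = A.clickRate (A.best fun k => (v k : ℝ)) ⟨k, hk⟩ := by
    rw [hf₇.real 13 rfl, hf₆.real 13 rfl, hf₅.real 13 rfl, hf₄.real 13 rfl]
    exact h₃.2 ⟨k, hk⟩
  have e14 : s₇.real 14 0 0 = A.bestValue fun k => (v k : ℝ) := by
    rw [hf₇.real 14 rfl, hf₆.real 14 rfl, hf₅.real 14 rfl, h₄]
  have e1 : s₇.real 1 k 0 = v ⟨k, hk⟩ := hi₇.report ⟨k, hk⟩
  simp only [Prog.eval, NatExpr.value, RealExpr.value, e4, e13, e14, h₇.value]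
  refine ⟨fun i => ?_, fun i hik => ?_⟩
  · by_cases h : (i : ℕ) = k
    · have : i = ⟨k, hk⟩ := Fin.ext h
      subst this
      simp [e4, e1]
    · simp [e4, h, hf₇.real 4 rfl, h₆.2 i h]
  · rcases Nat.lt_succ_iff_lt_or_eq.1 hik with h | h
    · have h' : (i : ℕ) ≠ k := by omega
      simp [h', hf₇.real 3 rfl, hf₆.real 3 rfl, hI.2 i h]
    · have : i = ⟨k, hk⟩ := Fin.ext h
      subst this
      simp [e1]

end PositionAuction

namespace PositionAuction

open RealRAM

variable {n m : ℕ} {A : PositionAuction n m} {s s' : Store}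
  {v : Fin n → ℝ≥0} {ε : ℝ} {w : Fin n → ℝ} {D : Fin n → ValueDist}

theorem runs_score {e : NatExpr} {x : RealExpr} {i : Fin n} {z : ℝ≥0} (he : e.value s = i)
    (hx : x.value (priorOracle D) s = z) :
    Runs (priorOracle D) (scoreProg e x) s 5 fun s' =>
      s' = s.writeReal 4 i 0 ((D i).score z) := by
  refine Runs.straight rfl (by simp [scoreProg, Prog.cost]) ?_
  have hpdf : (priorOracle D).pdf i z = (D i).pdf z := by
    simp only [priorOracle, dif_pos (show (i : ℕ) < n ∧ (0 : ℝ) ≤ z from ⟨i.2, z.2⟩)]; rfl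
  have hcdf : (priorOracle D).cdf i z = ((D i).cdf z).toReal := by
    simp only [priorOracle, dif_pos (show (i : ℕ) < n ∧ (0 : ℝ) ≤ z from ⟨i.2, z.2⟩)]; rfl
  have h0 : ((D i).pdf z : ℝ) ≤ 0 ↔ (D i).pdf z = 0 :=
    (NNReal.coe_le_coe (r₂ := 0)).trans nonpos_iff_eq_zero
  simp only [scoreProg, Prog.eval, Test.Holds, RealExpr.value, he, hx, hpdf, hcdf, Nat.cast_zero,
    Nat.cast_one, NatExpr.value, h0, ValueDist.score]
  split_ifs with h1 h2 h3 h3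
  · exact absurd h3 (not_lt.2 h2)
  · rfl
  · rfl
  · exact absurd (not_le.1 h2) h3
  · rfl

/-- A bound on the running time of `cellProg`. -/
def cellTime (n m : ℕ) : ℕ := 5 + (newtonTime n m + (3 + (3 + 1)))

/-- One pass through a cell that starts at `z`. The weights of the other advertisers are intact;
that of advertiser `l` is overwritten. -/
theorem runs_cell (hi : InputRep A v ε s) {l : Fin n} {z : ℝ} (hz0 : 0 ≤ z)
    (hl : s.nat 4 0 0 = l) (hz : s.real 14 0 0 = z)
    (hw : ∀ i, i ≠ l → s.real 4 i 0 = scores D v i) :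
    Runs (priorOracle D) cellProg s (cellTime n m) fun s' =>
      s'.real 14 0 0 = z + ε ∧ (∀ i, i ≠ l → s'.real 4 i 0 = scores D v i) ∧
      ∀ i : Fin n, s'.real 3 i 0 = if i = l then
        s.real 3 l 0 - min ε (v l - z) * A.scoreCurve D v l z else s.real 3 i 0 := by
  refine Runs.seq (runs_score (i := l) (z := z.toNNReal) (by simpa using hl)
    (by simpa [RealExpr.value, Real.coe_toNNReal _ hz0] using hz)) fun s₁ hf₁ h₁ => ?_
  have hi₁ := hi.of_frame hf₁ rfl rfl rfl rfl
  have hw₁ : WeightRep (Function.update (scores D v) l ((D l).score z.toNNReal)) s₁ := fun i => by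
    rw [h₁, Store.writeReal_real]
    by_cases h : i = l
    · subst h; simp
    · rw [if_neg (by simpa [Fin.ext_iff] using h), hw i h, Function.update_of_ne h]
  refine Runs.seq (runs_solve hi₁ hw₁) fun s₂ hf₂ h₂ => ?_
  have hi₂ := hi₁.of_frame hf₂ rfl rfl rfl rfl
  have e4 : s₂.nat 4 0 0 = l := by rw [hf₂.nat 4 rfl, hf₁.nat 4 rfl, hl]
  refine Runs.seq (runs_click (i := l) h₂ (by simpa using e4)) fun s₃ hf₃ h₃ => ?_
  have hi₃ := hi₂.of_frame hf₃ rfl rfl rfl rfl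
  refine Runs.straight rfl (by decide) ?_
  have e4 : s₃.nat 4 0 0 = l := by rw [hf₃.nat 4 rfl, e4]
  have e14 : s₃.real 14 0 0 = z := by rw [hf₃.real 14 rfl, hf₂.real 14 rfl, hf₁.real 14 rfl, hz]
  have e15 : s₃.real 15 l 0 = A.scoreCurve D v l z := by
    rw [h₃, Store.writeReal_real, if_pos (by simp), scoreCurve]
  have e3 : s₃.real 3 = s.real 3 := by rw [hf₃.real 3 rfl, hf₂.real 3 rfl, hf₁.real 3 rfl]
  have ew : ∀ i, i ≠ l → s₃.real 4 i 0 = scores D v i := fun i h => by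
    rw [hf₃.real 4 rfl, hf₂.real 4 rfl, hw₁, Function.update_of_ne h]
  simp only [Prog.eval, Test.Holds, NatExpr.value, RealExpr.value, e4, e14, e15, e3,
    hi₃.report l, hi₃.accuracy]
  split_ifs with h
  · have hmin : min ε (v l - z) = ε := min_eq_left (by linarith)
    refine ⟨by simp [e14, hi₃.accuracy], fun i h' => by simpa using ew i h', fun i => ?_⟩
    rw [hmin]
    simp [e3, Fin.ext_iff]
  · have hmin : min ε (v l - z) = v l - z := min_eq_right (by linarith)
    refine ⟨by simp [e14, hi₃.accuracy], fun i h' => by simpa using ew i h', fun i => ?_⟩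
    rw [hmin]
    simp [e3, Fin.ext_iff]

/-- A bound on the running time of `myersonProg` if the lower sums have at most `q` cells. -/
def myersonTime (n m q : ℕ) : ℕ :=
  (n * (5 + 2) + 2) + (newtonTime n m + ((n * ((m * (3 + 2) + 2) + 3 + 2) + 2) +
    (n * ((2 + ((q * (cellTime n m + 1) + 1) + 5)) + 2) + 2)))

theorem runs_myerson (A : PositionAuction n m) (D : Fin n → ValueDist) (v : Fin n → ℝ≥0)
    (hε : 0 < ε) {q : ℕ} (hq : ∀ l, ⌈(v l : ℝ) / ε⌉₊ ≤ q) :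
    Runs (priorOracle D) myersonProg (A.input v ε) (myersonTime n m q) fun s =>
      (∀ (i : Fin n) (j : Fin m), s.nat 1 i j = ((A.best (scores D v)).1 i j : ℕ)) ∧
        ∀ i : Fin n, s.real 3 i 0 = v i * A.clickRate (A.best (scores D v)) i -
          lowerSum ε (v i) (A.scoreCurve D v i) := by
  have hi := inputRep_input A v ε
  refine Runs.seq (P := WeightRep (scores D v)) ((Runs.forLoop (n := n) (T := 5)
    (fun k s' => ∀ i : Fin n, (i : ℕ) < k → s'.real 4 i 0 = scores D v i) rfl
    (fun s' hf => by simp [hf.nat 0 rfl, hi.sizes.n]) (fun _ _ _ h => by simpa using h) (by simp)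
    fun k hk s₁ hf₁ hk' hI => (runs_score (i := ⟨k, hk⟩) (z := v ⟨k, hk⟩) (by simpa using hk')
      ?_).mono le_rfl fun s₂ hf₂ h₂ i hik => ?_).mono le_rfl
    fun s' _ h i => h i i.2) fun s₁ hf₁ h₁ => ?_
  · simpa [hk'] using (hi.of_frame hf₁ rfl rfl rfl rfl).report ⟨k, hk⟩
  · rw [h₂, Store.writeReal_real]
    rcases Nat.lt_succ_iff_lt_or_eq.1 hik with h | h
    · rw [if_neg (by simp; omega), hI i h]
    · have : i = ⟨k, hk⟩ := Fin.ext h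
      subst this
      simp [scores]
  have hi₁ := hi.of_frame hf₁ rfl rfl rfl rfl
  refine Runs.seq (runs_solve hi₁ h₁) fun s₂ hf₂ h₂ => ?_
  have hi₂ := hi₁.of_frame hf₂ rfl rfl rfl rfl
  refine Runs.seq (runs_output hi₂ h₂) fun s₃ hf₃ h₃ => ?_
  have hi₃ := hi₂.of_frame hf₃ rfl rfl rfl rfl
  have hw₃ : WeightRep (scores D v) s₃ := fun i => by
    rw [hf₃.real 4 rfl, hf₂.real 4 rfl, h₁]
  refine (Runs.forLoop (n := n) (fun k s' => WeightRep (scores D v) s' ∧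
    ∀ i : Fin n, (i : ℕ) < k → s'.real 3 i 0 = v i * A.clickRate (A.best (scores D v)) i -
          lowerSum ε (v i) (A.scoreCurve D v i)) rfl
    (fun s' hf => by simp [hf.nat 0 rfl, hi₃.sizes.n])
    (fun _ _ _ h => by simpa [WeightRep] using h) ⟨hw₃, by simp⟩
    fun k hk s₅ hf₅ hk' hI => ?_).mono le_rfl
    fun s' hf h => ⟨fun i j => by rw [hf.nat 1 rfl, h₃.1], fun i => h.2 i i.2⟩
  have hi₅ := hi₃.of_frame hf₅ rfl rfl rfl rfl
  obtain ⟨l, rfl⟩ : ∃ l : Fin n, k = l := ⟨⟨k, hk⟩, rfl⟩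
  have e13 : s₅.real 13 l 0 = A.clickRate (A.best (scores D v)) l := by
    rw [hf₅.real 13 rfl, h₃.2]
  set f := A.scoreCurve D v l with hf
  set y := A.clickRate (A.best (scores D v)) l with hy
  -- the state after `k` cells; the number of cells is exact, since the loop ends at `v l ≤ k * ε`
  set I : ℕ → Store → Prop := fun k s' => k ≤ ⌈(v l : ℝ) / ε⌉₊ ∧ s'.real 14 0 0 = k * ε ∧
    (∀ i, i ≠ l → s'.real 4 i 0 = scores D v i) ∧
    s'.real 3 l 0 = v l * y - ∑ j ∈ Finset.range k, min ε (v l - j * ε) * f (j * ε) ∧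
    ∀ i : Fin n, i ≠ l → s'.real 3 i 0 = s₅.real 3 i 0 with hIdef
  have hne : ∀ i : Fin n, i ≠ l → (i : ℕ) ≠ l := fun i h h' => h (Fin.ext h')
  refine Runs.seq (Runs.straight (Q := I 0) rfl (by decide) ?_) fun s₆ hf₆ h₆ => ?_
  · refine ⟨Nat.zero_le _, ?_, fun i h => ?_, ?_, fun i h => ?_⟩
    · simp [Prog.eval]
    · simp [Prog.eval, hI.1 i]
    · simp [Prog.eval, hk', hi₅.report, e13]
    · simp [Prog.eval, hk', hne i h]
  have hi₆ := hi₅.of_frame hf₆ rfl rfl rfl rfl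
  have e4 : s₆.nat 4 0 0 = l := by rw [hf₆.nat 4 rfl, hk']
  refine Runs.seq ((Runs.loop (n := ⌈(v l : ℝ) / ε⌉₊) I h₆ fun k s₇ hf₇ h₇ hb => ?_).mono
    (Nat.add_le_add_right (Nat.mul_le_mul_right _ (hq l)) 1) fun _ _ h => h) fun s₇ hf₇ h₇ => ?_
  · have hi₇ := hi₆.of_frame hf₇ rfl rfl rfl rfl
    have e4' : s₇.nat 4 0 0 = l := by rw [hf₇.nat 4 rfl, e4]
    have hlt : (k : ℝ) * ε < v l := by
      simpa [Test.Holds, RealExpr.value, NatExpr.value, e4', hi₇.report, h₇.2.1] using hb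
    have hk₁ : k < ⌈(v l : ℝ) / ε⌉₊ := by
      rw [Nat.lt_ceil, lt_div_iff₀ hε]; exact hlt
    refine ⟨hk₁, (runs_cell hi₇ (l := l) (by positivity) e4' h₇.2.1 h₇.2.2.1).mono le_rfl
      fun s₈ hf₈ h₈ => ⟨hk₁, ?_, h₈.2.1, ?_, fun i h => ?_⟩⟩
    · rw [h₈.1]; push_cast; ring
    · rw [h₈.2.2, if_pos rfl, h₇.2.2.2.1, Finset.sum_range_succ, ← sub_sub]
    · rw [h₈.2.2, if_neg h, h₇.2.2.2.2 i h]
  · obtain ⟨k', ⟨hk₁, hz, hw₇, hp, hp'⟩, hb⟩ := h₇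
    have hi₇ := hi₆.of_frame hf₇ rfl rfl rfl rfl
    have e4' : s₇.nat 4 0 0 = l := by rw [hf₇.nat 4 rfl, e4]
    have hle : (v l : ℝ) ≤ k' * ε := by
      simpa [Test.Holds, RealExpr.value, NatExpr.value, e4', hi₇.report, hz] using hb
    have hk₂ : k' = ⌈(v l : ℝ) / ε⌉₊ :=
      le_antisymm hk₁ (Nat.ceil_le.2 ((div_le_iff₀ hε).2 hle))
    refine (runs_score (i := l) (z := v l) (by simpa using e4')
      (by simpa [RealExpr.value, NatExpr.value, e4'] using hi₇.report l)).mono le_rfl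
      fun s₈ hf₈ h₈ => ⟨fun i => ?_, fun i hil => ?_⟩
    · rw [h₈, Store.writeReal_real]
      by_cases h : i = l
      · subst h; simp [scores]
      · rw [if_neg (by simpa [Fin.ext_iff] using h), hw₇ i h]
    · rw [hf₈.real 3 rfl]
      by_cases h : i = l
      · subst h
        rw [hp, hk₂]; rfl
      · rw [hp' i h, hI.2 i (by have := hne i h; omega)]

theorem isMeasurable_priorOracle (D : Fin n → ValueDist) : (priorOracle D).IsMeasurable where
  cdf i := by
    by_cases h : i < n
    · have e : (priorOracle D).cdf i = fun x =>
          if 0 ≤ x then ((D ⟨i, h⟩).cdf x.toNNReal).toReal else 0 := by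
        funext x
        by_cases hx : 0 ≤ x
        · simp [priorOracle, h, hx, Real.toNNReal_of_nonneg hx]; rfl
        · simp [priorOracle, hx]
      rw [e]
      exact Measurable.ite measurableSet_Ici
        ((D ⟨i, h⟩).measurable_cdf.comp measurable_real_toNNReal).ennreal_toReal measurable_const
    · have e : (priorOracle D).cdf i = fun _ => 0 := by funext x; simp [priorOracle, h]
      rw [e]
      exact measurable_const
  pdf i := by
    by_cases h : i < n
    · have e : (priorOracle D).pdf i = fun x =>
          if 0 ≤ x then ((D ⟨i, h⟩).pdf x.toNNReal : ℝ) else 0 := by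
        funext x
        by_cases hx : 0 ≤ x
        · simp [priorOracle, h, hx, Real.toNNReal_of_nonneg hx]; rfl
        · simp [priorOracle, hx]
      rw [e]
      exact Measurable.ite measurableSet_Ici
        ((D ⟨i, h⟩).measurable_pdf.comp measurable_real_toNNReal).coe_nnreal_real measurable_const
    · have e : (priorOracle D).pdf i = fun _ => 0 := by funext x; simp [priorOracle, h]
      rw [e]
      exact measurable_const

/-! ### Polynomial time bounds -/

/-- Functions that are bounded by a polynomial. -/
def PolyBounded (f : ℕ → ℕ) : Prop := ∃ P : Polynomial ℕ, ∀ k, f k ≤ P.eval k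

namespace PolyBounded

variable {f g : ℕ → ℕ}

theorem const (a : ℕ) : PolyBounded fun _ => a := ⟨.C a, fun k => by simp⟩

theorem id : PolyBounded fun k => k := ⟨.X, fun k => by simp⟩

theorem add (hf : PolyBounded f) (hg : PolyBounded g) : PolyBounded fun k => f k + g k := by
  obtain ⟨P, hP⟩ := hf
  obtain ⟨Q, hQ⟩ := hg
  exact ⟨P + Q, fun k => by rw [Polynomial.eval_add]; exact Nat.add_le_add (hP k) (hQ k)⟩

theorem mul (hf : PolyBounded f) (hg : PolyBounded g) : PolyBounded fun k => f k * g k := by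
  obtain ⟨P, hP⟩ := hf
  obtain ⟨Q, hQ⟩ := hg
  exact ⟨P * Q, fun k => by rw [Polynomial.eval_mul]; exact Nat.mul_le_mul (hP k) (hQ k)⟩

end PolyBounded

theorem polyBounded_newtonTime : PolyBounded fun k => newtonTime k k := by
  unfold newtonTime NewtonState.stepBound newtonBound newtonStepTime matchTime initTime
    MatchState.stepBound stepTime
  repeat first | exact .const _ | exact .id | refine .add ?_ ?_ | refine .mul ?_ ?_

theorem polyBounded_vcgTime : PolyBounded fun k => vcgTime k k := by
  have := polyBounded_newtonTime
  unfold vcgTime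
  repeat first | exact this | exact .const _ | exact .id | refine .add ?_ ?_ | refine .mul ?_ ?_

theorem polyBounded_myersonTime : PolyBounded fun k => myersonTime k k k := by
  have := polyBounded_newtonTime
  unfold myersonTime cellTime
  repeat first | exact this | exact .const _ | exact .id | refine .add ?_ ?_ | refine .mul ?_ ?_

theorem newtonTime_mono {n' m' : ℕ} (hn : n ≤ n') (hm : m ≤ m') :
    newtonTime n m ≤ newtonTime n' m' := by
  unfold newtonTime NewtonState.stepBound newtonBound newtonStepTime matchTime initTime
    MatchState.stepBound stepTime
  gcongr

theorem vcgTime_mono {n' m' : ℕ} (hn : n ≤ n') (hm : m ≤ m') : vcgTime n m ≤ vcgTime n' m' := by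
  have := newtonTime_mono hn hm
  unfold vcgTime
  gcongr

theorem myersonTime_mono {n' m' q q' : ℕ} (hn : n ≤ n') (hm : m ≤ m') (hq : q ≤ q') :
    myersonTime n m q ≤ myersonTime n' m' q' := by
  have := newtonTime_mono hn hm
  unfold myersonTime cellTime
  gcongr

end PositionAuction

end

open PositionAuction in
/-- Optimal auctions in the multinomial logit model. -/
theorem theorem1 :
    -- a welfare-maximizing auction that is polynomial-time computable, IC and IR
    (∃ (c : RealRAM.Prog) (P : Polynomial ℕ),
      ∀ (n m : ℕ) (A : PositionAuction n m),
      ∃ M : A.Mechanism,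
        M.IsIC ∧ M.IsIR ∧
        (∀ (v : Fin n → ℝ≥0) (x : A.Allocation),
          ∑ i, (v i : ℝ) * A.clickRate x i ≤ ∑ i, (v i : ℝ) * M.clickProb v i) ∧
        (∀ (D : Fin n → ValueDist) (M' : A.Mechanism),
          M'.IsIC → M'.IsIR → M'.welfare D ≤ M.welfare D) ∧
        ∀ v : Fin n → ℝ≥0, M.ComputedBy c RealRAM.Oracle.none 0 v (P.eval (n + m))) ∧
    -- a revenue-maximizing auction that is polynomial-time computable, ε-IC and IR
    (∃ (c : RealRAM.Prog) (P : Polynomial ℕ),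
      ∀ (n m : ℕ) (A : PositionAuction n m) (D : Fin n → ValueDist),
      (∀ i, (D i).IsRegular) → (∀ i, (D i).HasFiniteMean) →
      ∀ ε : ℝ, 0 < ε →
      ∃ M : A.Mechanism,
        M.IsApproxIC ε ∧ M.IsIR ∧
        (∀ (v : Fin n → ℝ≥0) (x : A.Allocation),
          ∑ i, (A.clickRate x i : EReal) * (D i).virtualValue (v i) ≤
            ∑ i, (M.clickProb v i : EReal) * (D i).virtualValue (v i)) ∧
        (∀ (v : Fin n → ℝ≥0) (i : Fin n),
          |(M.pay v i : ℝ) - (v i * M.clickProb v i -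
            ∫ z in (0 : ℝ)..(v i), M.clickProb (Function.update v i z.toNNReal) i)| ≤ ε) ∧
        (∀ M' : A.Mechanism, M'.IsIC → M'.IsIR → M'.revenue D ≤ M.revenue D) ∧
        ∀ v : Fin n → ℝ≥0,
          M.ComputedBy c (PositionAuction.priorOracle D) ε v
            (P.eval (n + m + ⌈(Finset.univ.sup v : ℝ≥0) / ε⌉₊))) := by
  refine ⟨?_, ?_⟩
  · obtain ⟨P, hP⟩ := polyBounded_vcgTime
    refine ⟨RealRAM.vcgProg, P, fun n m A => ?_⟩
    obtain ⟨M, hy, hp, hc⟩ := Mechanism.exists_of_runs (A := A) (c := RealRAM.vcgProg) (ε := 0)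
      (O := RealRAM.Oracle.none) ⟨fun _ => measurable_const, fun _ => measurable_const⟩
      (fun v => A.best fun k => (v k : ℝ)) (fun v i => ⟨_, Mechanism.vcg_pay_nonneg A v i⟩)
      (fun _ => P.eval (n + m)) fun v => (runs_vcg A v 0).mono
        ((vcgTime_mono (Nat.le_add_right n m) (Nat.le_add_left m n)).trans (hP (n + m)))
        fun _ _ h => h
    have hp' : ∀ v i, (M.pay v i : ℝ) = A.bestValue (fun k => (Function.update v i 0 k : ℝ)) -
        A.bestValue (fun k => (v k : ℝ)) +
        v i * A.clickRate (A.best fun k => (v k : ℝ)) i := fun v i => by rw [hp]; rfl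
    have hopt : ∀ (v : Fin n → ℝ≥0) (x : A.Allocation),
        ∑ i, (v i : ℝ) * A.clickRate x i ≤ ∑ i, (v i : ℝ) * M.clickProb v i := fun v x => by
      simp only [hy]
      rw [sum_best A fun k => (v k : ℝ)]
      exact sum_le_bestValue (fun k => (v k : ℝ)) x
    refine ⟨M, Mechanism.vcg_isIC hy hp', Mechanism.vcg_isIR hy hp', hopt, fun D M' _ _ => ?_, hc⟩
    exact lintegral_mono fun v => ENNReal.ofReal_le_ofReal (M'.sum_mul_clickProb_le v (hopt v))
  · obtain ⟨P, hP⟩ := polyBounded_myersonTime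
    refine ⟨RealRAM.myersonProg, P, fun n m A D hreg hmean ε hε => ?_⟩
    have hpay : ∀ (v : Fin n → ℝ≥0) (i : Fin n),
        0 ≤ v i * A.clickRate (A.best (scores D v)) i -
          lowerSum ε (v i) (A.scoreCurve D v i) := fun v i => by
      have h := lowerSum_le_mul (monotone_scoreCurve (A := A) hreg v i) hε (v i).2
      have e : A.scoreCurve D v i (v i) = A.clickRate (A.best (scores D v)) i := by
        rw [scoreCurve, ← scores_update, Real.toNNReal_coe, Function.update_eq_self]
      rw [NNReal.val_eq_coe, e] at h
      linarith
    obtain ⟨M, hy, hp, hc⟩ := Mechanism.exists_of_runs (A := A) (c := RealRAM.myersonProg) (ε := ε)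
      (isMeasurable_priorOracle D) (fun v => A.best (scores D v)) (fun v i => ⟨_, hpay v i⟩)
      (fun v => P.eval (n + m + ⌈(Finset.univ.sup v : ℝ≥0) / ε⌉₊)) fun v =>
        (runs_myerson A D v hε fun l => Nat.ceil_mono (div_le_div_of_nonneg_right
          (NNReal.coe_le_coe.2 (Finset.le_sup (Finset.mem_univ l))) hε.le)).mono
        ((myersonTime_mono (by omega) (by omega) (by omega)).trans
          (hP (n + m + ⌈(Finset.univ.sup v : ℝ≥0) / ε⌉₊))) fun _ _ h => h
    have hmono : ∀ r i, Monotone (M.curve r i) := fun r i => by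
      rw [Mechanism.curve_eq_scoreCurve hy]
      exact monotone_scoreCurve hreg r i
    have hsum : M.HasLowerSumPayments ε := fun r i => by
      rw [hp, hy, Mechanism.curve_eq_scoreCurve hy]; rfl
    refine ⟨M, hsum.isApproxIC hε hmono, hsum.isIR hε, Mechanism.virtualSurplus_le hy,
      hsum.abs_pay_sub_le hε hmono, fun M' hic hir => ?_, hc⟩
    refine Mechanism.revenue_le hmean hic hir hmono (hsum.pay_ge hε hmono)
      (Mechanism.clickProb_eq_zero_of_mills hy) fun v => ?_
    refine M'.sum_mul_clickProb_le v fun x => (sum_le_bestValue (scores D v) x).trans_eq ?_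
    simp only [hy]
    exact (sum_best A (scores D v)).symm
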